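/- Let $k$ be a field, let $\phi:A\to B$ be a surjective morphism of associative unital $k$-algebras, and let $I=\ker\phi$. All tensor products without subscript are over $k$; $\Lambda^e=\Lambda\otimes\Lambda^{op}$ denotes the enveloping algebra of an algebra $\Lambda$, whose left modules are the $\Lambda$-bimodules, and $H^p(B,M)=\mathrm{Ext}^p_{B^e}(B,M)$ for a $B$-bimodule $M$. The quotient $I/I^2=\ker(A/I^2\to B)$ is a $B$-bimodule through $\phi(a)\cdot\bar x\cdot\phi(a')=\overline{axa'}$. The group $\mathrm{Tor}^A_q(B,B)$ is a $B$-bimodule through the left factor and, by functoriality, the right factor. *The class $O_1(\phi)$.* Let $X_\bullet\to A$ be a resolution of $A$ by projective $A^e$-modules, so that the $q$-th homology of $B^e\otimes_{A^e}X_\bullet$ is $\mathrm{Tor}_q^{A^e}(B^e,A)$, and let $N\to Y^\bullet$ be an injective resolution of a $B^e$-module $N$. The double complex $D^{p,q}=\mathrm{Hom}_{B^e}(B^e\otimes_{A^e}X_q,Y^p)$, with the anticommuting differentials $\delta''f=d_Y\circ f$ and $\delta'f=-(-1)^{p+q}f\circ d_X$, has a spectral sequence with $$E_2^{p,q}=H^p(H^q(D,\delta'),\delta'')\cong\mathrm{Ext}^p_{B^e}(\mathrm{Tor}_q^{A^e}(B^e,A),N),$$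 and its differential $d_2^{p,q}:E_2^{p,q}\to E_2^{p+2,q-1}$ sends the class of $a$ to the class of $\delta''b$ whenever $\delta'b=\delta''a$. The class $$O_1(\phi)\in\mathrm{Ext}^2_{B^e}\big(\mathrm{Tor}_0^{A^e}(B^e,A),\mathrm{Tor}_1^{A^e}(B^e,A)\big)$$ is the image $d_2^{0,1}(\mathrm{id})$ of the identity of $N=\mathrm{Tor}_1^{A^e}(B^e,A)$. (It is the class for which $d_2^{p,1}(\zeta)=(-1)^p\,\zeta\circ O_1(\phi)$ for all $N$, $p$ and $\zeta$.) **Proposition.** There are isomorphisms of $B$-bimodules $$\kappa_q:\mathrm{Tor}_q^{A^e}(B^e,A)\cong\mathrm{Tor}^A_q(B,B)\ (q\ge0),\qquad e_0:\mathrm{Tor}_0^A(B,B)\cong B,\qquad e_1:\mathrm{Tor}_1^A(B,B)\cong I/I^2$$ with the following properties. 1. Let $X_\bullet\to A$ be a resolution by projective $A^e$-modules, $P_\bullet\to B$ a resolution by projective left $A$-modules, and $g:X_\bullet\to P_\bullet$ a morphism of complexes of left $A$-modules that lies over $\phi:A\to B$ and vanishes on $X_\bullet I$. If $x\in X_q$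 is such that $1\otimes x$ and $1\otimes g(x)$ are cycles of $B^e\otimes_{A^e}X_\bullet$ and $B\otimes_AP_\bullet$, then $\kappa_q[1\otimes x]=[1\otimes g(x)]$. 2. For every resolution $\pi:P_\bullet\to B$ by projective left $A$-modules, $e_0[b\otimes y]=b\,\pi(y)$ for all $b\in B$ and $y\in P_0$. 3. For every such resolution, if $\xi\in P_0$, $\eta\in P_1$ and $x\in I$ satisfy $\pi(\xi)=1$ and $d\eta=x\xi$, then $1\otimes\eta$ being a cycle of $B\otimes_AP_\bullet$, one has $e_1[1\otimes\eta]=\bar x$, the class of $x$ in $I/I^2$. 4. Under the identifications $e_0\kappa_0$ and $e_1\kappa_1$, the class $O_1(\phi)$, computed with arbitrary resolutions $X_\bullet$ of $A$ and $Y^\bullet$ of $\mathrm{Tor}_1^{A^e}(B^e,A)$, becomes the characteristic class in $H^2(B,I/I^2)$ of the singular extension $$0\to I/I^2\to A/I^2\to B\to0,$$ that is, for every $k$-linear section $\sigma:B\to A/I^2$ of the projection, the class of the Hochschild $2$-cocycle $f(b,b')=\sigma(b)\sigma(b')-\sigma(bb')$, which is the class of the morphism $b_0\otimes b_1\otimes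 b_2\otimes b_3\mapsto b_0f(b_1,b_2)b_3$ on the degree $2$ term $B^{\otimes4}$ of the bar resolution of $B$ (with $d(b_0\otimes\cdots\otimes b_{n+1})=\sum_i(-1)^ib_0\otimes\cdots\otimes b_ib_{i+1}\otimes\cdots\otimes b_{n+1}$). -/

import Mathlib

open CategoryTheory TensorProduct MulOpposite

universe u v w

noncomputable section


/-- A first quadrant double cochain complex of abelian groups with anticommuting
differentials: `δ'` is the differential of the initial term `E₀` of the spectral sequence of the
filtration by the first index, and `δ''` raises the filtration index. -/
structure DoubleComplex where
  X : ℕ → ℕ → Type u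
  [grp : ∀ p q, AddCommGroup (X p q)]
  δ' : ∀ p q, X p q →+ X p (q + 1)
  δ'' : ∀ p q, X p q →+ X (p + 1) q
  δ'_δ' : ∀ p q x, δ' p (q + 1) (δ' p q x) = 0
  δ''_δ'' : ∀ p q x, δ'' (p + 1) q (δ'' p q x) = 0
  anticomm : ∀ p q x, δ'' p (q + 1) (δ' p q x) = -δ' (p + 1) q (δ'' p q x)

namespace DoubleComplex

attribute [instance] DoubleComplex.grp

variable (D : DoubleComplex.{u})

/-- The image of `δ'` in bidegree `(p, q)`. -/
def im' (p : ℕ) : ∀ q : ℕ, AddSubgroup (D.X p q)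
  | 0 => ⊥
  | q + 1 => (D.δ' p q).range

/-- The image under `δ''`, in bidegree `(p, q)`, of the `δ'`-cocycles. -/
def im'' : ∀ p q : ℕ, AddSubgroup (D.X p q)
  | 0, _ => ⊥
  | p + 1, q => (D.δ' p q).ker.map (D.δ'' p q)

/-- Representatives of the elements of the term `E₂` : the `δ'`-cocycles `a` such that `δ'' a` is
a `δ'`-coboundary. -/
def Z₂ (p q : ℕ) : AddSubgroup (D.X p q) :=
  (D.δ' p q).ker ⊓ (D.im' (p + 1) q).comap (D.δ'' p q)

/-- The representatives of zero in the term `E₂`. -/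
def B₂ (p q : ℕ) : AddSubgroup (D.X p q) := D.im' p q ⊔ D.im'' p q

/-- The term `E₂^{p,q} = H^p(H^q(D, δ'), δ'')` of the spectral sequence. -/
abbrev E₂ (p q : ℕ) : Type u := D.Z₂ p q ⧸ (D.B₂ p q).addSubgroupOf (D.Z₂ p q)

variable {D}

lemma δ''_mem_Z₂ {p q : ℕ} {a : D.X p (q + 1)} {b : D.X (p + 1) q}
    (h : D.δ' (p + 1) q b = D.δ'' p (q + 1) a) : D.δ'' (p + 1) q b ∈ D.Z₂ (p + 2) q := by
  refine ⟨?_, ?_⟩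
  · have h1 := D.anticomm (p + 1) q b
    rw [h, D.δ''_δ''] at h1
    exact neg_eq_zero.1 h1.symm
  · change D.δ'' (p + 2) q (D.δ'' (p + 1) q b) ∈ D.im' (p + 3) q
    rw [D.δ''_δ'']
    exact zero_mem _

lemma exists_zigzag {p q : ℕ} (a : D.Z₂ p (q + 1)) :
    ∃ b : D.X (p + 1) q, D.δ' (p + 1) q b = D.δ'' p (q + 1) a := a.2.2

lemma δ''_mem_B₂ {p q : ℕ} {a : D.X p (q + 1)} (ha : a ∈ D.B₂ p (q + 1)) {b : D.X (p + 1) q}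
    (h : D.δ' (p + 1) q b = D.δ'' p (q + 1) a) : D.δ'' (p + 1) q b ∈ D.B₂ (p + 2) q := by
  obtain ⟨x, ⟨e, rfl⟩, y, hy, rfl⟩ := AddSubgroup.mem_sup.1 ha
  have hy0 : D.δ'' p (q + 1) y = 0 := by
    cases p with
    | zero => rw [AddSubgroup.mem_bot.1 hy, map_zero]
    | succ p => obtain ⟨c, -, rfl⟩ := hy; exact D.δ''_δ'' _ _ _
  rw [map_add, hy0, add_zero, D.anticomm] at h
  have hk : b + D.δ'' p q e ∈ (D.δ' (p + 1) q).ker := by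
    rw [AddMonoidHom.mem_ker, map_add, h, neg_add_cancel]
  refine AddSubgroup.mem_sup_right ⟨_, hk, ?_⟩
  rw [map_add, D.δ''_δ'', add_zero]

variable (D)

/-- The differential `d₂` of the term `E₂` : if `a` represents a class in `E₂^{p,q+1}` and
`δ' b = δ'' a`, then `δ'' b` represents its image in `E₂^{p+2,q}`. -/
def d₂ (p q : ℕ) : D.E₂ p (q + 1) →+ D.E₂ (p + 2) q :=
  QuotientAddGroup.lift _
    (AddMonoidHom.mk'
      (fun a => (QuotientAddGroup.mk
        (⟨D.δ'' (p + 1) q (exists_zigzag a).choose, δ''_mem_Z₂ (exists_zigzag a).choose_spec⟩ :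
          D.Z₂ (p + 2) q) : D.E₂ (p + 2) q))
      (fun a a' => by
        rw [← QuotientAddGroup.mk_add, QuotientAddGroup.eq, AddSubgroup.mem_addSubgroupOf]
        have h : D.δ' (p + 1) q (-(exists_zigzag (a + a')).choose +
            ((exists_zigzag a).choose + (exists_zigzag a').choose)) =
              D.δ'' p (q + 1) (0 : D.X p (q + 1)) := by
          rw [map_add, map_neg, map_add, (exists_zigzag (a + a')).choose_spec,
            (exists_zigzag a).choose_spec, (exists_zigzag a').choose_spec]
          simp
        simpa using δ''_mem_B₂ (zero_mem _) h))
    (fun a ha => by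
      refine (QuotientAddGroup.eq_zero_iff _).2 ?_
      rw [AddSubgroup.mem_addSubgroupOf]
      exact δ''_mem_B₂ (AddSubgroup.mem_addSubgroupOf.1 ha) (exists_zigzag a).choose_spec)

variable {D} in
lemma d₂_mk {p q : ℕ} (a : D.Z₂ p (q + 1)) (b : D.X (p + 1) q)
    (h : D.δ' (p + 1) q b = D.δ'' p (q + 1) a) :
    D.d₂ p q (QuotientAddGroup.mk a) =
      QuotientAddGroup.mk (⟨D.δ'' (p + 1) q b, δ''_mem_Z₂ h⟩ : D.Z₂ (p + 2) q) := by
  refine QuotientAddGroup.eq.2 ?_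
  rw [AddSubgroup.mem_addSubgroupOf]
  have h' : D.δ' (p + 1) q (-(exists_zigzag a).choose + b) =
      D.δ'' p (q + 1) (0 : D.X p (q + 1)) := by
    rw [map_add, map_neg, (exists_zigzag a).choose_spec, h]
    simp
  simpa using δ''_mem_B₂ (zero_mem _) h'

end DoubleComplex

section ChangeOfRings

variable {C : Type u} [Category.{v} C] [Abelian C]

/-- The double complex `Hom(K_q, Y^p)`, with the usual signs: `δ'' f = d_Y ∘ f` and
`δ' f = -(-1)^{p+q} f ∘ d_K`, so that `δ' + δ''` is the differential of the complex `Hom(K, Y)`. -/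
def homDouble (K : ChainComplex C ℕ) (Y : CochainComplex C ℕ) : DoubleComplex.{v} where
  X p q := K.X q ⟶ Y.X p
  δ' p q := AddMonoidHom.mk' (fun f => (-1 : ℤ) ^ (p + q + 1) • (K.d (q + 1) q ≫ f))
    (fun f g => by simp)
  δ'' p q := AddMonoidHom.mk' (fun f => f ≫ Y.d p (p + 1)) (fun f g => by simp)
  δ'_δ' p q f := by simp
  δ''_δ'' p q f := by simp
  anticomm p q f := by
    simp only [AddMonoidHom.mk'_apply, Preadditive.zsmul_comp, Category.assoc]
    rw [← neg_zsmul]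
    congr 1
    ring

variable (K : ChainComplex C ℕ) {N : C} (Y : InjectiveResolution N)

lemma d_comp_eq_zero_of_δ' {p q : ℕ} {a : K.X q ⟶ Y.cocomplex.X p}
    (h : (homDouble K Y.cocomplex).δ' p q a = 0) : K.d (q + 1) q ≫ a = 0 := by
  have h' : (-1 : ℤ) ^ (p + q + 1) • (K.d (q + 1) q ≫ a) = 0 := h
  rcases neg_one_pow_eq_or ℤ (p + q + 1) with h1 | h1 <;> simpa [h1] using h'

/-- The morphism `H_q(K) ⟶ Y^p` induced by a morphism `K_q ⟶ Y^p` that vanishes on boundaries. -/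
def inducedOnHomology {p q : ℕ} (a : K.X q ⟶ Y.cocomplex.X p) (h : K.d (q + 1) q ≫ a = 0) :
    K.homology q ⟶ Y.cocomplex.X p :=
  K.homologyι q ≫ K.descOpcycles a (q + 1) (by simp) h

lemma inducedOnHomology_spec {p q : ℕ} (a : K.X q ⟶ Y.cocomplex.X p)
    (h : K.d (q + 1) q ≫ a = 0) :
    K.homologyπ q ≫ inducedOnHomology K Y a h = K.iCycles q ≫ a := by
  simp [inducedOnHomology]

lemma inducedOnHomology_eq_zero_iff {p q : ℕ} (a : K.X q ⟶ Y.cocomplex.X p)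
    (h : K.d (q + 1) q ≫ a = 0) :
    inducedOnHomology K Y a h = 0 ↔ a ∈ (homDouble K Y.cocomplex).im' p q := by
  constructor
  · intro h0
    cases q with
    | zero =>
      have h1 := inducedOnHomology_spec K Y a h
      rw [h0, Limits.comp_zero] at h1
      have : IsIso (K.iCycles 0) := K.isIso_iCycles 0 0 (by simp) (by simp)
      have h2 : a = 0 := (cancel_epi (K.iCycles 0)).1 (by rw [← h1, Limits.comp_zero])
      exact AddSubgroup.mem_bot.2 h2
    | succ q =>
      let S := ShortComplex.mk (K.homologyι (q + 1)) (K.fromOpcycles (q + 1) q) (by simp)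
      have hS : S.Exact := S.exact_of_f_is_kernel (K.homologyIsKernel (q + 1) q (by simp))
      have hg := hS.comp_descToInjective (K.descOpcycles a (q + 2) (by simp) h) h0
      refine ⟨(-1 : ℤ) ^ (p + q + 1) •
        hS.descToInjective (K.descOpcycles a (q + 2) (by simp) h) h0, ?_⟩
      change (-1 : ℤ) ^ (p + q + 1) • (K.d (q + 1) q ≫ (_ : K.X q ⟶ _)) = a
      rw [Preadditive.comp_zsmul, smul_smul, ← mul_pow, neg_one_mul, neg_neg, one_pow, one_smul,
        ← K.p_fromOpcycles, Category.assoc]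
      rw [show K.fromOpcycles (q + 1) q ≫ hS.descToInjective _ h0 = _ from hg]
      simp
  · intro ha
    rw [← cancel_epi (K.homologyπ q), inducedOnHomology_spec, Limits.comp_zero]
    cases q with
    | zero =>
      have h2 : a = 0 := AddSubgroup.mem_bot.1 ha
      rw [h2, Limits.comp_zero]
    | succ q =>
      obtain ⟨b, hb⟩ := ha
      change K.X q ⟶ Y.cocomplex.X p at b
      have hb' : (-1 : ℤ) ^ (p + q + 1) • (K.d (q + 1) q ≫ b) = a := hb
      rw [← hb', Preadditive.comp_zsmul, K.iCycles_d_assoc, Limits.zero_comp, smul_zero]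

lemma exists_inducedOnHomology {p q : ℕ} (f : K.homology q ⟶ Y.cocomplex.X p) :
    ∃ (a : K.X q ⟶ Y.cocomplex.X p) (h : K.d (q + 1) q ≫ a = 0), inducedOnHomology K Y a h = f := by
  refine ⟨K.pOpcycles q ≫ Injective.factorThru f (K.homologyι q), by simp, ?_⟩
  rw [← cancel_epi (K.homologyπ q), inducedOnHomology_spec]
  rw [← K.homology_π_ι_assoc, Injective.comp_factorThru]

lemma inducedOnHomology_comp {p q : ℕ} (a : K.X q ⟶ Y.cocomplex.X p)
    (h : K.d (q + 1) q ≫ a = 0) (h' : K.d (q + 1) q ≫ a ≫ Y.cocomplex.d p (p + 1) = 0) :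
    inducedOnHomology K Y (a ≫ Y.cocomplex.d p (p + 1)) h' =
      inducedOnHomology K Y a h ≫ Y.cocomplex.d p (p + 1) := by
  rw [← cancel_epi (K.homologyπ q), inducedOnHomology_spec, ← Category.assoc, ← Category.assoc,
    inducedOnHomology_spec]

lemma inducedOnHomology_add {p q : ℕ} (a b : K.X q ⟶ Y.cocomplex.X p)
    (ha : K.d (q + 1) q ≫ a = 0) (hb : K.d (q + 1) q ≫ b = 0)
    (hab : K.d (q + 1) q ≫ (a + b) = 0) :
    inducedOnHomology K Y (a + b) hab = inducedOnHomology K Y a ha + inducedOnHomology K Y b hb := by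
  rw [← cancel_epi (K.homologyπ q), Preadditive.comp_add]
  simp only [inducedOnHomology_spec, Preadditive.comp_add]

lemma inducedOnHomology_cocycle {p q : ℕ} {a : K.X q ⟶ Y.cocomplex.X p}
    (ha : a ∈ (homDouble K Y.cocomplex).Z₂ p q) :
    inducedOnHomology K Y a (d_comp_eq_zero_of_δ' K Y ha.1) ≫ Y.cocomplex.d p (p + 1) = 0 := by
  have h0 := d_comp_eq_zero_of_δ' K Y ha.1
  rw [← inducedOnHomology_comp K Y a h0 (by rw [← Category.assoc, h0, Limits.zero_comp])]
  exact (inducedOnHomology_eq_zero_iff K Y _ _).2 ha.2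

variable [HasExt.{w} C]

/-- The map `Z₂^{p,q} → Ext^p(H_q(K), N)` : a morphism `K_q ⟶ Y^p` in `Z₂^{p,q}` induces a morphism
`H_q(K) ⟶ Y^p` that is a cocycle of the complex `Hom(H_q(K), Y)`. -/
def E₂ToExtAux (p q : ℕ) :
    (homDouble K Y.cocomplex).Z₂ p q →+ Abelian.Ext.{w} (K.homology q) N p :=
  AddMonoidHom.mk'
    (fun a => Y.extMk (inducedOnHomology K Y a.1 (d_comp_eq_zero_of_δ' K Y a.2.1)) (p + 1) rfl
      (inducedOnHomology_cocycle K Y a.2))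
    (fun a b => by
      rw [Y.add_extMk]
      congr 1
      exact inducedOnHomology_add K Y _ _ _ _ _)

lemma E₂ToExtAux_surjective (p q : ℕ) : Function.Surjective (E₂ToExtAux K Y p q) := by
  intro x
  obtain ⟨f, hf, rfl⟩ := Y.extMk_surjective x (p + 1) rfl
  obtain ⟨a, ha, rfl⟩ := exists_inducedOnHomology K Y f
  have h2 : K.d (q + 1) q ≫ a ≫ Y.cocomplex.d p (p + 1) = 0 := by
    rw [← Category.assoc, ha, Limits.zero_comp]
  refine ⟨⟨a, ?_, ?_⟩, rfl⟩
  · change (-1 : ℤ) ^ (p + q + 1) • (K.d (q + 1) q ≫ a) = 0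
    rw [ha, smul_zero]
  · refine (inducedOnHomology_eq_zero_iff K Y _ h2).1 ?_
    rw [inducedOnHomology_comp K Y a ha h2, hf]

lemma E₂ToExtAux_ker (p q : ℕ) :
    (E₂ToExtAux K Y p q).ker =
      ((homDouble K Y.cocomplex).B₂ p q).addSubgroupOf ((homDouble K Y.cocomplex).Z₂ p q) := by
  ext ⟨a, haZ⟩
  change K.X q ⟶ Y.cocomplex.X p at a
  have ha := d_comp_eq_zero_of_δ' K Y haZ.1
  rw [AddMonoidHom.mem_ker, AddSubgroup.mem_addSubgroupOf]
  change Y.extMk (inducedOnHomology K Y a ha) (p + 1) rfl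
    (inducedOnHomology_cocycle K Y haZ) = 0 ↔ a ∈ (homDouble K Y.cocomplex).B₂ p q
  cases p with
  | zero =>
    rw [DoubleComplex.B₂, show (homDouble K Y.cocomplex).im'' 0 q = ⊥ from rfl, sup_bot_eq,
      ← inducedOnHomology_eq_zero_iff K Y a ha]
    constructor
    · intro h
      rw [← Y.extEquivCohomologyClass.apply_eq_iff_eq, Y.extEquivCohomologyClass_extMk,
        Y.extEquivCohomologyClass_zero, CochainComplex.HomComplex.CohomologyClass.mk_eq_zero_iff,
        CochainComplex.HomComplex.Cocycle.fromSingleMk_mem_coboundaries_iff _ _ _ _ _ (-1)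
          (by lia)] at h
      obtain ⟨g, hg⟩ := h
      rw [(Y.cochainComplex.isZero_of_isStrictlyGE 0 (-1) (by lia)).eq_of_tgt g 0,
        Limits.zero_comp] at hg
      exact (cancel_mono (Y.cochainComplexXIso 0 0 rfl).inv).1 (by rw [Limits.zero_comp]; exact hg.symm)
    · intro h
      simp only [h]
      exact Y.extMk_zero _ _
  | succ p =>
    rw [Y.extMk_eq_zero_iff _ _ _ _ p rfl]
    constructor
    · rintro ⟨g, hg⟩
      obtain ⟨c, hc, rfl⟩ := exists_inducedOnHomology K Y g
      have hcd : K.d (q + 1) q ≫ c ≫ Y.cocomplex.d p (p + 1) = 0 := by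
        rw [← Category.assoc, hc, Limits.zero_comp]
      rw [← inducedOnHomology_comp K Y c hc hcd] at hg
      have h1 : a - c ≫ Y.cocomplex.d p (p + 1) ∈ (homDouble K Y.cocomplex).im' (p + 1) q := by
        refine (inducedOnHomology_eq_zero_iff K Y _ (by
          rw [Preadditive.comp_sub, ha, hcd, sub_zero])).1 ?_
        rw [← cancel_epi (K.homologyπ q), inducedOnHomology_spec, Preadditive.comp_sub,
          ← inducedOnHomology_spec K Y a ha, ← inducedOnHomology_spec K Y _ hcd, hg, sub_self,
          Limits.comp_zero]
      refine AddSubgroup.mem_sup.2 ⟨_, h1, c ≫ Y.cocomplex.d p (p + 1), ⟨c, ?_, rfl⟩, ?_⟩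
      · change (-1 : ℤ) ^ (p + q + 1) • (K.d (q + 1) q ≫ c) = 0
        rw [hc, smul_zero]
      · exact sub_add_cancel (G := K.X q ⟶ Y.cocomplex.X (p + 1)) _ _
    · intro h
      obtain ⟨x, hx, y, ⟨c, hc, rfl⟩, hxy⟩ := AddSubgroup.mem_sup.1 h
      change K.X q ⟶ Y.cocomplex.X p at c
      have hc' := d_comp_eq_zero_of_δ' K Y hc
      have hcd : K.d (q + 1) q ≫ c ≫ Y.cocomplex.d p (p + 1) = 0 := by
        rw [← Category.assoc, hc', Limits.zero_comp]
      have hxa : x = a - c ≫ Y.cocomplex.d p (p + 1) := by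
        exact eq_sub_of_add_eq (G := K.X q ⟶ Y.cocomplex.X (p + 1)) hxy
      have hx' : K.d (q + 1) q ≫ x = 0 := by
        rw [hxa, Preadditive.comp_sub, ha, hcd, sub_zero]
      refine ⟨inducedOnHomology K Y c hc', ?_⟩
      have h0 := (inducedOnHomology_eq_zero_iff K Y x hx').2 hx
      rw [← inducedOnHomology_comp K Y c hc' hcd]
      rw [← cancel_epi (K.homologyπ q), inducedOnHomology_spec, inducedOnHomology_spec]
      have h3 := inducedOnHomology_spec K Y x hx'
      rw [h0, Limits.comp_zero, hxa, Preadditive.comp_sub, eq_comm, sub_eq_zero] at h3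
      exact h3.symm

/-- The identification `E₂^{p,q} ≅ Ext^p(H_q(K), N)` for the double complex `Hom(K, Y)`. -/
def E₂EquivExt (p q : ℕ) :
    (homDouble K Y.cocomplex).E₂ p q ≃+ Abelian.Ext.{w} (K.homology q) N p :=
  (QuotientAddGroup.quotientAddEquivOfEq (E₂ToExtAux_ker K Y p q).symm).trans
    (QuotientAddGroup.quotientKerEquivOfSurjective _ (E₂ToExtAux_surjective K Y p q))

/-- The differential `d₂ : Ext^p(H_{q+1}(K), N) → Ext^{p+2}(H_q(K), N)`. -/
def extD₂ (p q : ℕ) :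
    Abelian.Ext.{w} (K.homology (q + 1)) N p →+ Abelian.Ext.{w} (K.homology q) N (p + 2) :=
  ((E₂EquivExt K Y (p + 2) q).toAddMonoidHom.comp ((homDouble K Y.cocomplex).d₂ p q)).comp
    (E₂EquivExt K Y p (q + 1)).symm.toAddMonoidHom

end ChangeOfRings
section Tor

variable {R S : Type u} [Ring R] [Ring S] (f : R →+* S)

/-- The relations `s f(r) ⊗ m = s ⊗ r m` defining `S ⊗_R M` as a quotient of `S ⊗_ℤ M`. -/
def baseChangeRel (M : Type u) [AddCommGroup M] [Module R M] : Submodule S (S ⊗[ℤ] M) :=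
  Submodule.span S
    {x | ∃ (s : S) (r : R) (m : M), x = (s * f r) ⊗ₜ[ℤ] m - s ⊗ₜ[ℤ] (r • m)}

/-- The left `S`-module `S ⊗_R M`, for a left `R`-module `M` and a morphism of (noncommutative)
rings `f : R → S`. -/
abbrev BaseChange (M : Type u) [AddCommGroup M] [Module R M] : Type u :=
  (S ⊗[ℤ] M) ⧸ baseChangeRel f M

variable {M M' : Type u} [AddCommGroup M] [Module R M] [AddCommGroup M'] [Module R M']

/-- The element `s ⊗ m` of `S ⊗_R M`. -/
def baseChangeMk (s : S) (m : M) : BaseChange f M :=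
  (baseChangeRel f M).mkQ (s ⊗ₜ[ℤ] m)

/-- The morphism `S ⊗_R M → S ⊗_R M'` induced by a morphism `M → M'`. -/
def baseChangeMap (g : M →ₗ[R] M') : BaseChange f M →ₗ[S] BaseChange f M' :=
  Submodule.mapQ _ _
    (TensorProduct.AlgebraTensorModule.map (LinearMap.id : S →ₗ[S] S) (g.restrictScalars ℤ))
    (Submodule.span_le.2 (by
      rintro _ ⟨s, r, m, rfl⟩
      refine Submodule.subset_span ⟨s, r, g m, ?_⟩
      simp))

lemma baseChangeMap_mk (g : M →ₗ[R] M') (s : S) (m : M) :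
    baseChangeMap f g (baseChangeMk f s m) = baseChangeMk f s (g m) := rfl

variable {f} in
lemma baseChange_hom_ext {N : Type u} [AddCommGroup N] [Module S N]
    {g h : BaseChange f M →ₗ[S] N}
    (H : ∀ s m, g (baseChangeMk f s m) = h (baseChangeMk f s m)) : g = h := by
  refine Submodule.linearMap_qext _ ?_
  ext m
  exact H 1 m

/-- Extension of scalars `S ⊗_R -` along a morphism of rings `f : R → S`. -/
def baseChange : ModuleCat.{u} R ⥤ ModuleCat.{u} S where
  obj M := ModuleCat.of S (BaseChange f M)
  map g := ModuleCat.ofHom (baseChangeMap f g.hom)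
  map_id M := by
    ext1
    exact baseChange_hom_ext fun _ _ => rfl
  map_comp g h := by
    ext1
    exact baseChange_hom_ext fun _ _ => rfl

instance : (baseChange f).Additive where
  map_add {M M' g h} := by
    ext1
    refine baseChange_hom_ext fun s m => ?_
    change baseChangeMk f s (g.hom m + h.hom m) =
      baseChangeMk f s (g.hom m) + baseChangeMk f s (h.hom m)
    simp [baseChangeMk, TensorProduct.tmul_add]

/-- The functor `Tor_q^R(S, -)`, with values in left `S`-modules: the `q`-th left derived functor of
`S ⊗_R -`. -/
abbrev torFunctor (q : ℕ) : ModuleCat.{u} R ⥤ ModuleCat.{u} S := (baseChange f).leftDerived q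

lemma torFunctor_map_add (q : ℕ) {M N : ModuleCat.{u} R} (g h : M ⟶ N) :
    (torFunctor f q).map (g + h) = (torFunctor f q).map g + (torFunctor f q).map h := by
  let P := projectiveResolution M
  let Q := projectiveResolution N
  have hg := (ProjectiveResolution.lift_commutes g P Q)
  have hh := (ProjectiveResolution.lift_commutes h P Q)
  have hgh : (ProjectiveResolution.lift g P Q + ProjectiveResolution.lift h P Q) ≫ Q.π =
      P.π ≫ (ChainComplex.single₀ _).map (g + h) := by
    rw [Preadditive.add_comp, hg, hh, Functor.map_add, Preadditive.comp_add]
  rw [Functor.leftDerived_map_eq _ q _ _ hg, Functor.leftDerived_map_eq _ q _ _ hh,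
    Functor.leftDerived_map_eq _ q _ _ hgh, Functor.map_add]
  simp only [Preadditive.add_comp, Preadditive.comp_add]

lemma torFunctor_map_zero (q : ℕ) (M N : ModuleCat.{u} R) :
    (torFunctor f q).map (0 : M ⟶ N) = 0 := by
  have h := torFunctor_map_add f q (0 : M ⟶ N) 0
  rw [add_zero] at h
  exact left_eq_add.1 h

open ModuleCat.Algebra in
lemma torFunctor_map_smul {k : Type v} [Field k] {A B : Type u} [Ring A] [Ring B] [Algebra k A]
    [Algebra k B] (φ : A →ₐ[k] B) (q : ℕ) (M : ModuleCat.{u} A) (c : k) :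
    (torFunctor φ.toRingHom q).map (c • 𝟙 M) = c • 𝟙 ((torFunctor φ.toRingHom q).obj M) := by
  let P := projectiveResolution M
  let F := baseChange φ.toRingHom
  let K := (F.mapHomologicalComplex (ComplexShape.down ℕ)).obj P.complex
  have h0 : (c • 𝟙 P.complex) ≫ P.π = P.π ≫ (ChainComplex.single₀ _).map (c • 𝟙 M) := by
    ext1
    simp only [HomologicalComplex.comp_f, HomologicalComplex.smul_f_apply,
      ChainComplex.single₀_map_f_zero, Linear.smul_comp, Category.id_comp]
    exact (congrArg (c • ·) (Category.comp_id (P.π.f 0)).symm).trans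
      (Linear.comp_smul (R := k) _ _ _ (P.π.f 0) c (𝟙 M)).symm
  have h1 : ∀ N : ModuleCat.{u} A, F.map (c • 𝟙 N) = c • 𝟙 (F.obj N) := fun N => by
    ext1
    refine baseChange_hom_ext fun s m => ?_
    change baseChangeMk φ.toRingHom s (algebraMap k A c • (m : N)) =
      algebraMap k B c • baseChangeMk φ.toRingHom s m
    have h2 : baseChangeMk φ.toRingHom (s * φ (algebraMap k A c)) m =
        baseChangeMk φ.toRingHom s (algebraMap k A c • m) :=
      (Submodule.Quotient.eq _).2 (Submodule.subset_span ⟨s, algebraMap k A c, m, rfl⟩)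
    rw [← h2, φ.commutes, ← Algebra.commutes]
    rfl
  have h3 : HomologicalComplex.cyclesMap
      ((F.mapHomologicalComplex (ComplexShape.down ℕ)).map (c • 𝟙 P.complex)) q =
        c • 𝟙 (K.cycles q) := by
    rw [← cancel_mono (K.iCycles q), HomologicalComplex.cyclesMap_i, Linear.smul_comp,
      Category.id_comp]
    have h4 : ((F.mapHomologicalComplex (ComplexShape.down ℕ)).map (c • 𝟙 P.complex)).f q =
      c • 𝟙 (K.X q) := h1 _
    rw [h4, Linear.comp_smul, Category.comp_id]
  have h5 : HomologicalComplex.homologyMap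
      ((F.mapHomologicalComplex (ComplexShape.down ℕ)).map (c • 𝟙 P.complex)) q =
        c • 𝟙 (K.homology q) := by
    rw [← cancel_epi (K.homologyπ q), HomologicalComplex.homologyπ_naturality, h3,
      Linear.smul_comp, Category.id_comp, Linear.comp_smul, Category.comp_id]
  rw [Functor.leftDerived_map_eq _ q _ _ h0]
  have h6 : (F.mapHomologicalComplex _ ⋙ HomologicalComplex.homologyFunctor _ _ q).map
      (c • 𝟙 P.complex) = c • 𝟙 _ := h5
  rw [h6]
  have h7 : ∀ {X Y : ModuleCat.{u} B} (e : X ≅ Y), e.hom ≫ (c • 𝟙 Y) ≫ e.inv = c • 𝟙 X :=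
    fun e => by simp
  exact h7 _

variable {f} in
/-- The class in `Tor_q^R(S, M)` of a `q`-cycle of `S ⊗_R P`, where `P` is a projective resolution
of `M`. -/
def torClass {M : ModuleCat.{u} R} (P : ProjectiveResolution M) (q : ℕ)
    (z : (((baseChange f).mapHomologicalComplex _).obj P.complex).cycles q) :
    (torFunctor f q).obj M :=
  (P.isoLeftDerivedObj (baseChange f) q).inv
    ((((baseChange f).mapHomologicalComplex _).obj P.complex).homologyπ q z)

/-- `t ∈ Tor_q^R(S, M)` is the class of the cycle `s ⊗ x`, with `x ∈ P_q`. -/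
def IsTorClass {M : ModuleCat.{u} R} (P : ProjectiveResolution M) {q : ℕ} (s : S)
    (x : P.complex.X q) (t : (torFunctor f q).obj M) : Prop :=
  ∃ z : (((baseChange f).mapHomologicalComplex _).obj P.complex).cycles q,
    (((baseChange f).mapHomologicalComplex _).obj P.complex).iCycles q z = baseChangeMk f s x ∧
      torClass P q z = t

end Tor

section Bimodules

variable (k : Type v) [Field k]

/-- A `k`-vector space with commuting left and right actions of a `k`-algebra `B`, as a module over
`B ⊗ Bᵒᵖ`. -/
def bimodule (B : Type u) [Ring B] [Algebra k B] (M : Type u) [AddCommGroup M] [Module k M]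
    [Module B M] [Module Bᵐᵒᵖ M] [IsScalarTower k B M] [IsScalarTower k Bᵐᵒᵖ M]
    [SMulCommClass B Bᵐᵒᵖ M] : ModuleCat.{u} (B ⊗[k] Bᵐᵒᵖ) :=
  letI : Module (B ⊗[k] Bᵐᵒᵖ) M := TensorProduct.Algebra.module
  ModuleCat.of (B ⊗[k] Bᵐᵒᵖ) M

variable (B : Type u) [Ring B] [Algebra k B]

/-- The regular bimodule `B`. -/
abbrev regularBimodule : ModuleCat.{u} (B ⊗[k] Bᵐᵒᵖ) := bimodule k B B

variable {k} {A B : Type u} [Ring A] [Algebra k A] [Ring B] [Algebra k B] (φ : A →ₐ[k] B)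

/-- The morphism of enveloping algebras `φᵉ : Aᵉ → Bᵉ` induced by `φ : A → B`. -/
def envMap : A ⊗[k] Aᵐᵒᵖ →ₐ[k] B ⊗[k] Bᵐᵒᵖ := Algebra.TensorProduct.map φ (AlgHom.op φ)

/-- `Tor_q^{Aᵉ}(Bᵉ, A)` as a `Bᵉ`-module. -/
abbrev torEnv (q : ℕ) : ModuleCat.{u} (B ⊗[k] Bᵐᵒᵖ) :=
  (torFunctor (envMap φ).toRingHom q).obj (regularBimodule k A)

/-- `B` as a left `A`-module. -/
abbrev leftRestrict : ModuleCat.{u} A :=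
  (ModuleCat.restrictScalars φ.toRingHom).obj (ModuleCat.of B B)

/-- Right multiplication by `b`, an endomorphism of `B` as a left `A`-module. -/
def rightMul (b : B) : leftRestrict φ ⟶ leftRestrict φ :=
  (ModuleCat.restrictScalars φ.toRingHom).map
    (ModuleCat.ofHom (LinearMap.toSpanSingleton B B b))

/-- The group `Tor_q^A(B, B)`. -/
def TorBB (q : ℕ) : Type u := (torFunctor φ.toRingHom q).obj (leftRestrict φ)

variable (q : ℕ)

instance : AddCommGroup (TorBB φ q) :=
  inferInstanceAs (AddCommGroup ((torFunctor φ.toRingHom q).obj (leftRestrict φ)))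

instance : Module B (TorBB φ q) :=
  inferInstanceAs (Module B ((torFunctor φ.toRingHom q).obj (leftRestrict φ)))

instance : Module k (TorBB φ q) := Module.compHom _ (algebraMap k B)

instance : IsScalarTower k B (TorBB φ q) := IsScalarTower.of_algebraMap_smul fun _ _ => rfl

lemma rightMul_one : rightMul φ 1 = 𝟙 _ := by
  ext x
  exact mul_one (M := B) x

lemma rightMul_mul (b b' : B) : rightMul φ (b * b') = rightMul φ b ≫ rightMul φ b' := by
  ext x
  exact (mul_assoc (G := B) x b b').symm

lemma rightMul_add (b b' : B) : rightMul φ (b + b') = rightMul φ b + rightMul φ b' := by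
  ext x
  exact mul_add (R := B) x b b'

lemma rightMul_zero : rightMul φ (0 : B) = 0 := by
  ext x
  exact mul_zero (M₀ := B) x

/-- The right action of `B` on `Tor_q^A(B, B)`, by functoriality in the second variable. -/
instance : Module Bᵐᵒᵖ (TorBB φ q) where
  smul b t := (torFunctor φ.toRingHom q).map (rightMul φ b.unop) t
  one_smul t := by
    change (torFunctor φ.toRingHom q).map (rightMul φ 1) t = t
    rw [rightMul_one]
    exact DFunLike.congr_fun (congrArg ModuleCat.Hom.hom ((torFunctor φ.toRingHom q).map_id (leftRestrict φ))) t
  mul_smul b b' t := by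
    change (torFunctor φ.toRingHom q).map (rightMul φ (b'.unop * b.unop)) t = _
    rw [rightMul_mul]
    exact DFunLike.congr_fun (congrArg ModuleCat.Hom.hom ((torFunctor φ.toRingHom q).map_comp (rightMul φ b'.unop) (rightMul φ b.unop))) t
  smul_zero b := map_zero ((torFunctor φ.toRingHom q).map (rightMul φ b.unop)).hom
  smul_add b := map_add ((torFunctor φ.toRingHom q).map (rightMul φ b.unop)).hom
  add_smul b b' t := by
    change (torFunctor φ.toRingHom q).map (rightMul φ (b.unop + b'.unop)) t = _
    rw [rightMul_add]
    exact DFunLike.congr_fun (congrArg ModuleCat.Hom.hom (torFunctor_map_add φ.toRingHom q (rightMul φ b.unop) (rightMul φ b'.unop))) t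
  zero_smul t := by
    change (torFunctor φ.toRingHom q).map (rightMul φ 0) t = 0
    rw [rightMul_zero]
    exact DFunLike.congr_fun (congrArg ModuleCat.Hom.hom (torFunctor_map_zero φ.toRingHom q (leftRestrict φ) (leftRestrict φ))) t

instance : SMulCommClass B Bᵐᵒᵖ (TorBB φ q) where
  smul_comm b b' t :=
    (map_smul ((torFunctor φ.toRingHom q).map (rightMul φ b'.unop)).hom b t).symm

open ModuleCat.Algebra in
instance : IsScalarTower k Bᵐᵒᵖ (TorBB φ q) := by
  refine IsScalarTower.of_algebraMap_smul fun c t => ?_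
  have h : rightMul φ (algebraMap k B c) = c • 𝟙 (leftRestrict φ) := by
    ext x
    change B at x
    change x * algebraMap k B c = φ (algebraMap k A c) * x
    rw [φ.commutes, Algebra.commutes]
  change (torFunctor φ.toRingHom q).map (rightMul φ (algebraMap k B c)) t = _
  rw [h]
  exact DFunLike.congr_fun (congrArg ModuleCat.Hom.hom (torFunctor_map_smul φ q (leftRestrict φ) c)) t

/-- The `B`-bimodule `Tor_q^A(B, B)`. -/
abbrev torBB : ModuleCat.{u} (B ⊗[k] Bᵐᵒᵖ) := bimodule k B (TorBB φ q)

end Bimodules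
section Bar

open ModuleCat.Algebra

variable (k : Type v) [Field k] (B : Type u) [Ring B] [Algebra k B]

/-- The vector space `B ⊗ M`, for a `B`-bimodule `M`. -/
def BarStep (M : ModuleCat.{u} (B ⊗[k] Bᵐᵒᵖ)) : Type u := B ⊗[k] M

variable {k B} (M : ModuleCat.{u} (B ⊗[k] Bᵐᵒᵖ))

instance : AddCommGroup (BarStep k B M) := inferInstanceAs (AddCommGroup (B ⊗[k] M))

/-- The element `b ⊗ m` of `B ⊗ M`. -/
def barMk {M : ModuleCat.{u} (B ⊗[k] Bᵐᵒᵖ)} (b : B) (m : M) : BarStep k B M := b ⊗ₜ[k] m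

variable {M} in
lemma barStep_induction {motive : BarStep k B M → Prop} (zero : motive 0)
    (mk : ∀ b m, motive (barMk b m)) (add : ∀ x y, motive x → motive y → motive (x + y))
    (x : BarStep k B M) : motive x :=
  TensorProduct.induction_on (motive := motive) x zero mk add

variable (k B) in
/-- The left action of `B` on `B ⊗ M`. -/
def barLeft : B →ₐ[k] Module.End k (B ⊗[k] M) :=
  (Module.End.rTensorAlgHom k B M).comp (Algebra.lmul k B)

variable (k B) in
/-- The right action of `B` on `B ⊗ M`. -/
def barRight : Bᵐᵒᵖ →ₐ[k] Module.End k (B ⊗[k] M) :=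
  (Module.End.lTensorAlgHom k M B).comp ((Algebra.lsmul k k M).comp
    (Algebra.TensorProduct.includeRight : Bᵐᵒᵖ →ₐ[k] B ⊗[k] Bᵐᵒᵖ))

lemma barLeft_tmul (b x : B) (m : M) : barLeft k B M b (x ⊗ₜ m) = (b * x) ⊗ₜ m := rfl

lemma barRight_tmul (c : Bᵐᵒᵖ) (x : B) (m : M) :
    barRight k B M c (x ⊗ₜ m) = x ⊗ₜ (((1 : B) ⊗ₜ[k] c : B ⊗[k] Bᵐᵒᵖ) • m) := rfl

lemma barLeft_commute (b : B) (c : Bᵐᵒᵖ) : Commute (barLeft k B M b) (barRight k B M c) :=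
  TensorProduct.ext' fun x m => by
    rw [Module.End.mul_apply, Module.End.mul_apply, barLeft_tmul, barRight_tmul, barRight_tmul,
      barLeft_tmul]

/-- The action `b (x ⊗ m) b' = bx ⊗ mb'` of the enveloping algebra on `B ⊗ M`. -/
def barAction : B ⊗[k] Bᵐᵒᵖ →ₐ[k] Module.End k (B ⊗[k] M) :=
  Algebra.TensorProduct.lift (barLeft k B M) (barRight k B M) (barLeft_commute M)

instance : Module (B ⊗[k] Bᵐᵒᵖ) (BarStep k B M) :=
  letI : Module (Module.End k (B ⊗[k] M)) (BarStep k B M) :=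
    inferInstanceAs (Module (Module.End k (B ⊗[k] M)) (B ⊗[k] M))
  Module.compHom _ (barAction M).toRingHom

variable {M}

lemma smul_barMk (b : B) (c : Bᵐᵒᵖ) (x : B) (m : M) :
    (b ⊗ₜ[k] c : B ⊗[k] Bᵐᵒᵖ) • barMk x m =
      barMk (b * x) (((1 : B) ⊗ₜ[k] c : B ⊗[k] Bᵐᵒᵖ) • m) := by
  change barAction M (b ⊗ₜ[k] c) (x ⊗ₜ[k] m) = _
  rw [barAction, Algebra.TensorProduct.lift_tmul, Module.End.mul_apply, barRight_tmul,
    barLeft_tmul]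
  rfl

/-- A morphism of bimodules from `B ⊗ M` is an additive map that is compatible with the actions on
pure tensors. -/
def barLift {N : ModuleCat.{u} (B ⊗[k] Bᵐᵒᵖ)} (g : BarStep k B M →+ N)
    (hg : ∀ (b : B) (c : Bᵐᵒᵖ) (x : B) (m : M),
      g (barMk (b * x) (((1 : B) ⊗ₜ[k] c : B ⊗[k] Bᵐᵒᵖ) • m)) =
        (b ⊗ₜ[k] c : B ⊗[k] Bᵐᵒᵖ) • g (barMk x m)) :
    ModuleCat.of (B ⊗[k] Bᵐᵒᵖ) (BarStep k B M) ⟶ N :=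
  ModuleCat.ofHom
    { g with
      map_smul' := fun r x => by
        change g (r • x) = r • g x
        induction r using TensorProduct.induction_on with
        | zero =>
          exact (congrArg g (zero_smul (B ⊗[k] Bᵐᵒᵖ) x)).trans
            ((map_zero g).trans (zero_smul (B ⊗[k] Bᵐᵒᵖ) (g x)).symm)
        | add r s hr hs => rw [add_smul, add_smul, map_add, hr, hs]
        | tmul b c =>
          induction x using barStep_induction with
          | zero => rw [smul_zero, map_zero, smul_zero]
          | add x y hx hy => rw [smul_add, map_add, map_add, smul_add, hx, hy]
          | mk x m => rw [smul_barMk, hg] }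

variable (k B)

/-- The functor `M ↦ B ⊗ M` on `B`-bimodules, with `b (x ⊗ m) b' = bx ⊗ mb'`. -/
def barFunctor : ModuleCat.{u} (B ⊗[k] Bᵐᵒᵖ) ⥤ ModuleCat.{u} (B ⊗[k] Bᵐᵒᵖ) where
  obj M := ModuleCat.of _ (BarStep k B M)
  map {M N} g := barLift (N := ModuleCat.of _ (BarStep k B N))
    (LinearMap.lTensor B (g.hom.restrictScalars k)).toAddMonoidHom
    (fun b c x m => by
      refine Eq.trans ?_ (smul_barMk b c x (g m)).symm
      exact congrArg (barMk (b * x)) (map_smul g.hom _ m))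
  map_id M := by
    ext x
    exact LinearMap.lTensor_id_apply B M x
  map_comp {M N P} g h := by
    ext x
    exact LinearMap.lTensor_comp_apply B (h.hom.restrictScalars k) (g.hom.restrictScalars k) x

/-- The left action `B ⊗ M ⟶ M`. -/
def barAct (M : ModuleCat.{u} (B ⊗[k] Bᵐᵒᵖ)) : (barFunctor k B).obj M ⟶ M :=
  barLift
    (TensorProduct.lift ((Algebra.lsmul k k M).comp
      (Algebra.TensorProduct.includeLeft : B →ₐ[k] B ⊗[k] Bᵐᵒᵖ)).toLinearMap).toAddMonoidHom
    (fun b c x m => by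
      change ((b * x) ⊗ₜ[k] (1 : Bᵐᵒᵖ) : B ⊗[k] Bᵐᵒᵖ) • ((1 : B) ⊗ₜ[k] c : B ⊗[k] Bᵐᵒᵖ) • m =
        (b ⊗ₜ[k] c : B ⊗[k] Bᵐᵒᵖ) • (x ⊗ₜ[k] (1 : Bᵐᵒᵖ) : B ⊗[k] Bᵐᵒᵖ) • m
      simp [smul_smul])

/-- The bimodules `B ⊗ ⋯ ⊗ B` with `n + 1` factors. -/
def barObj : ℕ → ModuleCat.{u} (B ⊗[k] Bᵐᵒᵖ)
  | 0 => regularBimodule k B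
  | n + 1 => (barFunctor k B).obj (barObj n)

/-- The morphism `b ⊗ x ↦ bx`. -/
def barFace (n : ℕ) : barObj k B (n + 1) ⟶ barObj k B n := barAct k B (barObj k B n)

/-- The morphism `b ⊗ x ↦ b ⊗ g(x)`. -/
def barShift {m n : ℕ} (g : barObj k B m ⟶ barObj k B n) :
    barObj k B (m + 1) ⟶ barObj k B (n + 1) := (barFunctor k B).map g

/-- The differentials of the augmented bar complex, `d (b ⊗ x) = bx - b ⊗ dx`, that is
`d (b₀ ⊗ ⋯ ⊗ bₙ₊₁) = ∑ (-1)ⁱ b₀ ⊗ ⋯ ⊗ bᵢbᵢ₊₁ ⊗ ⋯ ⊗ bₙ₊₁`. -/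
def barD : ∀ n : ℕ, barObj k B (n + 1) ⟶ barObj k B n
  | 0 => barFace k B 0
  | n + 1 => barFace k B (n + 1) - barShift k B (barD n)

variable {k B}

lemma barFunctor_map_mk {M N : ModuleCat.{u} (B ⊗[k] Bᵐᵒᵖ)} (g : M ⟶ N) (b : B) (m : M) :
    ((barFunctor k B).map g).hom (barMk b m) = barMk b (g m) := rfl

lemma barAct_mk (M : ModuleCat.{u} (B ⊗[k] Bᵐᵒᵖ)) (b : B) (m : M) :
    (barAct k B M).hom (barMk b m) = (b ⊗ₜ[k] (1 : Bᵐᵒᵖ) : B ⊗[k] Bᵐᵒᵖ) • m := rfl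

lemma bar_hom_ext {M N : ModuleCat.{u} (B ⊗[k] Bᵐᵒᵖ)} {g h : (barFunctor k B).obj M ⟶ N}
    (H : ∀ (b : B) (m : M), g.hom (barMk b m) = h.hom (barMk b m)) : g = h := by
  ext x
  change BarStep k B M at x
  induction x using barStep_induction with
  | zero => exact (map_zero g.hom).trans (map_zero h.hom).symm
  | add x y hx hy =>
    exact (map_add g.hom x y).trans ((congrArg₂ _ hx hy).trans (map_add h.hom x y).symm)
  | mk b m => exact H b m

lemma barAct_naturality {M N : ModuleCat.{u} (B ⊗[k] Bᵐᵒᵖ)} (g : M ⟶ N) :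
    (barFunctor k B).map g ≫ barAct k B N = barAct k B M ≫ g :=
  bar_hom_ext fun _ m => (map_smul g.hom _ m).symm

lemma barFunctor_map_zero (M N : ModuleCat.{u} (B ⊗[k] Bᵐᵒᵖ)) :
    (barFunctor k B).map (0 : M ⟶ N) = 0 :=
  bar_hom_ext fun b _ => TensorProduct.tmul_zero N b

lemma barShift_comp_face {m n : ℕ} (g : barObj k B m ⟶ barObj k B n) :
    barShift k B g ≫ barFace k B n = barFace k B m ≫ g := barAct_naturality g

lemma barD_comp (n : ℕ) : barD k B (n + 1) ≫ barD k B n = 0 := by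
  induction n with
  | zero =>
    change (barFace k B 1 - barShift k B (barFace k B 0)) ≫ barFace k B 0 = 0
    rw [Preadditive.sub_comp, barShift_comp_face, sub_self]
  | succ n ih =>
    have h : barShift k B (barD k B (n + 1)) ≫ barShift k B (barD k B n) = 0 := by
      refine ((barFunctor k B).map_comp _ _).symm.trans ?_
      rw [ih]
      exact barFunctor_map_zero _ _
    have h' : barShift k B (barD k B (n + 1)) ≫ barD k B (n + 1) =
        barFace k B (n + 2) ≫ barD k B (n + 1) := by
      change _ ≫ (barFace k B (n + 1) - barShift k B (barD k B n)) = _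
      rw [Preadditive.comp_sub, h, sub_zero, barShift_comp_face]
    change (barFace k B (n + 2) - barShift k B (barD k B (n + 1))) ≫ barD k B (n + 1) = 0
    rw [Preadditive.sub_comp, h', sub_self]

/-- The map `x ↦ 1 ⊗ x`. -/
def barIns {n : ℕ} (x : barObj k B n) : barObj k B (n + 1) := barMk (1 : B) x

lemma barFace_ins {n : ℕ} (x : barObj k B n) : (barFace k B n).hom (barIns x) = x :=
  one_smul (B ⊗[k] Bᵐᵒᵖ) x

lemma barD_zero_ins (x : barObj k B 0) : (barD k B 0).hom (barIns x) = x :=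
  barFace_ins x

lemma barD_succ_ins (n : ℕ) (x : barObj k B (n + 1)) :
    (barD k B (n + 1)).hom (barIns x) = x - barIns ((barD k B n).hom x) := by
  change (barFace k B (n + 1)).hom (barIns x) - (barShift k B (barD k B n)).hom (barIns x) = _
  rw [barFace_ins]
  rfl

lemma barD_exact (n : ℕ) (x : barObj k B (n + 1)) (hx : (barD k B n).hom x = 0) :
    ∃ y, (barD k B (n + 1)).hom y = x :=
  ⟨barIns x, by
    rw [barD_succ_ins, hx, sub_eq_self]
    exact TensorProduct.tmul_zero (barObj k B n) (1 : B)⟩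

/-- A `B`-bimodule as a right `B`-module. -/
abbrev rightRestrict (M : ModuleCat.{u} (B ⊗[k] Bᵐᵒᵖ)) : ModuleCat.{u} Bᵐᵒᵖ :=
  (ModuleCat.restrictScalars
    (Algebra.TensorProduct.includeRight : Bᵐᵒᵖ →ₐ[k] B ⊗[k] Bᵐᵒᵖ).toRingHom).obj M

lemma right_projective (n : ℕ) : Module.Projective Bᵐᵒᵖ (rightRestrict (barObj k B n)) := by
  induction n with
  | zero =>
    let e : rightRestrict (barObj k B 0) ≃ₗ[Bᵐᵒᵖ] Bᵐᵒᵖ :=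
      { toFun := fun x => op (x : B)
        invFun := fun x => (x.unop : B)
        left_inv := fun x => rfl
        right_inv := fun x => rfl
        map_add' := fun x y => rfl
        map_smul' := fun c x => by
          change B at x
          change op ((1 : B) * (x * c.unop)) = c * op x
          simp }
    exact Module.Projective.of_equiv e.symm
  | succ n ih =>
    classical
    let N := rightRestrict (barObj k B n)
    let b := Module.Basis.ofVectorSpace k B
    let e : (B ⊗[k] barObj k B n) ≃ₗ[k] (Module.Basis.ofVectorSpaceIndex k B →₀ barObj k B n) :=
      TensorProduct.equivFinsuppOfBasisLeft b
    have he : ∀ (c : Bᵐᵒᵖ) (x : BarStep k B (barObj k B n)) (i : Module.Basis.ofVectorSpaceIndex k B),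
        e (((1 : B) ⊗ₜ[k] c : B ⊗[k] Bᵐᵒᵖ) • x) i =
          ((1 : B) ⊗ₜ[k] c : B ⊗[k] Bᵐᵒᵖ) • (e x i : barObj k B n) := by
      intro c x i
      induction x using barStep_induction with
      | zero =>
        rw [smul_zero]
        refine (congrArg (· i) (map_zero e)).trans ?_
        refine Eq.trans ?_ (congrArg (((1 : B) ⊗ₜ[k] c : B ⊗[k] Bᵐᵒᵖ) • ·)
          (congrArg (· i) (map_zero e)).symm)
        exact (smul_zero _).symm
      | add x y hx hy =>
        rw [smul_add]
        refine (congrArg (· i) (map_add e _ _)).trans ?_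
        refine Eq.trans ?_ (congrArg (((1 : B) ⊗ₜ[k] c : B ⊗[k] Bᵐᵒᵖ) • ·)
          (congrArg (· i) (map_add e _ _)).symm)
        exact (congrArg₂ (· + ·) hx hy).trans (smul_add _ _ _).symm
      | mk x m =>
        rw [smul_barMk, one_mul]
        refine (TensorProduct.equivFinsuppOfBasisLeft_apply_tmul_apply b x _ i).trans ?_
        refine Eq.trans ?_ (congrArg (((1 : B) ⊗ₜ[k] c : B ⊗[k] Bᵐᵒᵖ) • ·)
          (TensorProduct.equivFinsuppOfBasisLeft_apply_tmul_apply b x m i).symm)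
        exact (smul_comm _ _ _).symm
    let e' : rightRestrict (barObj k B (n + 1)) ≃ₗ[Bᵐᵒᵖ]
        (Module.Basis.ofVectorSpaceIndex k B →₀ N) :=
      { e.toAddEquiv with
        map_smul' := fun c x => Finsupp.ext fun i => he c x i }
    exact Module.Projective.of_equiv (e'.trans (finsuppLEquivDirectSum Bᵐᵒᵖ N _)).symm

lemma barStep_projective {M : ModuleCat.{u} (B ⊗[k] Bᵐᵒᵖ)}
    (hM : Module.Projective Bᵐᵒᵖ (rightRestrict M)) : Projective ((barFunctor k B).obj M) := by
  refine ⟨fun {E X} f e he => ?_⟩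
  have hes := (ModuleCat.epi_iff_surjective e).1 he
  let i : rightRestrict M →ₗ[Bᵐᵒᵖ] rightRestrict X :=
    { toFun := fun m => f.hom (barMk 1 m)
      map_add' := fun m m' => by
        refine Eq.trans ?_ (map_add f.hom _ _)
        exact congrArg f.hom (TensorProduct.tmul_add (R := k) (N := M) (1 : B) m m')
      map_smul' := fun c m => by
        refine Eq.trans ?_ (map_smul f.hom ((1 : B) ⊗ₜ[k] c : B ⊗[k] Bᵐᵒᵖ) _)
        refine congrArg f.hom ?_
        refine Eq.trans ?_ (smul_barMk (M := M) 1 c 1 m).symm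
        rw [one_mul]
        rfl }
  let e' : rightRestrict E →ₗ[Bᵐᵒᵖ] rightRestrict X :=
    ((ModuleCat.restrictScalars _).map e).hom
  obtain ⟨j, hj⟩ := Module.projective_lifting_property e' i hes
  let J : M → E := fun m => j m
  have hJ : ∀ (c : Bᵐᵒᵖ) (m : M), J (((1 : B) ⊗ₜ[k] c : B ⊗[k] Bᵐᵒᵖ) • m) =
      ((1 : B) ⊗ₜ[k] c : B ⊗[k] Bᵐᵒᵖ) • J m := fun c m =>
    map_smul j c (show rightRestrict M from m)
  have hJe : ∀ m : M, e.hom (J m) = f.hom (barMk 1 m) := fun m => DFunLike.congr_fun hj m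
  let j' : M →ₗ[k] E :=
    { toFun := J
      map_add' := fun m m' => map_add j m m'
      map_smul' := fun c m => by
        have h1 : ∀ (Z : ModuleCat.{u} (B ⊗[k] Bᵐᵒᵖ)) (z : Z), c • z =
            ((1 : B) ⊗ₜ[k] algebraMap k Bᵐᵒᵖ c : B ⊗[k] Bᵐᵒᵖ) • z := fun Z z => by
          rw [← Algebra.TensorProduct.algebraMap_apply']
          rfl
        rw [h1, hJ, RingHom.id_apply, h1] }
  let l : B ⊗[k] M →ₗ[k] E := TensorProduct.lift
    (((Algebra.lsmul k k E).comp
      (Algebra.TensorProduct.includeLeft : B →ₐ[k] B ⊗[k] Bᵐᵒᵖ)).toLinearMap.compl₂ j')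
  refine ⟨barLift (M := M) l.toAddMonoidHom fun b c x m => ?_, ?_⟩
  · change ((b * x) ⊗ₜ[k] (1 : Bᵐᵒᵖ) : B ⊗[k] Bᵐᵒᵖ) • J (((1 : B) ⊗ₜ[k] c : B ⊗[k] Bᵐᵒᵖ) • m) =
      (b ⊗ₜ[k] c : B ⊗[k] Bᵐᵒᵖ) • (x ⊗ₜ[k] (1 : Bᵐᵒᵖ) : B ⊗[k] Bᵐᵒᵖ) • J m
    rw [hJ, smul_smul, smul_smul]
    simp
  · refine bar_hom_ext fun b m => ?_
    change e.hom ((b ⊗ₜ[k] (1 : Bᵐᵒᵖ) : B ⊗[k] Bᵐᵒᵖ) • J m) = f.hom (barMk b m)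
    rw [map_smul, hJe]
    refine (map_smul f.hom _ _).symm.trans (congrArg f.hom ?_)
    refine (smul_barMk (M := M) b 1 1 m).trans ?_
    rw [mul_one]
    exact congrArg _ (one_smul (B ⊗[k] Bᵐᵒᵖ) m)

instance (n : ℕ) : Projective (barObj k B (n + 1)) := barStep_projective (right_projective n)

variable (k B)

/-- The (unaugmented) bar complex of `B`. -/
def barComplex : ChainComplex (ModuleCat.{u} (B ⊗[k] Bᵐᵒᵖ)) ℕ :=
  ChainComplex.of (fun n => barObj k B (n + 1)) (fun n => barD k B (n + 1))
    (fun n => barD_comp (n + 1))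

lemma barComplex_d (n : ℕ) : (barComplex k B).d (n + 1) n = barD k B (n + 1) := by
  simp [barComplex]

lemma barComplex_d_comp : (barComplex k B).d 1 0 ≫ barD k B 0 = 0 := by
  rw [barComplex_d]
  exact barD_comp 0

/-- The bar resolution `⋯ ⟶ B ⊗ B ⊗ B ⟶ B ⊗ B ⟶ B` of `B` by projective `B`-bimodules. -/
def barResolution : ProjectiveResolution (regularBimodule k B) where
  complex := barComplex k B
  projective n := inferInstanceAs (Projective (barObj k B (n + 1)))
  π := (ChainComplex.toSingle₀Equiv _ _).symm ⟨barD k B 0, barComplex_d_comp k B⟩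
  quasiIso := ⟨fun n => by
    rcases n with _ | n
    · rw [ChainComplex.quasiIsoAt₀_iff, ShortComplex.quasiIso_iff_of_zeros']
      · refine (ShortComplex.exact_and_epi_g_iff_of_iso
          (S₂ := ShortComplex.mk _ _ (barComplex_d_comp k B))
          (ShortComplex.isoMk (Iso.refl _) (Iso.refl _) (Iso.refl _)
            ((Category.id_comp _).trans (Category.comp_id _).symm)
            ((Category.id_comp _).trans (Category.comp_id _).symm))).2 ⟨?_, ?_⟩
        · rw [ShortComplex.moduleCat_exact_iff]
          intro x hx
          obtain ⟨y, hy⟩ := barD_exact 0 x hx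
          exact ⟨y, (congrArg (fun g => g.hom y) (barComplex_d k B 0)).trans hy⟩
        · exact (ModuleCat.epi_iff_surjective _).2 fun x => ⟨barIns x, barD_zero_ins x⟩
      all_goals rfl
    · rw [quasiIsoAt_iff_exactAt']
      · rw [HomologicalComplex.exactAt_iff' _ (n + 1 + 1) (n + 1) n (by simp) (by simp),
          ShortComplex.moduleCat_exact_iff]
        intro x hx
        obtain ⟨y, hy⟩ := barD_exact (n + 1) x
          ((congrArg (fun g => g.hom x) (barComplex_d k B n)).symm.trans hx)
        exact ⟨y, (congrArg (fun g => g.hom y) (barComplex_d k B (n + 1))).trans hy⟩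
      · apply ChainComplex.exactAt_succ_single_obj⟩

end Bar

section Omega

variable {R S : Type u} [Ring R] [Ring S] (f : R →+* S) {M : ModuleCat.{u} R}
  (X : ProjectiveResolution M) {N : ModuleCat.{u} S} (Y : InjectiveResolution N)

/-- The complex `S ⊗_R X` of left `S`-modules, whose homology is `Tor^R(S, M)`. -/
abbrev changeComplex : ChainComplex (ModuleCat.{u} S) ℕ :=
  ((baseChange f).mapHomologicalComplex _).obj X.complex

/-- The identification of `Tor_q^R(S, M)` with the homology of `S ⊗_R X`. -/
def torIso (q : ℕ) : (torFunctor f q).obj M ≅ (changeComplex f X).homology q :=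
  X.isoLeftDerivedObj (baseChange f) q

/-- The differential `d₂ : Ext^p(Tor_{q+1}(S, M), N) → Ext^{p+2}(Tor_q(S, M), N)` of the change of
rings spectral sequence, which is the spectral sequence of the double complex
`Hom_S(S ⊗_R X_q, Y^p)`. -/
def torD₂ (p q : ℕ) :
    Abelian.Ext.{u} ((torFunctor f (q + 1)).obj M) N p →+
      Abelian.Ext.{u} ((torFunctor f q).obj M) N (p + 2) :=
  AddMonoidHom.mk'
    (fun z => (Abelian.Ext.mk₀ (torIso f X q).hom).comp
      (extD₂ (changeComplex f X) Y p q
        ((Abelian.Ext.mk₀ (torIso f X (q + 1)).inv).comp z (zero_add p))) (zero_add (p + 2)))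
    (fun z z' => by simp)

end Omega

section OmegaAlgebra

variable {k : Type v} {A B : Type u} [Field k] [Ring A] [Ring B] [Algebra k A] [Algebra k B]
  (φ : A →ₐ[k] B)

/-- The class `O_{q+1}(φ)` in `Ext²(Tor_q, Tor_{q+1})`. As `d₂^{p,q+1}(ζ) = (-1)^p ζ ∘ O_{q+1}(φ)`,
it is the image of the identity of `Tor_{q+1}` under `d₂^{0,q+1}`, where the coefficients are
`Tor_{q+1}`. -/
def omega (q : ℕ) (X : ProjectiveResolution (regularBimodule k A))
    (Y : InjectiveResolution (torEnv φ (q + 1))) :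
    Abelian.Ext.{u} (torEnv φ q) (torEnv φ (q + 1)) 2 :=
  torD₂ (envMap φ).toRingHom X Y 0 q (Abelian.Ext.mk₀ (𝟙 (torEnv φ (q + 1))))

end OmegaAlgebra

section Hochschild

open ModuleCat.Algebra

variable {k : Type v} [Field k] {B : Type u} [Ring B] [Algebra k B]
  {M : ModuleCat.{u} (B ⊗[k] Bᵐᵒᵖ)}

lemma algebra_smul_eq (c : k) {N : ModuleCat.{u} (B ⊗[k] Bᵐᵒᵖ)} (x : N) :
    c • x = ((algebraMap k B c) ⊗ₜ[k] (1 : Bᵐᵒᵖ) : B ⊗[k] Bᵐᵒᵖ) • x := rfl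

lemma algebra_smul_barMk (c : k) {N : ModuleCat.{u} (B ⊗[k] Bᵐᵒᵖ)} (b : B) (x : N) :
    c • (show (barFunctor k B).obj N from barMk b x) = barMk (c • b) x := by
  rw [algebra_smul_eq]
  refine (smul_barMk _ _ _ _).trans ?_
  rw [Algebra.smul_def]
  exact congrArg _ (one_smul (B ⊗[k] Bᵐᵒᵖ) x)

/-- A bilinear map `f : B × B → M` is a Hochschild 2-cocycle of `B` with values in the bimodule `M`
if `b f(b', b'') - f(b b', b'') + f(b, b' b'') - f(b, b') b'' = 0`. -/
def IsHochschildCocycle (f : B →ₗ[k] B →ₗ[k] M) : Prop :=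
  ∀ b b' b'' : B, (b ⊗ₜ[k] (1 : Bᵐᵒᵖ) : B ⊗[k] Bᵐᵒᵖ) • f b' b'' - f (b * b') b'' + f b (b' * b'') -
    ((1 : B) ⊗ₜ[k] op b'' : B ⊗[k] Bᵐᵒᵖ) • f b b' = 0

variable (f : B →ₗ[k] B →ₗ[k] M)

variable (k) in
/-- An element of `B` as an element of the regular bimodule. -/
def barOf (b : B) : barObj k B 0 := b

variable (k) in
/-- The element `b ⊗ x` of `B ⊗ ⋯ ⊗ B`. -/
def barTmul {n : ℕ} (b : B) (x : barObj k B n) : barObj k B (n + 1) :=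
  barMk (M := barObj k B n) b x

lemma barTmul_zero {n : ℕ} (b : B) : barTmul k b (0 : barObj k B n) = 0 :=
  TensorProduct.tmul_zero (barObj k B n) b

lemma barTmul_add {n : ℕ} (b : B) (x y : barObj k B n) :
    barTmul k b (x + y) = barTmul k b x + barTmul k b y :=
  TensorProduct.tmul_add b x y

lemma barTmul_sub {n : ℕ} (b : B) (x y : barObj k B n) :
    barTmul k b (x - y) = barTmul k b x - barTmul k b y :=
  TensorProduct.tmul_sub b x y

lemma left_smul_barTmul {n : ℕ} (b b' : B) (x : barObj k B n) :
    (b ⊗ₜ[k] (1 : Bᵐᵒᵖ) : B ⊗[k] Bᵐᵒᵖ) • barTmul k b' x = barTmul k (b * b') x :=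
  (smul_barMk b 1 b' x).trans (congrArg _ (one_smul (B ⊗[k] Bᵐᵒᵖ) x))

lemma right_smul_barTmul {n : ℕ} (c : Bᵐᵒᵖ) (b : B) (x : barObj k B n) :
    ((1 : B) ⊗ₜ[k] c : B ⊗[k] Bᵐᵒᵖ) • barTmul k b x =
      barTmul k b (((1 : B) ⊗ₜ[k] c : B ⊗[k] Bᵐᵒᵖ) • x) := by
  refine (smul_barMk 1 c b x).trans ?_
  rw [one_mul]
  rfl

lemma barD_tmul {n : ℕ} (b : B) (x : barObj k B (n + 1)) :
    (barD k B (n + 1)).hom (barTmul k b x) =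
      (b ⊗ₜ[k] (1 : Bᵐᵒᵖ) : B ⊗[k] Bᵐᵒᵖ) • x - barTmul k b ((barD k B n).hom x) := rfl

lemma barD_zero_tmul (b : B) (x : barObj k B 0) :
    (barD k B 0).hom (barTmul k b x) = (b ⊗ₜ[k] (1 : Bᵐᵒᵖ) : B ⊗[k] Bᵐᵒᵖ) • x := rfl

lemma smul_barObj_zero (b b' : B) :
    (b ⊗ₜ[k] (1 : Bᵐᵒᵖ) : B ⊗[k] Bᵐᵒᵖ) • barOf k b' =
      barOf k (b * b') :=
  congrArg (b * ·) (mul_one b')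

lemma barObj_induction {n : ℕ} {motive : barObj k B (n + 1) → Prop} (zero : motive 0)
    (mk : ∀ (b : B) (m : barObj k B n), motive (barTmul k b m))
    (add : ∀ x y, motive x → motive y → motive (x + y)) (x : barObj k B (n + 1)) : motive x :=
  barStep_induction (M := barObj k B n) (motive := motive) zero mk add x

lemma algebra_smul_barObj {n : ℕ} (c : k) (b : B) (x : barObj k B n) :
    c • barTmul k b x = barTmul k (c • b) x :=
  algebra_smul_barMk c b x

/-- The map `b' ↦ f(b₁, b₂) b'`. -/
def cochainAux₀ (b₁ b₂ : B) : barObj k B 0 →+ M :=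
  AddMonoidHom.mk' (fun b' => ((1 : B) ⊗ₜ[k] op (show B from b') : B ⊗[k] Bᵐᵒᵖ) • f b₁ b₂)
    (fun x y => by
      refine Eq.trans ?_ (add_smul _ _ _)
      rw [← TensorProduct.tmul_add]
      rfl)

/-- The map `b₂ ⊗ b' ↦ f(b₁, b₂) b'`. -/
def cochainAux₁ (b₁ : B) : barObj k B 1 →+ M :=
  TensorProduct.liftAddHom (R := k) (M := B) (N := barObj k B 0)
    (AddMonoidHom.mk' (fun b₂ => cochainAux₀ f b₁ b₂) fun x y => by
      ext z
      change B at z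
      change ((1 : B) ⊗ₜ[k] op z : B ⊗[k] Bᵐᵒᵖ) • f b₁ (x + y) =
        ((1 : B) ⊗ₜ[k] op z : B ⊗[k] Bᵐᵒᵖ) • f b₁ x + ((1 : B) ⊗ₜ[k] op z : B ⊗[k] Bᵐᵒᵖ) • f b₁ y
      rw [map_add, smul_add])
    (fun c b₂ b' => by
      change B at b'
      change ((1 : B) ⊗ₜ[k] op b' : B ⊗[k] Bᵐᵒᵖ) • f b₁ (c • b₂) =
        ((1 : B) ⊗ₜ[k] op (algebraMap k B c * (b' * 1)) : B ⊗[k] Bᵐᵒᵖ) • f b₁ b₂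
      rw [map_smul, mul_one, ← Algebra.smul_def, op_smul, TensorProduct.tmul_smul,
        smul_comm, smul_assoc])

lemma cochainAux₁_mk (b₁ b₂ b' : B) :
    cochainAux₁ f b₁ (barTmul k b₂ (barOf k b')) =
      ((1 : B) ⊗ₜ[k] op b' : B ⊗[k] Bᵐᵒᵖ) • f b₁ b₂ := rfl

/-- The map `b₁ ⊗ b₂ ⊗ b' ↦ f(b₁, b₂) b'`. -/
def cochainAux₂ : barObj k B 2 →+ M :=
  TensorProduct.liftAddHom (R := k) (M := B) (N := barObj k B 1)
    (AddMonoidHom.mk' (cochainAux₁ f) fun x y => by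
      ext z
      rw [AddMonoidHom.add_apply]
      induction z using barObj_induction with
      | zero => rw [map_zero, map_zero, map_zero, add_zero]
      | add z z' h h' => rw [map_add, map_add, map_add, h, h', add_add_add_comm]
      | mk b m =>
        refine (cochainAux₁_mk f _ _ _).trans ?_
        rw [map_add, LinearMap.add_apply, smul_add]
        rfl)
    (fun c b₁ z => by
      change cochainAux₁ f (c • b₁) z = cochainAux₁ f b₁ (c • z)
      induction z using barObj_induction with
      | zero => rw [smul_zero, map_zero, map_zero]
      | add z z' h h' => rw [smul_add, map_add, map_add, h, h']
      | mk b m =>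
        rw [algebra_smul_barObj]
        refine (cochainAux₁_mk f _ _ _).trans (Eq.trans ?_ (cochainAux₁_mk f _ _ _).symm)
        rw [map_smul, LinearMap.smul_apply, map_smul])

lemma cochainAux₂_mk (b₁ b₂ b' : B) :
    cochainAux₂ f (barTmul k b₁ (barTmul k b₂ (barOf k b'))) =
      ((1 : B) ⊗ₜ[k] op b' : B ⊗[k] Bᵐᵒᵖ) • f b₁ b₂ := rfl

lemma cochainAux₂_smul (c : Bᵐᵒᵖ) (x : barObj k B 2) :
    cochainAux₂ f (((1 : B) ⊗ₜ[k] c : B ⊗[k] Bᵐᵒᵖ) • x) =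
      ((1 : B) ⊗ₜ[k] c : B ⊗[k] Bᵐᵒᵖ) • cochainAux₂ f x := by
  induction x using barObj_induction with
  | zero => rw [smul_zero, map_zero, smul_zero]
  | add z z' h h' => rw [smul_add, map_add, map_add, smul_add, h, h']
  | mk b₁ m =>
    induction m using barObj_induction with
    | zero => rw [barTmul_zero, smul_zero, map_zero, smul_zero]
    | add z z' h h' => rw [barTmul_add, smul_add, map_add, map_add, smul_add, h, h']
    | mk b₂ b' =>
      obtain ⟨b', rfl⟩ : ∃ b'' : B, barOf k b'' = b' := ⟨b', rfl⟩
      have h1 : ((1 : B) ⊗ₜ[k] c : B ⊗[k] Bᵐᵒᵖ) • barOf k b' =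
          barOf k (b' * c.unop) := one_mul (b' * c.unop)
      rw [right_smul_barTmul, right_smul_barTmul, h1, cochainAux₂_mk, cochainAux₂_mk, smul_smul, Algebra.TensorProduct.tmul_mul_tmul, one_mul, op_mul, op_unop]

/-- The morphism of bimodules `B ⊗ B ⊗ B ⊗ B ⟶ M`, `b ⊗ b₁ ⊗ b₂ ⊗ b' ↦ b f(b₁, b₂) b'`. -/
def cochainHom : barObj k B 3 ⟶ M :=
  barLift (M := barObj k B 2)
    (TensorProduct.liftAddHom (R := k) (M := B) (N := barObj k B 2)
      (AddMonoidHom.mk' (fun b => (AddMonoidHom.mk'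
          (fun x => (b ⊗ₜ[k] (1 : Bᵐᵒᵖ) : B ⊗[k] Bᵐᵒᵖ) • cochainAux₂ f x)
          (fun x y => by rw [map_add, smul_add]) : barObj k B 2 →+ M))
        (fun b b' => by
          ext x
          change ((b + b') ⊗ₜ[k] (1 : Bᵐᵒᵖ) : B ⊗[k] Bᵐᵒᵖ) • cochainAux₂ f x =
            (b ⊗ₜ[k] (1 : Bᵐᵒᵖ) : B ⊗[k] Bᵐᵒᵖ) • cochainAux₂ f x +
              (b' ⊗ₜ[k] (1 : Bᵐᵒᵖ) : B ⊗[k] Bᵐᵒᵖ) • cochainAux₂ f x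
          rw [TensorProduct.add_tmul, add_smul]))
      (fun c b x => by
        change ((c • b) ⊗ₜ[k] (1 : Bᵐᵒᵖ) : B ⊗[k] Bᵐᵒᵖ) • cochainAux₂ f x =
          (b ⊗ₜ[k] (1 : Bᵐᵒᵖ) : B ⊗[k] Bᵐᵒᵖ) • cochainAux₂ f (c • x)
        have h : c • x = ((1 : B) ⊗ₜ[k] algebraMap k Bᵐᵒᵖ c : B ⊗[k] Bᵐᵒᵖ) • x := by
          rw [← Algebra.TensorProduct.algebraMap_apply']
          rfl
        rw [h, cochainAux₂_smul, smul_smul, Algebra.TensorProduct.tmul_mul_tmul, one_mul, mul_one,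
          Algebra.algebraMap_eq_smul_one, TensorProduct.tmul_smul, TensorProduct.smul_tmul']))
    (fun b c x m => by
      change ((b * x) ⊗ₜ[k] (1 : Bᵐᵒᵖ) : B ⊗[k] Bᵐᵒᵖ) •
          cochainAux₂ f (((1 : B) ⊗ₜ[k] c : B ⊗[k] Bᵐᵒᵖ) • m) =
        (b ⊗ₜ[k] c : B ⊗[k] Bᵐᵒᵖ) • (x ⊗ₜ[k] (1 : Bᵐᵒᵖ) : B ⊗[k] Bᵐᵒᵖ) • cochainAux₂ f m
      rw [cochainAux₂_smul, smul_smul, smul_smul]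
      simp)

/-- The element `b₀ ⊗ b₁ ⊗ b₂ ⊗ b₃` of the bar resolution. -/
def barMk₄ (b₀ b₁ b₂ b₃ : B) : barObj k B 3 :=
  barTmul k b₀ (barTmul k b₁ (barTmul k b₂ (barOf k b₃)))

lemma cochainHom_mk (b b₁ b₂ b' : B) :
    (cochainHom f).hom (barMk₄ b b₁ b₂ b') = (b ⊗ₜ[k] op b' : B ⊗[k] Bᵐᵒᵖ) • f b₁ b₂ := by
  change (b ⊗ₜ[k] (1 : Bᵐᵒᵖ) : B ⊗[k] Bᵐᵒᵖ) • ((1 : B) ⊗ₜ[k] op b' : B ⊗[k] Bᵐᵒᵖ) • f b₁ b₂ = _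
  rw [smul_smul, Algebra.TensorProduct.tmul_mul_tmul, one_mul, mul_one]

lemma bar₅_hom_ext {N : ModuleCat.{u} (B ⊗[k] Bᵐᵒᵖ)} {g : barObj k B 4 ⟶ N}
    (H : ∀ b₀ b₁ b₂ b₃ b₄ : B, g.hom (barTmul k b₀ (barMk₄ b₁ b₂ b₃ b₄)) = 0) : g = 0 := by
  ext m
  change g.hom m = 0
  induction m using barObj_induction with
  | zero => rw [map_zero]
  | add x y hx hy => rw [map_add, hx, hy, add_zero]
  | mk b m =>
    induction m using barObj_induction with
    | zero => rw [barTmul_zero, map_zero]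
    | add x y hx hy => rw [barTmul_add, map_add, hx, hy, add_zero]
    | mk b₁ m =>
      induction m using barObj_induction with
      | zero => rw [barTmul_zero, barTmul_zero, map_zero]
      | add x y hx hy => rw [barTmul_add, barTmul_add, map_add, hx, hy, add_zero]
      | mk b₂ m =>
        induction m using barObj_induction with
        | zero => rw [barTmul_zero, barTmul_zero, barTmul_zero, map_zero]
        | add x y hx hy =>
          rw [barTmul_add, barTmul_add, barTmul_add, map_add, hx, hy, add_zero]
        | mk b₃ m => exact H b b₁ b₂ b₃ m

lemma barD_mk₅ (b₀ b₁ b₂ b₃ b₄ : B) :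
    (barD k B 3).hom (barTmul k b₀ (barMk₄ b₁ b₂ b₃ b₄)) =
      barMk₄ (b₀ * b₁) b₂ b₃ b₄ - barMk₄ b₀ (b₁ * b₂) b₃ b₄ + barMk₄ b₀ b₁ (b₂ * b₃) b₄ -
        barMk₄ b₀ b₁ b₂ (b₃ * b₄) := by
  simp only [barMk₄]
  rw [barD_tmul, barD_tmul, barD_tmul, barD_zero_tmul, smul_barObj_zero, left_smul_barTmul,
    left_smul_barTmul, left_smul_barTmul, barTmul_sub, barTmul_sub, barTmul_sub]
  abel

variable {f}

lemma IsHochschildCocycle.comp_eq_zero (hf : IsHochschildCocycle f) :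
    (barComplex k B).d 3 2 ≫ cochainHom f = 0 := by
  rw [barComplex_d]
  refine bar₅_hom_ext fun b₀ b₁ b₂ b₃ b₄ => ?_
  change (cochainHom f).hom ((barD k B 3).hom (barTmul k b₀ (barMk₄ b₁ b₂ b₃ b₄))) = 0
  rw [barD_mk₅, map_sub, map_add, map_sub]
  have h := congrArg (fun x => (b₀ ⊗ₜ[k] op b₄ : B ⊗[k] Bᵐᵒᵖ) • x) (hf b₁ b₂ b₃)
  simp only [smul_add, smul_sub, smul_smul, smul_zero, Algebra.TensorProduct.tmul_mul_tmul,
    mul_one, ← op_mul] at h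
  refine Eq.trans ?_ h
  refine congrArg₂ _ (congrArg₂ _ (congrArg₂ _ ?_ ?_) ?_) ?_ <;> exact cochainHom_mk f _ _ _ _

/-- The class in `H²(B, M) = Ext²(B, M)` of a Hochschild 2-cocycle. -/
def IsHochschildCocycle.extClass (hf : IsHochschildCocycle f) :
    Abelian.Ext.{u} (regularBimodule k B) M 2 :=
  (barResolution k B).extMk (cochainHom f) 3 rfl hf.comp_eq_zero

end Hochschild

section Singular

variable (k : Type v) [Field k] (B : Type u) [Ring B] [Algebra k B]

/-- A singular extension of the algebra `B`: a surjective morphism of algebras `E → B` whose kernel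
has square zero. -/
structure SingularExtension where
  E : Type u
  [ring : Ring E]
  [algebra : Algebra k E]
  proj : E →ₐ[k] B
  surjective : Function.Surjective proj
  sq_zero : ∀ x y : E, proj x = 0 → proj y = 0 → x * y = 0

namespace SingularExtension

attribute [instance] SingularExtension.ring SingularExtension.algebra

variable {k B} (S : SingularExtension k B)

/-- The kernel of a singular extension. -/
def Ker : Type u := LinearMap.ker S.proj.toLinearMap

instance : AddCommGroup S.Ker := inferInstanceAs (AddCommGroup (LinearMap.ker S.proj.toLinearMap))

instance : Module k S.Ker := inferInstanceAs (Module k (LinearMap.ker S.proj.toLinearMap))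

variable {S}

/-- An element of the kernel, as an element of the extension. -/
def Ker.val (m : S.Ker) : S.E := Subtype.val (p := (· ∈ LinearMap.ker S.proj.toLinearMap)) m

/-- An element of the extension that is mapped to zero, as an element of the kernel. -/
def Ker.mk (x : S.E) (hx : S.proj x = 0) : S.Ker :=
  (⟨x, hx⟩ : LinearMap.ker S.proj.toLinearMap)

lemma Ker.ext {m m' : S.Ker} (h : m.val = m'.val) : m = m' := Subtype.ext h

lemma Ker.proj_val (m : S.Ker) : S.proj m.val = 0 :=
  Subtype.property (p := (· ∈ LinearMap.ker S.proj.toLinearMap)) m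

lemma Ker.val_mk (x : S.E) (hx : S.proj x = 0) : (Ker.mk x hx).val = x := rfl

lemma Ker.val_add (m m' : S.Ker) : (m + m').val = m.val + m'.val := rfl

lemma Ker.val_sub (m m' : S.Ker) : (m - m').val = m.val - m'.val := rfl

lemma Ker.val_zero : (0 : S.Ker).val = 0 := rfl

lemma Ker.val_smul (c : k) (m : S.Ker) : (c • m).val = c • m.val := rfl

lemma mul_val_congr {x y : S.E} (h : S.proj x = S.proj y) (m : S.Ker) : x * m.val = y * m.val := by
  rw [← sub_eq_zero, ← sub_mul]
  exact S.sq_zero _ _ (by rw [map_sub, h, sub_self]) m.proj_val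

lemma val_mul_congr {x y : S.E} (h : S.proj x = S.proj y) (m : S.Ker) : m.val * x = m.val * y := by
  rw [← sub_eq_zero, ← mul_sub]
  exact S.sq_zero _ _ m.proj_val (by rw [map_sub, h, sub_self])

/-- The left action of `B` on the kernel: `b m = x m` if `x` is a preimage of `b`. -/
instance : SMul B S.Ker where
  smul b m := Ker.mk (Function.surjInv S.surjective b * m.val)
    (by rw [map_mul, m.proj_val, mul_zero])

/-- The right action of `B` on the kernel: `m b = m x` if `x` is a preimage of `b`. -/
instance : SMul Bᵐᵒᵖ S.Ker where
  smul b m := Ker.mk (m.val * Function.surjInv S.surjective b.unop)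
    (by rw [map_mul, m.proj_val, zero_mul])

lemma smul_val (x : S.E) (m : S.Ker) : (S.proj x • m).val = x * m.val :=
  mul_val_congr (Function.surjInv_eq S.surjective _) m

lemma op_smul_val (x : S.E) (m : S.Ker) : (op (S.proj x) • m).val = m.val * x :=
  val_mul_congr (Function.surjInv_eq S.surjective _) m

lemma exists_proj (b : B) : ∃ x : S.E, S.proj x = b := S.surjective b

instance : Module B S.Ker where
  one_smul m := Ker.ext (by rw [← map_one S.proj, smul_val, one_mul])
  mul_smul b b' m := Ker.ext (by
    obtain ⟨x, rfl⟩ := exists_proj (S := S) b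
    obtain ⟨y, rfl⟩ := exists_proj (S := S) b'
    rw [← map_mul, smul_val, smul_val, smul_val, mul_assoc])
  smul_zero b := Ker.ext (by
    obtain ⟨x, rfl⟩ := exists_proj (S := S) b
    rw [smul_val, Ker.val_zero, mul_zero])
  smul_add b m m' := Ker.ext (by
    obtain ⟨x, rfl⟩ := exists_proj (S := S) b
    rw [Ker.val_add, smul_val, smul_val, smul_val, Ker.val_add, mul_add])
  add_smul b b' m := Ker.ext (by
    obtain ⟨x, rfl⟩ := exists_proj (S := S) b
    obtain ⟨y, rfl⟩ := exists_proj (S := S) b'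
    rw [← map_add, Ker.val_add, smul_val, smul_val, smul_val, add_mul])
  zero_smul m := Ker.ext (by rw [← map_zero S.proj, smul_val, zero_mul, Ker.val_zero])

instance : Module Bᵐᵒᵖ S.Ker where
  one_smul m := Ker.ext (by rw [← op_one, ← map_one S.proj, op_smul_val, mul_one])
  mul_smul b b' m := Ker.ext (by
    obtain ⟨x, hx⟩ := exists_proj (S := S) b.unop
    obtain ⟨y, hy⟩ := exists_proj (S := S) b'.unop
    rw [← op_unop b, ← op_unop b', ← hx, ← hy, ← op_mul, ← map_mul, op_smul_val, op_smul_val,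
      op_smul_val, mul_assoc])
  smul_zero b := Ker.ext (by
    obtain ⟨x, hx⟩ := exists_proj (S := S) b.unop
    rw [← op_unop b, ← hx, op_smul_val, Ker.val_zero, zero_mul])
  smul_add b m m' := Ker.ext (by
    obtain ⟨x, hx⟩ := exists_proj (S := S) b.unop
    rw [← op_unop b, ← hx, Ker.val_add, op_smul_val, op_smul_val, op_smul_val, Ker.val_add,
      add_mul])
  add_smul b b' m := Ker.ext (by
    obtain ⟨x, hx⟩ := exists_proj (S := S) b.unop
    obtain ⟨y, hy⟩ := exists_proj (S := S) b'.unop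
    rw [← op_unop b, ← op_unop b', ← hx, ← hy, ← MulOpposite.op_add, ← map_add, Ker.val_add, op_smul_val,
      op_smul_val, op_smul_val, mul_add])
  zero_smul m := Ker.ext (by
    rw [← op_zero, ← map_zero S.proj, op_smul_val, mul_zero, Ker.val_zero])

instance : IsScalarTower k B S.Ker := IsScalarTower.of_algebraMap_smul fun c m => Ker.ext (by
  rw [← S.proj.commutes, smul_val, Ker.val_smul, Algebra.smul_def])

instance : IsScalarTower k Bᵐᵒᵖ S.Ker := IsScalarTower.of_algebraMap_smul fun c m => Ker.ext (by
  rw [MulOpposite.algebraMap_apply, ← S.proj.commutes, op_smul_val, Ker.val_smul,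
    Algebra.smul_def, Algebra.commutes])

instance : SMulCommClass B Bᵐᵒᵖ S.Ker where
  smul_comm b b' m := Ker.ext (by
    obtain ⟨x, rfl⟩ := exists_proj (S := S) b
    obtain ⟨y, hy⟩ := exists_proj (S := S) b'.unop
    rw [← op_unop b', ← hy, smul_val, op_smul_val, op_smul_val, smul_val, mul_assoc])

variable (S)

/-- The kernel of a singular extension of `B`, as a `B`-bimodule. -/
abbrev kerBimodule : ModuleCat.{u} (B ⊗[k] Bᵐᵒᵖ) := bimodule k B S.Ker

variable {S} in
lemma left_smul_ker (x : S.E) (m : S.Ker) :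
    (S.proj x ⊗ₜ[k] (1 : Bᵐᵒᵖ) : B ⊗[k] Bᵐᵒᵖ) • (show S.kerBimodule from m) =
      (show S.kerBimodule from Ker.mk (x * m.val) (by rw [map_mul, m.proj_val, mul_zero])) := by
  change S.proj x • (1 : Bᵐᵒᵖ) • m = _
  rw [one_smul]
  exact Ker.ext (smul_val x m)

variable {S} in
lemma right_smul_ker (x : S.E) (m : S.Ker) :
    ((1 : B) ⊗ₜ[k] op (S.proj x) : B ⊗[k] Bᵐᵒᵖ) • (show S.kerBimodule from m) =
      (show S.kerBimodule from Ker.mk (m.val * x) (by rw [map_mul, m.proj_val, zero_mul])) := by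
  change (1 : B) • op (S.proj x) • m = _
  rw [one_smul]
  exact Ker.ext (op_smul_val x m)

variable {S} in
lemma left_smul_ker_of_eq {b : B} {x : S.E} (hx : S.proj x = b) (m : S.Ker) :
    (b ⊗ₜ[k] (1 : Bᵐᵒᵖ) : B ⊗[k] Bᵐᵒᵖ) • (show S.kerBimodule from m) =
      (show S.kerBimodule from Ker.mk (x * m.val) (by rw [map_mul, m.proj_val, mul_zero])) := by
  subst hx
  exact left_smul_ker x m

variable {S} in
lemma right_smul_ker_of_eq {b : B} {x : S.E} (hx : S.proj x = b) (m : S.Ker) :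
    ((1 : B) ⊗ₜ[k] op b : B ⊗[k] Bᵐᵒᵖ) • (show S.kerBimodule from m) =
      (show S.kerBimodule from Ker.mk (m.val * x) (by rw [map_mul, m.proj_val, zero_mul])) := by
  subst hx
  exact right_smul_ker x m

open ModuleCat.Algebra in
variable {S} in
lemma algebra_smul_ker (c : k) (m : S.Ker) :
    c • (show S.kerBimodule from m) = (show S.kerBimodule from c • m) := by
  rw [algebra_smul_eq, ← S.proj.commutes, left_smul_ker]
  exact Ker.ext (Algebra.smul_def c m.val).symm

open ModuleCat.Algebra in
/-- The factor set `f(b, b') = σ(b) σ(b') - σ(b b')` of a singular extension, for a linear section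
`σ` of the projection. -/
def factorSet (σ : B →ₗ[k] S.E) (hσ : ∀ b, S.proj (σ b) = b) : B →ₗ[k] B →ₗ[k] S.kerBimodule :=
  LinearMap.mk₂ k
    (fun b b' => (show S.kerBimodule from Ker.mk (σ b * σ b' - σ (b * b'))
      (by rw [map_sub, map_mul, hσ, hσ, hσ, sub_self])))
    (fun b b' b'' => Ker.ext (S := S) (by
      change σ (b + b') * σ b'' - σ ((b + b') * b'') =
        (σ b * σ b'' - σ (b * b'')) + (σ b' * σ b'' - σ (b' * b''))
      rw [add_mul, map_add, map_add, add_mul]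
      abel))
    (fun c b b' => by
      refine Eq.trans (Ker.ext ?_) (algebra_smul_ker c _).symm
      change σ (c • b) * σ b' - σ ((c • b) * b') = c • (σ b * σ b' - σ (b * b'))
      rw [smul_mul_assoc, map_smul, map_smul, smul_mul_assoc, smul_sub])
    (fun b b' b'' => Ker.ext (S := S) (by
      change σ b * σ (b' + b'') - σ (b * (b' + b'')) =
        (σ b * σ b' - σ (b * b')) + (σ b * σ b'' - σ (b * b''))
      rw [mul_add, map_add, map_add, mul_add]
      abel))
    (fun c b b' => by
      refine Eq.trans (Ker.ext ?_) (algebra_smul_ker c _).symm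
      change σ b * σ (c • b') - σ (b * (c • b')) = c • (σ b * σ b' - σ (b * b'))
      rw [mul_smul_comm, map_smul, map_smul, mul_smul_comm, smul_sub])

lemma factorSet_isHochschildCocycle (σ : B →ₗ[k] S.E) (hσ : ∀ b, S.proj (σ b) = b) :
    IsHochschildCocycle (S.factorSet σ hσ) := by
  intro b b' b''
  have h1 := left_smul_ker_of_eq (hσ b) (show S.Ker from S.factorSet σ hσ b' b'')
  have h2 := right_smul_ker_of_eq (hσ b'') (show S.Ker from S.factorSet σ hσ b b')
  refine (congrArg₂ (fun x y => x - _ + _ - y) h1 h2).trans (Ker.ext ?_)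
  change σ b * (σ b' * σ b'' - σ (b' * b'')) - (σ (b * b') * σ b'' - σ (b * b' * b'')) +
    (σ b * σ (b' * b'') - σ (b * (b' * b''))) - (σ b * σ b' - σ (b * b')) * σ b'' = 0
  rw [mul_sub, sub_mul, mul_assoc, mul_assoc]
  abel

/-- The characteristic class, in `H²(B, M) = Ext²(B, M)`, of a singular extension of `B` with kernel
`M`, computed with the help of a linear section `σ`. -/
def charClass (σ : B →ₗ[k] S.E) (hσ : ∀ b, S.proj (σ b) = b) :
    Abelian.Ext.{u} (regularBimodule k B) S.kerBimodule 2 :=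
  (S.factorSet_isHochschildCocycle σ hσ).extClass

end SingularExtension

end Singular

section Surjection

variable {k : Type v} {A B : Type u} [Field k] [Ring A] [Ring B] [Algebra k A] [Algebra k B]
  (φ : A →ₐ[k] B) (hφ : Function.Surjective φ)

/-- The singular extension `0 → I/I² → A/I² → B → 0`, where `I` is the kernel of a surjective
morphism of algebras `A → B`. -/
def squareZeroQuotient : SingularExtension k B where
  E := A ⧸ (RingHom.ker φ) ^ 2
  proj := Ideal.Quotient.liftₐ ((RingHom.ker φ) ^ 2) φ
    (fun _ ha => Ideal.pow_le_self two_ne_zero ha)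
  surjective b := by
    obtain ⟨a, rfl⟩ := hφ b
    exact ⟨Ideal.Quotient.mk _ a, rfl⟩
  sq_zero x y hx hy := by
    obtain ⟨a, rfl⟩ := Ideal.Quotient.mk_surjective x
    obtain ⟨b, rfl⟩ := Ideal.Quotient.mk_surjective y
    rw [← map_mul, Ideal.Quotient.eq_zero_iff_mem, Submodule.pow_succ, Submodule.pow_one]
    exact Ideal.mul_mem_mul hx hy

/-- The `B`-bimodule `I/I²`, that is, the kernel of the projection `A/I² → B`. -/
abbrev conormal : ModuleCat.{u} (B ⊗[k] Bᵐᵒᵖ) := (squareZeroQuotient φ hφ).kerBimodule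

/-- The class in `I/I²` of an element of `I`. -/
def conormalMk (x : A) (hx : φ x = 0) : conormal φ hφ :=
  SingularExtension.Ker.mk (S := squareZeroQuotient φ hφ) (Ideal.Quotient.mk _ x) hx

lemma conormalMk_surjective (m : conormal φ hφ) : ∃ x hx, conormalMk φ hφ x hx = m := by
  obtain ⟨m, hm⟩ := m
  obtain ⟨x, rfl⟩ := Ideal.Quotient.mk_surjective m
  exact ⟨x, hm, rfl⟩

lemma conormalMk_eq_iff (x y : A) (hx : φ x = 0) (hy : φ y = 0) :
    conormalMk φ hφ x hx = conormalMk φ hφ y hy ↔ x - y ∈ (RingHom.ker φ) ^ 2 :=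
  Subtype.ext_iff.trans (Ideal.Quotient.eq (I := (RingHom.ker φ) ^ 2))

end Surjection

section Augmentation

/-- The augmentation `P₀ ⟶ M` of a projective resolution of `M`. -/
def augmentation {R : Type u} [Ring R] {M : ModuleCat.{u} R} (P : ProjectiveResolution M) :
    P.complex.X 0 ⟶ M := P.π.f 0

variable {k : Type v} {A B : Type u} [Field k] [Ring A] [Ring B] [Algebra k A] [Algebra k B]

/-- A complex of `A`-bimodules, as a complex of left `A`-modules. -/
abbrev leftComplex (X : ChainComplex (ModuleCat.{u} (A ⊗[k] Aᵐᵒᵖ)) ℕ) :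
    ChainComplex (ModuleCat.{u} A) ℕ :=
  ((ModuleCat.restrictScalars (Algebra.TensorProduct.includeLeft :
    A →ₐ[k] A ⊗[k] Aᵐᵒᵖ).toRingHom).mapHomologicalComplex _).obj X

end Augmentation

end

/-!
Let `I` be the kernel of the surjection `φ : A → B`.

*The isomorphisms `κ_q`.* For an `A`-bimodule `M` there is an isomorphism
`Bᵉ ⊗_{Aᵉ} M ≅ B ⊗_A (M / M I)`, since the kernel of `Aᵉ → Bᵉ` is `I ⊗ A + A ⊗ I`
(`mem_ker_smul_top_iff`). If `X` is the bar resolution of `A`, then `X / X I` is a resolution of the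
left module `B` by projective modules, as the contraction `x ↦ 1 ⊗ x` of `X` is right linear
(`quotBarResolution`). Thus both `Tor` groups are the homology of the same complex. The relation
"represented by the same element of `X`" is the graph of `κ_q` (`exists_kappa`), and comparison maps
show that it may be checked on arbitrary resolutions (`KappaRel.of_isTorClass`). All three
isomorphisms are built from such a relation between elements, by `exists_iso_of_relation`: this
makes bilinearity and the independence of the resolutions statements about representatives.

*The isomorphisms `e₀` and `e₁`.* Let `P` be a projective resolution of `B`. The first relates
`[1 ⊗ y]` to the image of `y` under the augmentation. For the second, fix `ξ ∈ P_0` over `1`, and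
relate `[1 ⊗ η]` to the class of `x ∈ I` if `dη = x ξ`. Every class has such a representative: if
`ψ : P_0 → A` lifts the augmentation, then `y ↦ y - ψ(y) ξ` factors through `d : P_1 → P_0`, so that
a cycle `η` may be corrected in `I P_1`. The class of `x = ψ(dη)` in `I/I²` only depends on
`[1 ⊗ η]` since `ψ d` maps `I P_1` to `I²` (`exists_eOne`).

*The class `O₁(φ)`.* Let `K = Bᵉ ⊗_{Aᵉ} X`, and let `P` now be the bar resolution of `B`. The
identity of `B` lifts in degrees `0` and `1` to a morphism `P → K`, and the obstruction to lifting
it in degree `2` is a cocycle `P_2 → H_1(K)`. A zigzag in the double complex `Hom(P, Y)` shows that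
`d₂` of the identity is the class of this cocycle, without a sign (`mk₀_comp_extD₂_mk₀`). If `s` is
a linear section of `φ`, the lift may be chosen to map `1 ⊗ b ⊗ 1` to `1 ⊗ s(b) ⊗ 1`. The
obstruction is then `(b₁, b₂) ↦ 1 ⊗ (s(b₁) s(b₂) - s(b₁ b₂)) ⊗ 1` modulo boundaries, and `e₁ κ₁`
maps this class to that of `s(b₁) s(b₂) - s(b₁ b₂)` in `I/I²`, which is the factor set of `A/I²`
(`omega_eq_charClass`).
-/

noncomputable section

/-! ### Comparing projective and injective representatives of classes in `Ext²` -/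

section ExtComparison

open CochainComplex CochainComplex.HomComplex Abelian

variable {C : Type u} [Category.{v} C] [Abelian C]

lemma toSingleMk_comp_ofHom {K L : CochainComplex C ℤ} {N : C} {p q n : ℤ} (f : K.X p ⟶ N)
    (h : p + n = q) (g : (singleFunctor C q).obj N ⟶ L) :
    (Cochain.toSingleMk f h).comp (Cochain.ofHom g) (add_zero n) =
      Cochain.single (f ≫ (HomologicalComplex.singleObjXSelf (.up ℤ) q N).inv ≫ g.f q) n := by
  ext p' q' hpq
  rw [Cochain.comp_v _ _ (add_zero n) p' q' q' hpq (add_zero q'), Cochain.ofHom_v]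
  by_cases hp : p' = p
  · obtain rfl := hp
    obtain rfl : q = q' := by lia
    rw [Cochain.toSingleMk_v, Cochain.single_v]
    exact Category.assoc _ _ _
  · rw [Cochain.toSingleMk_v_eq_zero _ _ _ _ _ hp, Cochain.single_v_eq_zero _ _ _ _ _ hp,
      Limits.zero_comp]

lemma ofHom_comp_fromSingleMk {K L : CochainComplex C ℤ} {M : C} {p q n : ℤ} (f : M ⟶ L.X q)
    (h : p + n = q) (g : K ⟶ (singleFunctor C p).obj M) :
    (Cochain.ofHom g).comp (Cochain.fromSingleMk f h) (zero_add n) =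
      Cochain.single (g.f p ≫ (HomologicalComplex.singleObjXSelf (.up ℤ) p M).hom ≫ f) n := by
  ext p' q' hpq
  rw [Cochain.comp_v _ _ (zero_add n) p' p' q' (add_zero p') hpq, Cochain.ofHom_v]
  by_cases hp : p' = p
  · obtain rfl := hp
    obtain rfl : q = q' := by lia
    rw [Cochain.fromSingleMk_v, Cochain.single_v]
    rfl
  · rw [Cochain.fromSingleMk_v_eq_zero _ _ _ _ _ hp, Cochain.single_v_eq_zero _ _ _ _ _ hp,
      Limits.comp_zero]

variable [HasExt.{w} C]

/-- Two degree `2` cocycles, on a projective resolution `P` of `M` and with values in an injective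
resolution `Y` of `N`, define the same element of `Ext²(M, N)` if they are linked by a zigzag
`P₁ ⟶ Y⁰`, `P₀ ⟶ Y¹`. No sign intervenes: the cochain `(β, -γ)` has coboundary `u - v`. -/
lemma extMk_eq_extMk_of_zigzag {M N : C} (P : ProjectiveResolution M) (Y : InjectiveResolution N)
    (u : P.complex.X 2 ⟶ N) (hu : P.complex.d 3 2 ≫ u = 0)
    (v : M ⟶ Y.cocomplex.X 2) (hv : v ≫ Y.cocomplex.d 2 3 = 0)
    (β : P.complex.X 1 ⟶ Y.cocomplex.X 0) (γ : P.complex.X 0 ⟶ Y.cocomplex.X 1)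
    (h1 : P.complex.d 2 1 ≫ β = u ≫ Y.ι.f 0)
    (h2 : β ≫ Y.cocomplex.d 0 1 = P.complex.d 1 0 ≫ γ)
    (h3 : γ ≫ Y.cocomplex.d 1 2 = P.π.f 0 ≫ v) :
    P.extMk u 3 rfl hu = Y.extMk v 3 rfl hv := by
  have := HasDerivedCategory.standard C
  have hu' : P.cochainComplex.d (-3) (-2) ≫ (P.cochainComplexXIso (-2) 2 rfl).hom ≫ u = 0 := by
    rw [P.cochainComplex_d (-3) (-2) 3 2 rfl rfl]
    simp [hu]
  have hv' : (v ≫ (Y.cochainComplexXIso 2 2 rfl).inv) ≫ Y.cochainComplex.d 2 3 = 0 := by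
    rw [Y.cochainComplex_d 2 3 2 3 rfl rfl]
    simp [reassoc_of% hv]
  -- `i` and `p` are `ι` and `π` in degree `0`, with `N` and `M` themselves as source and target,
  -- instead of the degree `0` terms of single complexes, which only unfold to them
  obtain ⟨i, hi0⟩ : ∃ i : N ⟶ Y.cocomplex.X 0, i = Y.ι.f 0 := ⟨_, rfl⟩
  obtain ⟨p, hp0⟩ : ∃ p : P.complex.X 0 ⟶ M, p = P.π.f 0 := ⟨_, rfl⟩
  replace h1 : P.complex.d 2 1 ≫ β = u ≫ i := by rw [hi0]; exact h1
  replace h3 : γ ≫ Y.cocomplex.d 1 2 = p ≫ v := by rw [hp0]; exact h3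
  have hi : (HomologicalComplex.singleObjXSelf (.up ℤ) 0 N).inv ≫ Y.ι'.f 0 =
      i ≫ (Y.cochainComplexXIso 0 0 rfl).inv := by
    rw [Y.ι'_f_zero, hi0]
    exact Iso.inv_hom_id_assoc _ _
  have hp : P.π'.f 0 ≫ (HomologicalComplex.singleObjXSelf (.up ℤ) 0 M).hom =
      (P.cochainComplexXIso 0 0 rfl).hom ≫ p := by
    rw [P.π'_f_zero, hp0]
    refine (Category.assoc _ _ _).trans (congrArg (_ ≫ ·) ((Category.assoc _ _ _).trans ?_))
    exact (congrArg (_ ≫ ·) (Iso.inv_hom_id _)).trans (Category.comp_id _)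
  ext
  rw [P.extMk_hom, Y.extMk_hom]
  set x : Cocycle P.cochainComplex ((singleFunctor C 0).obj N) 2 :=
    Cocycle.toSingleMk ((P.cochainComplexXIso (-2) 2 rfl).hom ≫ u) (by simp) (-3) (by lia) hu'
    with hx
  set y : Cocycle ((singleFunctor C 0).obj M) Y.cochainComplex 2 :=
    Cocycle.fromSingleMk (v ≫ (Y.cochainComplexXIso 2 2 rfl).inv) (zero_add _) 3 (by lia) hv'
    with hy
  -- in `Hom(P, Y)`, which computes the same cohomology, the two cocycles are cohomologous
  have h : CohomologyClass.mk (x.postcomp Y.ι') = CohomologyClass.mk (y.precomp P.π') := by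
    rw [← sub_eq_zero, ← CohomologyClass.mk_sub, CohomologyClass.mk_eq_zero_iff,
      mem_coboundaries_iff _ 1 (by lia)]
    refine ⟨Cochain.single ((P.cochainComplexXIso (-1) 1 rfl).hom ≫ β ≫
        (Y.cochainComplexXIso 0 0 rfl).inv) 1 -
      Cochain.single ((P.cochainComplexXIso 0 0 rfl).hom ≫ γ ≫
        (Y.cochainComplexXIso 1 1 rfl).inv) 1, ?_⟩
    have e1 : (x.postcomp Y.ι').1 = Cochain.single ((P.cochainComplexXIso (-2) 2 rfl).hom ≫ u ≫
        i ≫ (Y.cochainComplexXIso 0 0 rfl).inv) 2 := by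
      refine (toSingleMk_comp_ofHom _ (by lia) _).trans ?_
      rw [Category.assoc, hi]
    have e2 : (y.precomp P.π').1 = Cochain.single ((P.cochainComplexXIso 0 0 rfl).hom ≫
        p ≫ v ≫ (Y.cochainComplexXIso 2 2 rfl).inv) 2 := by
      refine (ofHom_comp_fromSingleMk _ (by lia) _).trans ?_
      exact congrArg (Cochain.single · 2) ((Category.assoc _ _ _).symm.trans
        ((congrArg (· ≫ _) hp).trans (Category.assoc _ _ _)))
    rw [δ_sub, Cochain.δ_single _ 1 2 rfl (-2) 1 rfl rfl, Cochain.δ_single _ 1 2 rfl (-1) 2 rfl rfl]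
    change _ = (x.postcomp Y.ι').1 - (y.precomp P.π').1
    rw [e1, e2]
    have d1 : P.cochainComplex.d (-2) (-2 + 1) = _ := P.cochainComplex_d (-2) (-1) 2 1 rfl rfl
    have d0 : P.cochainComplex.d (-1) (-1 + 1) = _ := P.cochainComplex_d (-1) 0 1 0 rfl rfl
    rw [d1, d0,
      Y.cochainComplex_d 0 1 0 1 rfl rfl, Y.cochainComplex_d 1 2 1 2 rfl rfl]
    simp only [Category.assoc, Iso.inv_hom_id_assoc, Int.negOnePow_even 2 even_two, one_smul]
    rw [reassoc_of% h1, reassoc_of% h2, reassoc_of% h3]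
    abel
  have key : ShiftedHom.map (Cocycle.equivHomShift.symm (x.postcomp Y.ι')) DerivedCategory.Q =
      ShiftedHom.map (Cocycle.equivHomShift.symm (y.precomp P.π')) DerivedCategory.Q := by
    simp only [ShiftedHom.map]
    rw [DerivedCategory.Q_map_eq_of_homotopy]
    apply HomotopyCategory.homotopyOfEq
    rw [← CohomologyClass.toHom_mk, ← CohomologyClass.toHom_mk, h]
  rw [Cocycle.equivHomShift_symm_postcomp, Cocycle.equivHomShift_symm_precomp,
    ← ShiftedHom.comp_mk₀ _ 0 rfl, ← ShiftedHom.mk₀_comp 0 rfl, ShiftedHom.map_comp,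
    ShiftedHom.map_comp, ShiftedHom.map_mk₀, ShiftedHom.map_mk₀, ShiftedHom.comp_mk₀,
    ShiftedHom.mk₀_comp] at key
  rw [ShiftedHom.mk₀_comp, ShiftedHom.mk₀_comp, ShiftedHom.comp_mk₀, ShiftedHom.comp_mk₀,
    Functor.map_comp, Functor.map_inv, Category.assoc]
  congr 1
  have key' : ShiftedHom.map (Cocycle.equivHomShift.symm x) DerivedCategory.Q ≫
      (CategoryTheory.shiftFunctor (DerivedCategory C) (2 : ℤ)).map
        ((DerivedCategory.singleFunctorIsoCompQ C 0).inv.app N) =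
      DerivedCategory.Q.map P.π' ≫
        ShiftedHom.map (Cocycle.equivHomShift.symm y) DerivedCategory.Q ≫
          inv ((CategoryTheory.shiftFunctor (DerivedCategory C) (2 : ℤ)).map
              (DerivedCategory.Q.map Y.ι')) ≫
            (CategoryTheory.shiftFunctor (DerivedCategory C) (2 : ℤ)).map
              ((DerivedCategory.singleFunctorIsoCompQ C 0).inv.app N) := by
    rw [← reassoc_of% key, IsIso.hom_inv_id_assoc]
  rw [IsIso.inv_comp_eq]
  exact key'

end ExtComparison

/-! ### The differential `d₂` through a projective resolution -/

section Zigzag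

open CochainComplex CochainComplex.HomComplex Abelian

variable {C : Type u} [Category.{v} C] [Abelian C]

lemma equivHomShift_mk₀ {K L : CochainComplex C ℤ} (f : K ⟶ L) :
    Cocycle.equivHomShift (ShiftedHom.mk₀ (0 : ℤ) rfl f) = Cocycle.ofHom f := by
  ext p
  simp [Cocycle.equivHomShift_apply, ShiftedHom.mk₀, CategoryTheory.shiftFunctorZero',
    Cochain.rightUnshift_v _ _ _ _ _ _ _ (add_zero p), CochainComplex.shiftFunctorZero_inv_app_f]

variable [HasExt.{w} C]

/-- In degree `0`, the cocycle `f ≫ ι : M ⟶ Y⁰` represents `f : M ⟶ N`. -/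
lemma extMk_comp_ι {M N : C} (Y : InjectiveResolution N) (f : M ⟶ N)
    (h : (f ≫ Y.ι.f 0) ≫ Y.cocomplex.d 0 1 = 0) :
    Y.extMk (f ≫ Y.ι.f 0) 1 rfl h = Ext.mk₀ f := by
  have := HasDerivedCategory.standard C
  obtain ⟨i, hi0⟩ : ∃ i : N ⟶ Y.cocomplex.X 0, i = Y.ι.f 0 := ⟨_, rfl⟩
  have hi1 : i ≫ Y.cocomplex.d 0 1 = 0 := by
    rw [hi0]
    exact Y.ι_f_zero_comp_complex_d
  have h1 : Y.extMk i 1 rfl hi1 = Ext.mk₀ (𝟙 N) := by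
    ext
    have hi : Y.ι'.f 0 = (HomologicalComplex.singleObjXSelf (.up ℤ) 0 N).hom ≫
        i ≫ (Y.cochainComplexXIso 0 0 rfl).inv := by
      rw [Y.ι'_f_zero, hi0]
    have hi' : (i ≫ (Y.cochainComplexXIso 0 0 rfl).inv) ≫ Y.cochainComplex.d 0 1 = 0 := by
      rw [Y.cochainComplex_d 0 1 0 1 rfl rfl]
      simp [reassoc_of% hi1]
    have hc : (Cocycle.fromSingleMk (i ≫ (Y.cochainComplexXIso 0 0 rfl).inv) (zero_add 0) 1 rfl
        hi' : Cocycle _ _ 0) = Cocycle.ofHom Y.ι' := by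
      ext : 1
      refine (Cochain.fromSingleEquiv (zero_add 0)).injective ?_
      refine (Cochain.fromSingleEquiv_fromSingleMk _ _).trans ?_
      change _ = (HomologicalComplex.singleObjXSelf (.up ℤ) 0 N).inv ≫ (Cochain.ofHom Y.ι').v 0 0 _
      rw [Cochain.ofHom_v, hi]
      exact (Iso.inv_hom_id_assoc _ _).symm
    have hm : ShiftedHom.map (Cocycle.equivHomShift.symm (Cocycle.fromSingleMk
        (i ≫ (Y.cochainComplexXIso 0 0 rfl).inv) (zero_add 0) 1 rfl hi')) DerivedCategory.Q =
        ShiftedHom.mk₀ (0 : ℤ) rfl (DerivedCategory.Q.map Y.ι') := by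
      rw [hc, ← equivHomShift_mk₀, AddEquiv.symm_apply_apply, ShiftedHom.map_mk₀]
    rw [Y.extMk_hom, Ext.mk₀_hom]
    refine (congrArg (fun z => (ShiftedHom.mk₀ (0 : ℤ) rfl
      ((DerivedCategory.singleFunctorIsoCompQ C 0).hom.app N)).comp (z.comp (ShiftedHom.mk₀ (0 : ℤ)
        rfl (inv (DerivedCategory.Q.map Y.ι') ≫
          (DerivedCategory.singleFunctorIsoCompQ C 0).inv.app N)) (zero_add 0)) (add_zero 0))
            hm).trans ?_
    rw [ShiftedHom.mk₀_comp_mk₀, ShiftedHom.mk₀_comp_mk₀]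
    congr 1
    rw [IsIso.hom_inv_id_assoc, Iso.hom_inv_id_app]
    exact ((DerivedCategory.singleFunctor C 0).map_id N).symm
  have h2 := Y.mk₀_comp_extMk i 1 rfl hi1 f
  rw [h1, Ext.mk₀_comp_mk₀, Category.comp_id] at h2
  rw [h2]
  simp only [hi0]

lemma E₂EquivExt_mk (K : ChainComplex C ℕ) {N : C} (Y : InjectiveResolution N) (p q : ℕ)
    (a : (homDouble K Y.cocomplex).Z₂ p q) :
    E₂EquivExt K Y p q (QuotientAddGroup.mk a) = E₂ToExtAux K Y p q a := rfl

/-- The differential `d₂` of the class of `θ : H₁(K) ⟶ N`, computed with the help of a projective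
resolution `P` of `M` and a morphism `m : M ⟶ H₀(K)`: if `γ`, `β` are the first two components of a
lift of `m` to `P ⟶ K`, then the obstruction to extending the lift is a cocycle `P₂ ⟶ H₁(K)`, and
its composite with `θ` represents the class. -/
lemma mk₀_comp_extD₂_mk₀ (K : ChainComplex C ℕ) {M N : C} (Y : InjectiveResolution N)
    (P : ProjectiveResolution M) (m : M ⟶ K.homology 0) (θ : K.homology 1 ⟶ N)
    (γ : P.complex.X 0 ⟶ K.cycles 0) (hγ : γ ≫ K.homologyπ 0 = P.π.f 0 ≫ m)
    (β : P.complex.X 1 ⟶ K.X 1) (hβ : β ≫ K.d 1 0 = P.complex.d 1 0 ≫ γ ≫ K.iCycles 0)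
    (c : P.complex.X 2 ⟶ K.cycles 1) (hc : c ≫ K.iCycles 1 = P.complex.d 2 1 ≫ β)
    (hu : P.complex.d 3 2 ≫ c ≫ K.homologyπ 1 ≫ θ = 0) :
    (Ext.mk₀ m).comp (extD₂ K Y 0 0 (Ext.mk₀ θ)) (zero_add 2) =
      P.extMk (c ≫ K.homologyπ 1 ≫ θ) 3 rfl hu := by
  obtain ⟨i, hi0⟩ : ∃ i : N ⟶ Y.cocomplex.X 0, i = Y.ι.f 0 := ⟨_, rfl⟩
  have hi1 : i ≫ Y.cocomplex.d 0 1 = 0 := by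
    rw [hi0]
    exact Y.ι_f_zero_comp_complex_d
  obtain ⟨a, ha, haθ⟩ := exists_inducedOnHomology K Y (θ ≫ i)
  have haZ : a ∈ (homDouble K Y.cocomplex).Z₂ 0 1 := by
    have h2 : K.d 2 1 ≫ a ≫ Y.cocomplex.d 0 1 = 0 := by rw [reassoc_of% ha, Limits.zero_comp]
    refine ⟨?_, (inducedOnHomology_eq_zero_iff K Y _ h2).1 ?_⟩
    · change (-1 : ℤ) ^ (0 + 1 + 1) • (K.d 2 1 ≫ a) = 0
      rw [ha, smul_zero]
    · rw [inducedOnHomology_comp K Y a ha h2, haθ, Category.assoc, hi1, Limits.comp_zero]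
  have hθ : E₂EquivExt K Y 0 1 (QuotientAddGroup.mk ⟨a, haZ⟩) = Ext.mk₀ θ := by
    rw [E₂EquivExt_mk, ← extMk_comp_ι Y θ (by
      rw [← hi0]; exact (Category.assoc _ _ _).trans (by rw [hi1, Limits.comp_zero]))]
    change Y.extMk (inducedOnHomology K Y a ha) 1 rfl
      (inducedOnHomology_cocycle K Y haZ) = _
    simp only [haθ, hi0]
  obtain ⟨b, hb⟩ := DoubleComplex.exists_zigzag (D := homDouble K Y.cocomplex) ⟨a, haZ⟩
  change K.X 0 ⟶ Y.cocomplex.X 1 at b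
  have hb' : K.d 1 0 ≫ b = a ≫ Y.cocomplex.d 0 1 := by
    have h : (-1 : ℤ) ^ (1 + 0 + 1) • (K.d 1 0 ≫ b) = a ≫ Y.cocomplex.d 0 1 := hb
    simpa using h
  have hbd : K.d 1 0 ≫ b ≫ Y.cocomplex.d 1 2 = 0 := by
    rw [reassoc_of% hb', Y.cocomplex.d_comp_d, Limits.comp_zero]
  have hd : extD₂ K Y 0 0 (Ext.mk₀ θ) =
      Y.extMk (inducedOnHomology K Y (b ≫ Y.cocomplex.d 1 2) hbd) 3 rfl
        (inducedOnHomology_cocycle K Y (DoubleComplex.δ''_mem_Z₂ hb)) := by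
    have h1 : (E₂EquivExt K Y 0 1).symm (Ext.mk₀ θ) = QuotientAddGroup.mk ⟨a, haZ⟩ := by
      rw [← hθ, AddEquiv.symm_apply_apply]
    change E₂EquivExt K Y 2 0 ((homDouble K Y.cocomplex).d₂ 0 0
      ((E₂EquivExt K Y 0 1).symm (Ext.mk₀ θ))) = _
    rw [h1, DoubleComplex.d₂_mk _ b hb]
    rfl
  rw [hd]
  refine (Y.mk₀_comp_extMk _ _ _ _ m).trans (extMk_eq_extMk_of_zigzag P Y _ _ _ _ (β ≫ a)
    (γ ≫ K.iCycles 0 ≫ b) ?_ ?_ ?_).symm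
  · rw [← reassoc_of% hc, ← inducedOnHomology_spec K Y a ha, haθ]
    refine Eq.trans (by simp only [Category.assoc]) (congrArg ((c ≫ K.homologyπ 1 ≫ θ) ≫ ·) hi0)
  · rw [Category.assoc, ← hb', reassoc_of% hβ]
  · simp only [Category.assoc]
    rw [← inducedOnHomology_spec K Y _ hbd, reassoc_of% hγ]
    exact Category.assoc _ _ _

end Zigzag

/-! ### Elements of `S ⊗_R M`, of homology and of `Tor` -/

section BaseChangeElements

variable {R S : Type u} [Ring R] [Ring S] (f : R →+* S)
  {M : Type u} [AddCommGroup M] [Module R M]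

lemma baseChangeMk_add (s : S) (m m' : M) :
    baseChangeMk f s (m + m') = baseChangeMk f s m + baseChangeMk f s m' := by
  simp [baseChangeMk, TensorProduct.tmul_add]

lemma baseChangeMk_sub (s : S) (m m' : M) :
    baseChangeMk f s (m - m') = baseChangeMk f s m - baseChangeMk f s m' := by
  simp [baseChangeMk, TensorProduct.tmul_sub]

lemma baseChangeMk_zero (s : S) : baseChangeMk f s (0 : M) = 0 := by
  simp [baseChangeMk]

lemma smul_baseChangeMk (s s' : S) (m : M) :
    s • baseChangeMk f s' m = baseChangeMk f (s * s') m := by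
  change s • (baseChangeRel f M).mkQ _ = _
  rw [← map_smul, TensorProduct.smul_tmul', smul_eq_mul]
  rfl

lemma baseChangeMk_mul_map (s : S) (r : R) (m : M) :
    baseChangeMk f (s * f r) m = baseChangeMk f s (r • m) :=
  (Submodule.Quotient.eq _).2 (Submodule.subset_span ⟨s, r, m, rfl⟩)

lemma baseChangeMk_map (r : R) (m : M) : baseChangeMk f (f r) m = baseChangeMk f 1 (r • m) := by
  rw [← baseChangeMk_mul_map, one_mul]

variable {f} (hf : Function.Surjective f)

include hf in
lemma exists_baseChangeMk_one (z : BaseChange f M) : ∃ m, baseChangeMk f 1 m = z := by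
  obtain ⟨z, rfl⟩ := (baseChangeRel f M).mkQ_surjective z
  induction z using TensorProduct.induction_on with
  | zero => exact ⟨0, by rw [baseChangeMk_zero, map_zero]⟩
  | tmul s m =>
    obtain ⟨r, rfl⟩ := hf s
    exact ⟨r • m, (baseChangeMk_map f r m).symm⟩
  | add x y hx hy =>
    obtain ⟨m, hm⟩ := hx
    obtain ⟨m', hm'⟩ := hy
    exact ⟨m + m', by rw [baseChangeMk_add, hm, hm', map_add]⟩

/-- The inverse `S ⊗_R M → M / (ker f) M` of `m ↦ 1 ⊗ m`, on the level of `S ⊗_ℤ M`. -/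
def baseChangeToQuotient :
    S ⊗[ℤ] M →+ M ⧸ (RingHom.ker f • (⊤ : Submodule R M)) :=
  TensorProduct.liftAddHom (R := ℤ)
    (AddMonoidHom.mk' (fun s => AddMonoidHom.mk'
        (fun m => Submodule.Quotient.mk (Function.surjInv hf s • m))
        (fun m m' => by rw [smul_add, Submodule.Quotient.mk_add]))
      (fun s s' => by
        ext m
        change (Submodule.Quotient.mk _ : M ⧸ (RingHom.ker f • (⊤ : Submodule R M))) =
          Submodule.Quotient.mk _ + Submodule.Quotient.mk _
        rw [← Submodule.Quotient.mk_add, Submodule.Quotient.eq, ← add_smul, ← sub_smul]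
        refine Submodule.smul_mem_smul ?_ Submodule.mem_top
        rw [RingHom.mem_ker, map_sub, map_add]
        simp [Function.surjInv_eq hf]))
    (fun n s m => by
      change (Submodule.Quotient.mk _ : M ⧸ (RingHom.ker f • (⊤ : Submodule R M))) =
        Submodule.Quotient.mk _
      rw [Submodule.Quotient.eq, smul_comm, ← smul_assoc, ← sub_smul]
      refine Submodule.smul_mem_smul ?_ Submodule.mem_top
      rw [RingHom.mem_ker, map_sub, map_zsmul]
      simp [Function.surjInv_eq hf])

lemma baseChangeToQuotient_tmul (r : R) (m : M) :
    baseChangeToQuotient hf (f r ⊗ₜ[ℤ] m) = Submodule.Quotient.mk (r • m) := by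
  change Submodule.Quotient.mk _ = _
  rw [Submodule.Quotient.eq, ← sub_smul]
  refine Submodule.smul_mem_smul ?_ Submodule.mem_top
  rw [RingHom.mem_ker, map_sub, Function.surjInv_eq hf, sub_self]

lemma baseChangeToQuotient_smul (r : R) (z : S ⊗[ℤ] M) :
    baseChangeToQuotient hf (f r • z) = r • baseChangeToQuotient hf z := by
  induction z using TensorProduct.induction_on with
  | zero => rw [smul_zero, map_zero, smul_zero]
  | tmul s m =>
    obtain ⟨r', rfl⟩ := hf s
    rw [TensorProduct.smul_tmul', smul_eq_mul, ← map_mul, baseChangeToQuotient_tmul,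
      baseChangeToQuotient_tmul, mul_smul, Submodule.Quotient.mk_smul]
  | add x y hx hy => rw [smul_add, map_add, map_add, smul_add, hx, hy]

include hf in
/-- For a surjective morphism of rings `f : R → S`, the group `S ⊗_R M` is `M / (ker f) M`. -/
lemma baseChangeMk_one_eq_zero_iff (m : M) :
    baseChangeMk f 1 m = 0 ↔ m ∈ RingHom.ker f • (⊤ : Submodule R M) := by
  constructor
  · intro h
    have h1 : (1 : S) ⊗ₜ[ℤ] m ∈ baseChangeRel f M := (Submodule.Quotient.mk_eq_zero _).1 h
    have h2 : ∀ z ∈ baseChangeRel f M, baseChangeToQuotient hf z = 0 := by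
      intro z hz
      induction hz using Submodule.span_induction with
      | mem z hz =>
        obtain ⟨s, r, m, rfl⟩ := hz
        obtain ⟨r', rfl⟩ := hf s
        rw [map_sub, ← map_mul, baseChangeToQuotient_tmul, baseChangeToQuotient_tmul, mul_smul,
          sub_self]
      | zero => exact map_zero _
      | add x y _ _ hx hy => rw [map_add, hx, hy, add_zero]
      | smul s x _ hx =>
        obtain ⟨r, rfl⟩ := hf s
        rw [baseChangeToQuotient_smul, hx, smul_zero]
    have h3 := h2 _ h1
    rw [← map_one f, baseChangeToQuotient_tmul, one_smul] at h3
    exact (Submodule.Quotient.mk_eq_zero _).1 h3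
  · intro h
    induction h using Submodule.smul_induction_on' with
    | smul r hr m _ =>
      rw [← baseChangeMk_map, (RingHom.mem_ker).1 hr]
      simp [baseChangeMk]
    | add x _ y _ hx hy => rw [baseChangeMk_add, hx, hy, add_zero]

include hf in
lemma baseChangeMk_one_eq_iff (m m' : M) :
    baseChangeMk f 1 m = baseChangeMk f 1 m' ↔
      m - m' ∈ RingHom.ker f • (⊤ : Submodule R M) := by
  rw [← baseChangeMk_one_eq_zero_iff hf, baseChangeMk_sub, sub_eq_zero]

end BaseChangeElements

section HomologyElements

variable {S : Type u} [Ring S] (K : ChainComplex (ModuleCat.{u} S) ℕ)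

lemma exists_iCycles_eq {q : ℕ} (x : K.X q) (h : ∀ j, (K.d q j).hom x = 0) :
    ∃ z : K.cycles q, (K.iCycles q).hom z = x := by
  have h0 : ModuleCat.ofHom (LinearMap.toSpanSingleton S (K.X q) x) ≫
      K.d q ((ComplexShape.down ℕ).next q) = 0 := by
    ext
    change (K.d q _).hom ((1 : S) • x) = 0
    rw [one_smul, h]
  refine ⟨(K.liftCycles _ _ rfl h0).hom (1 : S), ?_⟩
  have h1 := congrArg (fun g => g.hom (1 : S)) (K.liftCycles_i _ _ rfl h0)
  exact h1.trans (one_smul S x)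

lemma d_iCycles_apply {q : ℕ} (z : K.cycles q) (j : ℕ) :
    (K.d q j).hom ((K.iCycles q).hom z) = 0 :=
  congrArg (fun g => g.hom z) (K.iCycles_d q j)

lemma iCycles_injective (q : ℕ) : Function.Injective (K.iCycles q).hom :=
  (ModuleCat.mono_iff_injective _).1 inferInstance

lemma homologyπ_surjective (q : ℕ) : Function.Surjective (K.homologyπ q).hom :=
  (ModuleCat.epi_iff_surjective _).1 inferInstance

lemma homologyπ_eq_zero_iff {q : ℕ} (z : K.cycles q) :
    (K.homologyπ q).hom z = 0 ↔ ∃ w : K.X (q + 1), (K.d (q + 1) q).hom w = (K.iCycles q).hom z := by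
  have hi : ∀ w, (K.iCycles q).hom ((K.toCycles (q + 1) q).hom w) = (K.d (q + 1) q).hom w :=
    fun w => congrArg (fun g => g.hom w) (K.toCycles_i (q + 1) q)
  constructor
  · intro h
    have hS : (ShortComplex.mk (K.toCycles (q + 1) q) (K.homologyπ q) (by simp)).Exact :=
      ShortComplex.exact_of_g_is_cokernel _ (K.homologyIsCokernel (q + 1) q (by simp))
    obtain ⟨w, hw⟩ := (ShortComplex.moduleCat_exact_iff _).1 hS z h
    exact ⟨w, (hi w).symm.trans (congrArg _ hw)⟩
  · rintro ⟨w, hw⟩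
    rw [← hi] at hw
    rw [← iCycles_injective K q hw]
    exact congrArg (fun g => g.hom w) (K.toCycles_comp_homologyπ (q + 1) q)

end HomologyElements

section TorElements

variable {R S : Type u} [Ring R] [Ring S] {f : R →+* S} {M M' : ModuleCat.{u} R}
  (P : ProjectiveResolution M) (P' : ProjectiveResolution M') {q : ℕ}

lemma changeComplex_d_mk (i j : ℕ) (s : S) (x : P.complex.X i) :
    ((changeComplex f P).d i j).hom (baseChangeMk f s x) =
      baseChangeMk f s ((P.complex.d i j).hom x) := rfl

lemma torClass_surjective (t : (torFunctor f q).obj M) : ∃ z, torClass P q z = t := by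
  obtain ⟨z, hz⟩ := homologyπ_surjective (changeComplex f P) q ((torIso f P q).hom.hom t)
  refine ⟨z, ?_⟩
  change (torIso f P q).inv.hom ((changeComplex f P).homologyπ q z) = t
  refine (congrArg (torIso f P q).inv.hom hz).trans ?_
  exact congrArg (fun g => g.hom t) (torIso f P q).hom_inv_id

lemma torClass_eq_zero_iff (z : (changeComplex f P).cycles q) :
    torClass P q z = 0 ↔ ∃ w, ((changeComplex f P).d (q + 1) q).hom w =
      ((changeComplex f P).iCycles q).hom z := by
  rw [← homologyπ_eq_zero_iff]
  constructor
  · intro h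
    have h1 := congrArg (torIso f P q).hom.hom h
    rw [map_zero] at h1
    rw [← h1]
    exact (congrArg (fun g => g.hom ((changeComplex f P).homologyπ q z))
      (torIso f P q).inv_hom_id).symm
  · intro h
    change (torIso f P q).inv.hom (((changeComplex f P).homologyπ q).hom z) = 0
    rw [h, map_zero]

lemma exists_isTorClass (s : S) (x : P.complex.X q)
    (h : ∀ j, baseChangeMk f s ((P.complex.d q j).hom x) = 0) : ∃ t, IsTorClass f P s x t := by
  obtain ⟨z, hz⟩ := exists_iCycles_eq (changeComplex f P) (q := q) (baseChangeMk f s x) h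
  exact ⟨_, z, hz, rfl⟩

lemma exists_isTorClass_one (hf : Function.Surjective f) (t : (torFunctor f q).obj M) :
    ∃ x : P.complex.X q, IsTorClass f P 1 x t := by
  obtain ⟨z, rfl⟩ := torClass_surjective P t
  obtain ⟨x, hx⟩ := exists_baseChangeMk_one hf (((changeComplex f P).iCycles q).hom z)
  exact ⟨x, z, hx.symm, rfl⟩

variable {P P'} {s : S} {x x' : P.complex.X q} {t t' : (torFunctor f q).obj M}

lemma IsTorClass.d_eq_zero (h : IsTorClass f P s x t) (j : ℕ) :
    baseChangeMk f s ((P.complex.d q j).hom x) = 0 := by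
  obtain ⟨z, hz, -⟩ := h
  rw [← changeComplex_d_mk, ← hz]
  exact d_iCycles_apply (changeComplex f P) z j

lemma IsTorClass.congr (h : IsTorClass f P s x t) {s' : S}
    (hx : baseChangeMk f s x = baseChangeMk f s' x') : IsTorClass f P s' x' t := by
  obtain ⟨z, hz, ht⟩ := h
  exact ⟨z, hz.trans hx, ht⟩

lemma IsTorClass.add (h : IsTorClass f P s x t) (h' : IsTorClass f P s x' t') :
    IsTorClass f P s (x + x') (t + t') := by
  obtain ⟨z, hz, rfl⟩ := h
  obtain ⟨z', hz', rfl⟩ := h'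
  refine ⟨z + z', ?_, ?_⟩
  · refine (map_add ((changeComplex f P).iCycles q).hom z z').trans ?_
    rw [baseChangeMk_add]
    exact congrArg₂ _ hz hz'
  · refine Eq.trans ?_ (map_add (torIso f P q).inv.hom _ _)
    exact congrArg (torIso f P q).inv.hom (map_add ((changeComplex f P).homologyπ q).hom z z')

lemma IsTorClass.smul (h : IsTorClass f P s x t) (s' : S) :
    IsTorClass f P (s' * s) x (s' • t) := by
  obtain ⟨z, hz, rfl⟩ := h
  refine ⟨s' • z, ?_, ?_⟩
  · refine (map_smul ((changeComplex f P).iCycles q).hom s' z).trans ?_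
    rw [← smul_baseChangeMk]
    exact congrArg _ hz
  · refine Eq.trans ?_ (map_smul (torIso f P q).inv.hom _ _)
    exact congrArg (torIso f P q).inv.hom (map_smul ((changeComplex f P).homologyπ q).hom s' z)

lemma IsTorClass.smul_one (h : IsTorClass f P 1 x t) (r : R) :
    IsTorClass f P 1 (r • x) (f r • t) :=
  (h.smul (f r)).congr (by rw [mul_one, baseChangeMk_map])

lemma IsTorClass.neg (h : IsTorClass f P 1 x t) : IsTorClass f P 1 (-x) (-t) := by
  have h1 := h.smul_one (-1)
  rwa [map_neg, map_one, neg_smul, neg_smul, one_smul, one_smul] at h1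

lemma IsTorClass.sub (h : IsTorClass f P 1 x t) (h' : IsTorClass f P 1 x' t') :
    IsTorClass f P 1 (x - x') (t - t') := by
  rw [sub_eq_add_neg, sub_eq_add_neg]
  exact h.add h'.neg

lemma IsTorClass.eq_zero_iff (h : IsTorClass f P s x t) :
    t = 0 ↔ ∃ w, ((changeComplex f P).d (q + 1) q).hom w = baseChangeMk f s x := by
  obtain ⟨z, hz, rfl⟩ := h
  rw [torClass_eq_zero_iff, ← hz]

/-- If `f` is surjective, the class of `1 ⊗ x` vanishes if and only if `x` is a boundary modulo
`(ker f) P_q`. -/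
lemma IsTorClass.eq_zero_iff_one (hf : Function.Surjective f) (h : IsTorClass f P 1 x t) :
    t = 0 ↔ ∃ w : P.complex.X (q + 1), x - (P.complex.d (q + 1) q).hom w ∈
      RingHom.ker f • (⊤ : Submodule R (P.complex.X q)) := by
  rw [h.eq_zero_iff]
  constructor
  · rintro ⟨w, hw⟩
    obtain ⟨w, rfl⟩ := exists_baseChangeMk_one hf w
    exact ⟨w, (baseChangeMk_one_eq_iff hf _ _).1 hw.symm⟩
  · rintro ⟨w, hw⟩
    exact ⟨baseChangeMk f 1 w, ((baseChangeMk_one_eq_iff hf _ _).2 hw).symm⟩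

lemma IsTorClass.unique (h : IsTorClass f P s x t) (h' : IsTorClass f P s x t') : t = t' := by
  obtain ⟨z, hz, rfl⟩ := h
  obtain ⟨z', hz', rfl⟩ := h'
  rw [iCycles_injective (changeComplex f P) q (hz.trans hz'.symm)]

/-- Naturality: a morphism of resolutions that lifts `m` computes the action of `m` on `Tor`. -/
lemma IsTorClass.map (h : IsTorClass f P s x t) (m : M ⟶ M') (g : P.complex ⟶ P'.complex)
    (hg : ∀ y, (augmentation P').hom ((g.f 0).hom y) = m.hom ((augmentation P).hom y)) :
    IsTorClass f P' s ((g.f q).hom x) (((torFunctor f q).map m).hom t) := by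
  obtain ⟨z, hz, rfl⟩ := h
  let G : changeComplex f P ⟶ changeComplex f P' := ((baseChange f).mapHomologicalComplex _).map g
  refine ⟨(HomologicalComplex.cyclesMap G q).hom z, ?_, ?_⟩
  · refine (congrArg (fun g => g.hom z) (HomologicalComplex.cyclesMap_i G q)).trans ?_
    exact congrArg (G.f q).hom hz
  · have comm : g.f 0 ≫ P'.π.f 0 = P.π.f 0 ≫ m := by
      ext y
      exact hg y
    have h1 := congrArg (fun g => g.hom (((changeComplex f P).homologyπ q).hom z))
      (ProjectiveResolution.isoLeftDerivedObj_inv_naturality m P P' g comm (baseChange f) q)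
    refine Eq.trans ?_ h1.symm
    refine congrArg (torIso f P' q).inv.hom ?_
    exact (congrArg (fun g => g.hom z) (HomologicalComplex.homologyπ_naturality G q)).symm

lemma IsTorClass.map_id {P' : ProjectiveResolution M} (h : IsTorClass f P s x t)
    (g : P.complex ⟶ P'.complex)
    (hg : ∀ y, (augmentation P').hom ((g.f 0).hom y) = (augmentation P).hom y) :
    IsTorClass f P' s ((g.f q).hom x) t := by
  have h1 := h.map (𝟙 M) g hg
  rwa [(torFunctor f q).map_id] at h1

/-- A morphism of modules lifts to a morphism of projective resolutions. -/
lemma exists_resolution_lift (P : ProjectiveResolution M) (P' : ProjectiveResolution M')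
    (m : M ⟶ M') : ∃ g : P.complex ⟶ P'.complex, ∀ y,
      (augmentation P').hom ((g.f 0).hom y) = m.hom ((augmentation P).hom y) :=
  ⟨ProjectiveResolution.lift m P P', fun y => congrArg (fun h => h.hom y)
    (ProjectiveResolution.lift_commutes_zero m P P')⟩

lemma augmentation_surjective (P : ProjectiveResolution M) :
    Function.Surjective (augmentation P).hom :=
  (ModuleCat.epi_iff_surjective (P.π.f 0)).1 inferInstance

lemma augmentation_d (P : ProjectiveResolution M) (y : P.complex.X 1) :
    (augmentation P).hom ((P.complex.d 1 0).hom y) = 0 :=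
  congrArg (fun g => g.hom y) P.complex_d_comp_π_f_zero

lemma exists_d_eq_of_augmentation_eq_zero (P : ProjectiveResolution M) (y : P.complex.X 0)
    (h : (augmentation P).hom y = 0) : ∃ w, (P.complex.d 1 0).hom w = y :=
  (ShortComplex.moduleCat_exact_iff _).1 P.exact₀ y h

lemma exists_d_eq_of_d_eq_zero (P : ProjectiveResolution M) (y : P.complex.X (q + 1))
    (h : (P.complex.d (q + 1) q).hom y = 0) : ∃ w, (P.complex.d (q + 2) (q + 1)).hom w = y :=
  (ShortComplex.moduleCat_exact_iff _).1 (P.exact_succ q) y h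

end TorElements

/-! ### The quotient `M / M I` of a bimodule -/

section OfExact

variable {R : Type u} [Ring R] {M : ModuleCat.{u} R}

/-- A complex of projective modules with an augmentation `ε`, exact on elements, as a projective
resolution. -/
def projectiveResolutionOfExact (K : ChainComplex (ModuleCat.{u} R) ℕ)
    (hK : ∀ n, Projective (K.X n)) (ε : K.X 0 ⟶ M) (hε : K.d 1 0 ≫ ε = 0)
    (surj : Function.Surjective ε.hom)
    (exact₀ : ∀ x, ε.hom x = 0 → ∃ y, (K.d 1 0).hom y = x)
    (exact_succ : ∀ n x, (K.d (n + 1) n).hom x = 0 → ∃ y, (K.d (n + 2) (n + 1)).hom y = x) :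
    ProjectiveResolution M where
  complex := K
  projective := hK
  π := (ChainComplex.toSingle₀Equiv _ _).symm ⟨ε, hε⟩
  quasiIso := ⟨fun n => by
    rcases n with _ | n
    · rw [ChainComplex.quasiIsoAt₀_iff, ShortComplex.quasiIso_iff_of_zeros']
      · refine (ShortComplex.exact_and_epi_g_iff_of_iso
          (S₂ := ShortComplex.mk _ _ hε)
          (ShortComplex.isoMk (Iso.refl _) (Iso.refl _) (Iso.refl _)
            ((Category.id_comp _).trans (Category.comp_id _).symm)
            ((Category.id_comp _).trans (Category.comp_id _).symm))).2 ⟨?_, ?_⟩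
        · rw [ShortComplex.moduleCat_exact_iff]
          exact exact₀
        · exact (ModuleCat.epi_iff_surjective _).2 surj
      · exact K.shape 0 0 (by simp)
      all_goals rfl
    · rw [quasiIsoAt_iff_exactAt']
      · rw [HomologicalComplex.exactAt_iff' _ (n + 1 + 1) (n + 1) n (by simp) (by simp),
          ShortComplex.moduleCat_exact_iff]
        exact exact_succ n
      · apply ChainComplex.exactAt_succ_single_obj⟩

end OfExact

section RightQuotient

variable {k : Type v} [Field k] {A B : Type u} [Ring A] [Ring B] [Algebra k A] [Algebra k B]
  (φ : A →ₐ[k] B)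

/-- A bimodule as a left module. -/
abbrev leftModule (M : ModuleCat.{u} (A ⊗[k] Aᵐᵒᵖ)) : ModuleCat.{u} A :=
  (ModuleCat.restrictScalars (Algebra.TensorProduct.includeLeft :
    A →ₐ[k] A ⊗[k] Aᵐᵒᵖ).toRingHom).obj M

/-- The subgroup `M I` of an `A`-bimodule `M`, where `I` is the kernel of `φ : A → B`, as a left
submodule. -/
def rightKer (M : ModuleCat.{u} (A ⊗[k] Aᵐᵒᵖ)) : Submodule A (leftModule M) :=
  { AddSubgroup.closure {y : M | ∃ i : A, φ i = 0 ∧ ∃ m : M,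
      y = ((1 : A) ⊗ₜ[k] op i : A ⊗[k] Aᵐᵒᵖ) • m} with
    smul_mem' := fun a x hx => by
      change (a ⊗ₜ[k] (1 : Aᵐᵒᵖ) : A ⊗[k] Aᵐᵒᵖ) • (show M from x) ∈ AddSubgroup.closure _
      change M at x
      change x ∈ AddSubgroup.closure _ at hx
      induction hx using AddSubgroup.closure_induction with
      | mem y hy =>
        obtain ⟨i, hi, m, rfl⟩ := hy
        refine AddSubgroup.subset_closure ⟨i, hi, (a ⊗ₜ[k] (1 : Aᵐᵒᵖ) : A ⊗[k] Aᵐᵒᵖ) • m, ?_⟩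
        rw [smul_smul, smul_smul]
        simp
      | zero => rw [smul_zero]; exact zero_mem _
      | add x y _ _ hx hy => rw [smul_add]; exact add_mem hx hy
      | neg x _ hx => rw [smul_neg]; exact neg_mem hx }

variable {M N : ModuleCat.{u} (A ⊗[k] Aᵐᵒᵖ)}

/-- A morphism of left modules from a bimodule is an additive map that commutes with the left
action. -/
def leftModuleHom {N : ModuleCat.{u} A} (g : M →+ N)
    (hg : ∀ (a : A) (m : M), g ((a ⊗ₜ[k] (1 : Aᵐᵒᵖ) : A ⊗[k] Aᵐᵒᵖ) • m) = a • g m) :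
    leftModule M ⟶ N :=
  ModuleCat.ofHom (X := leftModule M) (Y := N) { g with map_smul' := hg }

variable {φ} in
lemma right_smul_mem_rightKer {i : A} (hi : φ i = 0) (m : M) :
    (((1 : A) ⊗ₜ[k] op i : A ⊗[k] Aᵐᵒᵖ) • m : M) ∈ rightKer φ M :=
  AddSubgroup.subset_closure ⟨i, hi, m, rfl⟩

/-- An additive map that commutes with the right action of `I` maps `M I` to `N I`. -/
lemma map_mem_rightKer (g : M →+ N)
    (hg : ∀ i : A, φ i = 0 → ∀ m, g (((1 : A) ⊗ₜ[k] op i : A ⊗[k] Aᵐᵒᵖ) • m) =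
      ((1 : A) ⊗ₜ[k] op i : A ⊗[k] Aᵐᵒᵖ) • g m) (x : M) (hx : x ∈ rightKer φ M) :
    g x ∈ rightKer φ N := by
  change x ∈ AddSubgroup.closure _ at hx
  change g x ∈ AddSubgroup.closure _
  induction hx using AddSubgroup.closure_induction with
  | mem y hy =>
    obtain ⟨i, hi, m, rfl⟩ := hy
    exact AddSubgroup.subset_closure ⟨i, hi, g m, hg i hi m⟩
  | zero => rw [map_zero]; exact zero_mem _
  | add x y _ _ hx hy => rw [map_add]; exact add_mem hx hy
  | neg x _ hx => rw [map_neg]; exact neg_mem hx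

/-- An additive map that vanishes on the elements `m i` vanishes on `M I`. -/
lemma map_eq_zero_of_mem_rightKer {G : Type*} [AddGroup G] (g : M →+ G)
    (hg : ∀ i : A, φ i = 0 → ∀ m, g (((1 : A) ⊗ₜ[k] op i : A ⊗[k] Aᵐᵒᵖ) • m) = 0)
    (x : M) (hx : x ∈ rightKer φ M) : g x = 0 := by
  change x ∈ AddSubgroup.closure _ at hx
  induction hx using AddSubgroup.closure_induction with
  | mem y hy =>
    obtain ⟨i, hi, m, rfl⟩ := hy
    exact hg i hi m
  | zero => rw [map_zero]
  | add x y _ _ hx hy => rw [map_add, hx, hy, add_zero]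
  | neg x _ hx => rw [map_neg, hx, neg_zero]

/-- The functor `M ↦ M / M I ≅ M ⊗_A B` from `A`-bimodules to left `A`-modules. -/
def rightQuot : ModuleCat.{u} (A ⊗[k] Aᵐᵒᵖ) ⥤ ModuleCat.{u} A where
  obj M := ModuleCat.of A (leftModule M ⧸ rightKer φ M)
  map {M N} g := ModuleCat.ofHom (Submodule.mapQ (rightKer φ M) (rightKer φ N)
    ((ModuleCat.restrictScalars _).map g).hom
    (map_mem_rightKer φ g.hom.toAddMonoidHom (fun _ _ _ => map_smul g.hom _ _)))
  map_id M := by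
    ext1
    refine Submodule.linearMap_qext _ ?_
    rfl
  map_comp g h := by
    ext1
    refine Submodule.linearMap_qext _ ?_
    rfl

instance : (rightQuot φ).Additive where
  map_add {M M' g h} := by
    ext1
    refine Submodule.linearMap_qext _ ?_
    rfl

/-- The projection `M ⟶ M / M I`. -/
def rightQuotMk : ModuleCat.restrictScalars (Algebra.TensorProduct.includeLeft :
    A →ₐ[k] A ⊗[k] Aᵐᵒᵖ).toRingHom ⟶ rightQuot φ where
  app M := ModuleCat.ofHom (X := leftModule M) (Y := leftModule M ⧸ rightKer φ M)
    (rightKer φ M).mkQ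

/-- The class in `M / M I` of an element of `M`. -/
def rightMk (m : M) : (rightQuot φ).obj M := ((rightQuotMk φ).app M).hom m

lemma rightMk_surjective (z : (rightQuot φ).obj M) : ∃ m, rightMk φ m = z :=
  (rightKer φ M).mkQ_surjective z

lemma rightMk_eq_zero_iff (m : M) : rightMk φ m = 0 ↔ m ∈ rightKer φ M :=
  Submodule.Quotient.mk_eq_zero (rightKer φ M)

lemma rightMk_add (m m' : M) : rightMk φ (m + m') = rightMk φ m + rightMk φ m' := rfl

lemma rightMk_sub (m m' : M) : rightMk φ (m - m') = rightMk φ m - rightMk φ m' := rfl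

lemma rightMk_smul (a : A) (m : M) :
    rightMk φ ((a ⊗ₜ[k] (1 : Aᵐᵒᵖ) : A ⊗[k] Aᵐᵒᵖ) • m) = a • rightMk φ m := rfl

/-- The morphism from `M / M I` induced by a morphism of left modules that vanishes on `M I`. -/
def rightQuotDesc {N : ModuleCat.{u} A} (g : leftModule M ⟶ N)
    (hg : ∀ i : A, φ i = 0 → ∀ m : M, g.hom (((1 : A) ⊗ₜ[k] op i : A ⊗[k] Aᵐᵒᵖ) • m : M) = 0) :
    (rightQuot φ).obj M ⟶ N :=
  ModuleCat.ofHom ((rightKer φ M).liftQ g.hom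
    (fun x hx => map_eq_zero_of_mem_rightKer φ (M := M) g.hom.toAddMonoidHom hg x hx))

open ModuleCat.Algebra in
/-- The left module `(A ⊗ M) / (A ⊗ M) I = A ⊗ (M / M I)` is free. -/
lemma rightQuot_barFunctor_projective :
    Projective ((rightQuot φ).obj ((barFunctor k A).obj M)) := by
  refine ⟨fun {E X} f e he => ?_⟩
  have hes := (ModuleCat.epi_iff_surjective e).1 he
  have hmk : ∀ (a : A) (m : M), rightMk φ (show (barFunctor k A).obj M from barMk a m) =
      a • rightMk φ (show (barFunctor k A).obj M from barMk (1 : A) m) := fun a m => by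
    rw [← rightMk_smul]
    refine congrArg _ (Eq.trans ?_ (smul_barMk a 1 1 m).symm)
    rw [mul_one]
    exact congrArg (barMk a) (one_smul (A ⊗[k] Aᵐᵒᵖ) m).symm
  -- the restriction of `f` to the linear subspace `M / M I` of `A ⊗ (M / M I)`
  let h₀ : M →+ X := AddMonoidHom.mk'
    (fun m => f.hom (rightMk φ (show (barFunctor k A).obj M from barMk (1 : A) m)))
    (fun m m' => by
      refine Eq.trans ?_ (map_add f.hom _ _)
      exact congrArg (fun z => f.hom (rightMk φ (M := (barFunctor k A).obj M) z))
        (TensorProduct.tmul_add (R := k) (N := M) (1 : A) m m'))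
  have h₀z : ∀ x ∈ rightKer φ M, h₀ x = 0 := map_eq_zero_of_mem_rightKer φ h₀ (fun i hi m => by
    change f.hom _ = 0
    rw [← map_zero f.hom]
    refine congrArg f.hom ((rightMk_eq_zero_iff φ _).2 ?_)
    have h1 := right_smul_mem_rightKer hi (show (barFunctor k A).obj M from barMk (1 : A) m)
    have h2 : (((1 : A) ⊗ₜ[k] op i : A ⊗[k] Aᵐᵒᵖ) •
        (show (barFunctor k A).obj M from barMk (1 : A) m)) = barMk (1 : A)
          (((1 : A) ⊗ₜ[k] op i : A ⊗[k] Aᵐᵒᵖ) • m) :=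
      (smul_barMk 1 (op i) 1 m).trans (by rw [one_mul])
    rwa [h2] at h1)
  let h₁ : (rightQuot φ).obj M →+ X :=
    QuotientAddGroup.lift (rightKer φ M).toAddSubgroup h₀ h₀z
  have h₁mk : ∀ m : M, h₁ (rightMk φ m) =
    f.hom (rightMk φ (show (barFunctor k A).obj M from barMk (1 : A) m)) := fun m => rfl
  let h : (rightQuot φ).obj M →ₗ[k] X :=
    { h₁ with
      map_smul' := fun c z => by
        obtain ⟨m, rfl⟩ := rightMk_surjective φ z
        change h₁ (algebraMap k A c • rightMk φ m) = algebraMap k A c • h₁ (rightMk φ m)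
        rw [← rightMk_smul, h₁mk, h₁mk, ← map_smul, ← hmk]
        refine congrArg (fun z => f.hom (rightMk φ (M := (barFunctor k A).obj M) z)) ?_
        change (1 : A) ⊗ₜ[k] (c • m) = (algebraMap k A c) ⊗ₜ[k] m
        rw [← TensorProduct.smul_tmul, Algebra.algebraMap_eq_smul_one] }
  let e' : E →ₗ[k] X := { e.hom.toAddMonoidHom with map_smul' := fun c z => map_smul e.hom _ z }
  obtain ⟨j, hj⟩ := Module.projective_lifting_property e' h hes
  have hje : ∀ z, e.hom (j z) = h z := fun z => DFunLike.congr_fun hj z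
  let mk' : M →ₗ[k] (rightQuot φ).obj M :=
    { toFun := rightMk φ
      map_add' := fun _ _ => rfl
      map_smul' := fun _ _ => rfl }
  let l : BarStep k A M →+ E := (TensorProduct.lift
    ((Algebra.lsmul k k E : A →ₐ[k] Module.End k E).toLinearMap.compl₂
      (j ∘ₗ mk'))).toAddMonoidHom
  have hl : ∀ (a : A) (m : M), l (barMk a m) = a • j (rightMk φ m) := fun a m => rfl
  let L : leftModule ((barFunctor k A).obj M) ⟶ E :=
    leftModuleHom (M := (barFunctor k A).obj M) l (fun a z => by
      change l ((a ⊗ₜ[k] (1 : Aᵐᵒᵖ) : A ⊗[k] Aᵐᵒᵖ) • (show BarStep k A M from z)) = a • l z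
      change BarStep k A M at z
      induction z using barStep_induction with
      | zero => rw [smul_zero, map_zero, smul_zero]
      | add x y hx hy => rw [smul_add, map_add, map_add, smul_add, hx, hy]
      | mk x m =>
        rw [smul_barMk, hl, hl, mul_smul]
        exact congrArg (fun z => a • x • j (rightMk φ z)) (one_smul (A ⊗[k] Aᵐᵒᵖ) m))
  refine ⟨rightQuotDesc φ L (fun i hi z => ?_), ?_⟩
  · change l ((((1 : A) ⊗ₜ[k] op i : A ⊗[k] Aᵐᵒᵖ)) • (show BarStep k A M from z)) = 0
    change BarStep k A M at z
    induction z using barStep_induction with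
    | zero => rw [smul_zero, map_zero]
    | add x y hx hy => rw [smul_add, map_add, hx, hy, add_zero]
    | mk x m =>
      rw [smul_barMk, hl, (rightMk_eq_zero_iff φ _).2 (right_smul_mem_rightKer hi m), map_zero,
        smul_zero]
  · ext z
    obtain ⟨z, rfl⟩ := rightMk_surjective φ z
    change BarStep k A M at z
    change e.hom (l z) = f.hom (rightMk φ (M := (barFunctor k A).obj M) z)
    induction z using barStep_induction with
    | zero =>
      rw [map_zero, map_zero]
      exact (map_zero f.hom).symm
    | add x y hx hy =>
      rw [map_add, map_add, hx, hy]
      exact (map_add f.hom _ _).symm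
    | mk x m =>
      rw [hl, map_smul, hje]
      refine Eq.trans ?_ (congrArg f.hom (hmk x m)).symm
      exact (map_smul f.hom x _).symm

end RightQuotient

/-! ### The resolution `X / X I` of `B` -/

section QuotBar

variable {k : Type v} [Field k] {A B : Type u} [Ring A] [Ring B] [Algebra k A] [Algebra k B]
  (φ : A →ₐ[k] B)

/-- The complex `X / X I` of left `A`-modules, for a complex `X` of `A`-bimodules. -/
abbrev quotComplex (X : ChainComplex (ModuleCat.{u} (A ⊗[k] Aᵐᵒᵖ)) ℕ) :
    ChainComplex (ModuleCat.{u} A) ℕ :=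
  ((rightQuot φ).mapHomologicalComplex _).obj X

lemma barComplex_d_apply (n : ℕ) (x : barObj k A (n + 2)) :
    ((barComplex k A).d (n + 1) n).hom x = (barD k A (n + 1)).hom x :=
  congrArg (fun g => g.hom x) (barComplex_d k A n)

/-- The class in `X_n / X_n I` of an element of the bar complex `X` of `A`. -/
def quotBarMk (n : ℕ) (x : barObj k A (n + 1)) : (quotComplex φ (barComplex k A)).X n :=
  rightMk φ (M := barObj k A (n + 1)) x

lemma quotBarMk_surjective (n : ℕ) (z : (quotComplex φ (barComplex k A)).X n) :
    ∃ x, quotBarMk φ n x = z :=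
  rightMk_surjective φ (M := barObj k A (n + 1)) z

lemma quotBarMk_d (n : ℕ) (x : barObj k A (n + 2)) :
    ((quotComplex φ (barComplex k A)).d (n + 1) n).hom (quotBarMk φ (n + 1) x) =
      quotBarMk φ n ((barD k A (n + 1)).hom x) :=
  congrArg (quotBarMk φ n) (barComplex_d_apply n x)

lemma quotBarMk_eq_zero_iff (n : ℕ) (x : barObj k A (n + 1)) :
    quotBarMk φ n x = 0 ↔ x ∈ rightKer φ (barObj k A (n + 1)) :=
  rightMk_eq_zero_iff φ (M := barObj k A (n + 1)) x

lemma quotBarMk_sub (n : ℕ) (x y : barObj k A (n + 1)) :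
    quotBarMk φ n (x - y) = quotBarMk φ n x - quotBarMk φ n y := rfl

lemma quotBarMk_smul (n : ℕ) (a : A) (x : barObj k A (n + 1)) :
    quotBarMk φ n ((a ⊗ₜ[k] (1 : Aᵐᵒᵖ) : A ⊗[k] Aᵐᵒᵖ) • x) = a • quotBarMk φ n x := rfl

open ModuleCat.Algebra in
variable (k A) in
/-- The contraction `x ↦ 1 ⊗ x` of the bar complex, as an additive map. -/
def barInsHom (n : ℕ) : barObj k A n →+ barObj k A (n + 1) :=
  AddMonoidHom.mk' barIns (fun x y => TensorProduct.tmul_add (R := k) (1 : A) x y)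

lemma barIns_right_smul {n : ℕ} (c : Aᵐᵒᵖ) (x : barObj k A n) :
    barIns (((1 : A) ⊗ₜ[k] c : A ⊗[k] Aᵐᵒᵖ) • x) =
      ((1 : A) ⊗ₜ[k] c : A ⊗[k] Aᵐᵒᵖ) • barIns x := by
  refine Eq.trans ?_ (smul_barMk (M := barObj k A n) 1 c 1 x).symm
  rw [one_mul]
  rfl

lemma barIns_mem_rightKer {n : ℕ} (x : barObj k A n) (hx : x ∈ rightKer φ (barObj k A n)) :
    barIns x ∈ rightKer φ (barObj k A (n + 1)) :=
  map_mem_rightKer φ (barInsHom k A n) (fun i _ m => barIns_right_smul (op i) m) x hx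

/-- The augmentation `x ↦ φ(dx)` of the quotient `X / X I` of the bar complex `X` of `A`. -/
def quotBarAug : (quotComplex φ (barComplex k A)).X 0 ⟶ leftRestrict φ :=
  rightQuotDesc φ (M := barObj k A 1) (N := leftRestrict φ)
    (leftModuleHom (N := leftRestrict φ)
      (AddMonoidHom.mk' (fun x => (φ (show A from (barD k A 0).hom x) : B)) (fun x y => by
        rw [map_add]
        exact map_add φ _ _))
      (fun a x => by
        change φ (show A from (barD k A 0).hom _) = φ a * φ (show A from (barD k A 0).hom x)
        rw [map_smul, ← map_mul]
        exact congrArg (fun z => φ (a * z)) (mul_one (M := A) _)))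
    (fun i hi x => by
      change φ (show A from (barD k A 0).hom _) = 0
      rw [map_smul]
      refine (map_mul φ 1 _).trans ?_
      refine (congrArg (φ 1 * ·) (map_mul φ _ i)).trans ?_
      rw [hi, mul_zero, mul_zero])

lemma quotBarAug_mk (x : barObj k A 1) :
    (quotBarAug φ).hom (quotBarMk φ 0 x) = φ (show A from (barD k A 0).hom x) := rfl

/-- The resolution `X / X I` of the left `A`-module `B`, where `X` is the bar resolution of `A`. It
is exact since the contraction `x ↦ 1 ⊗ x` of `X` is a morphism of right modules. -/
def quotBarResolution (hφ : Function.Surjective φ) : ProjectiveResolution (leftRestrict φ) :=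
  projectiveResolutionOfExact (quotComplex φ (barComplex k A))
    (fun n => rightQuot_barFunctor_projective φ (M := barObj k A n))
    (quotBarAug φ)
    (by
      ext x
      obtain ⟨x, rfl⟩ := quotBarMk_surjective φ 1 x
      refine (congrArg (quotBarAug φ).hom (quotBarMk_d φ 0 x)).trans ?_
      rw [quotBarAug_mk]
      refine (congrArg φ ?_).trans (map_zero φ)
      exact congrArg (fun g => g.hom x) (barD_comp (k := k) (B := A) 0))
    (fun b => by
      obtain ⟨a, rfl⟩ := hφ b
      exact ⟨quotBarMk φ 0 (barIns (barOf k a)), congrArg φ (barD_zero_ins (barOf k a))⟩)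
    (fun x hx => by
      obtain ⟨x, rfl⟩ := quotBarMk_surjective φ 0 x
      rw [quotBarAug_mk] at hx
      refine ⟨quotBarMk φ 1 (barIns x), ?_⟩
      rw [quotBarMk_d, barD_succ_ins, quotBarMk_sub, sub_eq_self, quotBarMk_eq_zero_iff]
      let a : A := (barD k A 0).hom x
      have h := right_smul_mem_rightKer (φ := φ) (i := a) hx (M := barObj k A 1)
        (barIns (barOf k (1 : A)))
      have h2 : ((1 : A) ⊗ₜ[k] op a : A ⊗[k] Aᵐᵒᵖ) • barOf k (1 : A) = (barD k A 0).hom x :=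
        (one_mul (M := A) _).trans (one_mul (M := A) _)
      rwa [← barIns_right_smul, h2] at h)
    (fun n x hx => by
      obtain ⟨x, rfl⟩ := quotBarMk_surjective φ (n + 1) x
      rw [quotBarMk_d, quotBarMk_eq_zero_iff] at hx
      refine ⟨quotBarMk φ (n + 2) (barIns x), ?_⟩
      rw [quotBarMk_d, barD_succ_ins, quotBarMk_sub, sub_eq_self, quotBarMk_eq_zero_iff]
      exact barIns_mem_rightKer φ _ hx)

/-- The class in the resolution `X / X I` of `B` of an element of the bar complex `X` of `A`. -/
def quotBarCls (hφ : Function.Surjective φ) (n : ℕ) (x : barObj k A (n + 1)) :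
    (quotBarResolution φ hφ).complex.X n := quotBarMk φ n x

lemma quotBar_augmentation (hφ : Function.Surjective φ) (x : barObj k A 1) :
    (augmentation (quotBarResolution φ hφ)).hom (quotBarCls φ hφ 0 x) =
      φ (show A from (barD k A 0).hom x) := rfl

lemma quotBarCls_d (hφ : Function.Surjective φ) (n : ℕ) (x : barObj k A (n + 2)) :
    ((quotBarResolution φ hφ).complex.d (n + 1) n).hom (quotBarCls φ hφ (n + 1) x) =
      quotBarCls φ hφ n ((barD k A (n + 1)).hom x) :=
  quotBarMk_d φ n x

/-- Right multiplication by `a` on `M / M I`. -/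
def rightQuotMul (a : A) : rightQuot φ ⟶ rightQuot φ where
  app M := rightQuotDesc φ (M := M) (N := (rightQuot φ).obj M)
    (leftModuleHom (N := (rightQuot φ).obj M)
      (AddMonoidHom.mk' (fun m => rightMk φ (((1 : A) ⊗ₜ[k] op a : A ⊗[k] Aᵐᵒᵖ) • m))
        (fun m m' => by rw [smul_add, rightMk_add]))
      (fun b m => by
        change rightMk φ _ = b • rightMk φ _
        rw [← rightMk_smul, smul_smul, smul_smul]
        simp))
    (fun i hi m => by
      change rightMk φ (((1 : A) ⊗ₜ[k] op a : A ⊗[k] Aᵐᵒᵖ) •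
        ((1 : A) ⊗ₜ[k] op i : A ⊗[k] Aᵐᵒᵖ) • m) = 0
      rw [rightMk_eq_zero_iff, smul_smul, Algebra.TensorProduct.tmul_mul_tmul, one_mul, ← op_mul]
      exact right_smul_mem_rightKer (by rw [map_mul, hi, zero_mul]) m)
  naturality M N g := by
    ext x
    obtain ⟨x, rfl⟩ := rightMk_surjective φ x
    change rightMk φ (((1 : A) ⊗ₜ[k] op a : A ⊗[k] Aᵐᵒᵖ) • g.hom x) =
      rightMk φ (g.hom (((1 : A) ⊗ₜ[k] op a : A ⊗[k] Aᵐᵒᵖ) • x))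
    rw [map_smul]

/-- The right action of `B` on `Tor^A(B, B)` is computed by right multiplication on the resolution
`X / X I` of `B`. -/
lemma IsTorClass.quotBar_right_smul {hφ : Function.Surjective φ} {q : ℕ} {x : barObj k A (q + 1)}
    {t : (torFunctor φ.toRingHom q).obj (leftRestrict φ)}
    (h : IsTorClass φ.toRingHom (quotBarResolution φ hφ) 1 (quotBarCls φ hφ q x) t) (a : A) :
    IsTorClass φ.toRingHom (quotBarResolution φ hφ) 1
      (quotBarCls φ hφ q (((1 : A) ⊗ₜ[k] op a : A ⊗[k] Aᵐᵒᵖ) • x))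
      (((torFunctor φ.toRingHom q).map (rightMul φ (φ a))).hom t) :=
  h.map (P' := quotBarResolution φ hφ) (rightMul φ (φ a))
    ((NatTrans.mapHomologicalComplex (rightQuotMul φ a) _).app (barComplex k A)) (fun y => by
      obtain ⟨y, rfl⟩ := quotBarMk_surjective φ 0 y
      refine (congrArg φ (map_smul (barD k A 0).hom _ y)).trans ?_
      exact (congrArg φ (one_mul (M := A) _)).trans (map_mul φ _ _))

variable {φ} in
/-- The kernel of `φ ⊗ φ : Aᵉ → Bᵉ` is `I ⊗ A + A ⊗ I`. -/
lemma ker_envMap_induction (hφ : Function.Surjective φ) {motive : A ⊗[k] Aᵐᵒᵖ → Prop}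
    (zero : motive 0) (add : ∀ x y, motive x → motive y → motive (x + y))
    (left : ∀ i c, φ i = 0 → motive (i ⊗ₜ c)) (right : ∀ a i, φ i = 0 → motive (a ⊗ₜ op i))
    (r : A ⊗[k] Aᵐᵒᵖ) (hr : r ∈ RingHom.ker (envMap φ).toRingHom) : motive r := by
  have h1 := TensorProduct.map_ker (LinearMap.exact_subtype_ker_map φ.toLinearMap) hφ
    (LinearMap.exact_subtype_ker_map (AlgHom.op φ).toLinearMap)
    (fun b => by
      obtain ⟨a, ha⟩ := hφ b.unop
      exact ⟨op a, congrArg op ha⟩)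
  have h2 : r ∈ LinearMap.ker (TensorProduct.map φ.toLinearMap (AlgHom.op φ).toLinearMap) := hr
  rw [h1] at h2
  obtain ⟨x, ⟨x, rfl⟩, y, ⟨y, rfl⟩, rfl⟩ := Submodule.mem_sup.1 h2
  clear h1 h2 hr
  refine add _ _ ?_ ?_
  · induction x using TensorProduct.induction_on with
    | zero => rw [map_zero]; exact zero
    | add x y hx hy =>
      rw [map_add]
      exact add _ _ hx hy
    | tmul a i => exact right a i.1.unop (congrArg unop i.2)
  · induction y using TensorProduct.induction_on with
    | zero => rw [map_zero]; exact zero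
    | add x y hx hy =>
      rw [map_add]
      exact add _ _ hx hy
    | tmul i c => exact left i.1 c i.2

end QuotBar

/-! ### The isomorphism `Tor^{Aᵉ}(Bᵉ, A) ≅ Tor^A(B, B)` -/

section Relation

variable {k : Type v} [Field k] {B : Type u} [Ring B] [Algebra k B]
  {M N : ModuleCat.{u} (B ⊗[k] Bᵐᵒᵖ)}

/-- An additive map of bimodules that commutes with the left and the right action is linear. -/
lemma map_smul_of_left_right (g : M →+ N)
    (left : ∀ (b : B) m, g ((b ⊗ₜ[k] (1 : Bᵐᵒᵖ) : B ⊗[k] Bᵐᵒᵖ) • m) =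
      (b ⊗ₜ[k] (1 : Bᵐᵒᵖ) : B ⊗[k] Bᵐᵒᵖ) • g m)
    (right : ∀ (b : B) m, g (((1 : B) ⊗ₜ[k] op b : B ⊗[k] Bᵐᵒᵖ) • m) =
      ((1 : B) ⊗ₜ[k] op b : B ⊗[k] Bᵐᵒᵖ) • g m)
    (s : B ⊗[k] Bᵐᵒᵖ) (m : M) : g (s • m) = s • g m := by
  induction s using TensorProduct.induction_on with
  | zero =>
    exact (congrArg g (zero_smul (B ⊗[k] Bᵐᵒᵖ) m)).trans
      ((map_zero g).trans (zero_smul (B ⊗[k] Bᵐᵒᵖ) (g m)).symm)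
  | add x y hx hy => rw [add_smul, add_smul, map_add, hx, hy]
  | tmul b c =>
    have h : (b ⊗ₜ[k] c : B ⊗[k] Bᵐᵒᵖ) = b ⊗ₜ[k] (1 : Bᵐᵒᵖ) * (1 : B) ⊗ₜ[k] op c.unop := by
      rw [Algebra.TensorProduct.tmul_mul_tmul, one_mul, mul_one, op_unop]
    rw [h, mul_smul, mul_smul, left, right]

/-- A relation between two bimodules that is additive, compatible with both actions, total on both
sides and injective on both sides is the graph of an isomorphism. -/
lemma exists_iso_of_relation (r : M → N → Prop)
    (sub : ∀ {t s t' s'}, r t t' → r s s' → r (t - s) (t' - s'))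
    (left : ∀ (b : B) {t t'}, r t t' → r ((b ⊗ₜ[k] (1 : Bᵐᵒᵖ) : B ⊗[k] Bᵐᵒᵖ) • t)
      ((b ⊗ₜ[k] (1 : Bᵐᵒᵖ) : B ⊗[k] Bᵐᵒᵖ) • t'))
    (right : ∀ (b : B) {t t'}, r t t' → r (((1 : B) ⊗ₜ[k] op b : B ⊗[k] Bᵐᵒᵖ) • t)
      (((1 : B) ⊗ₜ[k] op b : B ⊗[k] Bᵐᵒᵖ) • t'))
    (total : ∀ t, ∃ t', r t t') (total' : ∀ t', ∃ t, r t t')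
    (eq_zero_iff : ∀ {t t'}, r t t' → (t = 0 ↔ t' = 0)) :
    ∃ e : M ≅ N, ∀ t t', r t t' → e.hom.hom t = t' := by
  choose g hg using total
  have uniq : ∀ {t t'}, r t t' → g t = t' := fun {t t'} h =>
    sub_eq_zero.1 ((eq_zero_iff (sub (hg t) h)).1 (sub_self t))
  let G : M →+ N := AddMonoidHom.ofMapSub g fun t s => uniq (sub (hg t) (hg s))
  let L : M →ₗ[B ⊗[k] Bᵐᵒᵖ] N :=
    { G with
      map_smul' := map_smul_of_left_right G (fun b m => uniq (left b (hg m)))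
        (fun b m => uniq (right b (hg m))) }
  have hL : Function.Bijective L := by
    refine ⟨(injective_iff_map_eq_zero L).2 fun t ht => (eq_zero_iff (hg t)).2 ht, fun t' => ?_⟩
    obtain ⟨t, ht⟩ := total' t'
    exact ⟨t, uniq ht⟩
  exact ⟨(LinearEquiv.ofBijective L hL).toModuleIso, fun t t' h => uniq h⟩

end Relation

section Kappa

variable {k : Type v} [Field k] {A B : Type u} [Ring A] [Ring B] [Algebra k A] [Algebra k B]
  {φ : A →ₐ[k] B} (hφ : Function.Surjective φ)

include hφ in
lemma envMap_surjective : Function.Surjective (envMap φ).toRingHom :=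
  TensorProduct.map_surjective (R := k) (g := φ.toLinearMap) (g' := (AlgHom.op φ).toLinearMap) hφ
    (fun b => by
      obtain ⟨a, ha⟩ := hφ b.unop
      exact ⟨op a, congrArg op ha⟩)

include hφ in
/-- A left linear map that vanishes on `M I` maps `(ker (φ ⊗ φ)) M = I M + M I` to `I N`. -/
lemma map_mem_ker_smul_top {M : ModuleCat.{u} (A ⊗[k] Aᵐᵒᵖ)} {N : ModuleCat.{u} A}
    (g : leftModule M ⟶ N)
    (hg : ∀ i : A, φ i = 0 → ∀ m : M, g.hom (((1 : A) ⊗ₜ[k] op i : A ⊗[k] Aᵐᵒᵖ) • m : M) = 0)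
    (m : M) (hm : m ∈ RingHom.ker (envMap φ).toRingHom • (⊤ : Submodule (A ⊗[k] Aᵐᵒᵖ) M)) :
    g.hom m ∈ RingHom.ker φ.toRingHom • (⊤ : Submodule A N) := by
  have hgl : ∀ (a : A) (m : M), g.hom ((a ⊗ₜ[k] (1 : Aᵐᵒᵖ) : A ⊗[k] Aᵐᵒᵖ) • m : M) =
      a • (show N from g.hom m) := fun a m => map_smul g.hom a (show leftModule M from m)
  induction hm using Submodule.smul_induction_on' with
  | smul r hr m _ =>
    refine ker_envMap_induction hφ (motive := fun r => g.hom (r • m : M) ∈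
      RingHom.ker φ.toRingHom • (⊤ : Submodule A N)) ?_ ?_ ?_ ?_ r hr
    · exact (congrArg (· ∈ _) ((congrArg g.hom (zero_smul (A ⊗[k] Aᵐᵒᵖ) m)).trans
        (map_zero g.hom))).mpr (zero_mem _)
    · intro x y hx hy
      exact (congrArg (· ∈ _) ((congrArg g.hom (add_smul x y m)).trans
        (map_add g.hom _ _))).mpr (add_mem hx hy)
    · intro i c hi
      have h : (i ⊗ₜ[k] c : A ⊗[k] Aᵐᵒᵖ) = i ⊗ₜ[k] (1 : Aᵐᵒᵖ) * (1 : A) ⊗ₜ[k] c := by simp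
      rw [h, mul_smul, hgl]
      exact Submodule.smul_mem_smul hi Submodule.mem_top
    · intro a i hi
      have h : (a ⊗ₜ[k] op i : A ⊗[k] Aᵐᵒᵖ) = a ⊗ₜ[k] (1 : Aᵐᵒᵖ) * (1 : A) ⊗ₜ[k] op i := by simp
      rw [h, mul_smul, hgl, hg i hi, smul_zero]
      exact zero_mem _
  | add x _ y _ hx hy => exact (congrArg (· ∈ _) (map_add g.hom x y)).mpr (add_mem hx hy)

lemma rightKer_le_ker_smul_top {M : ModuleCat.{u} (A ⊗[k] Aᵐᵒᵖ)} (m : M) (hm : m ∈ rightKer φ M) :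
    m ∈ RingHom.ker (envMap φ).toRingHom • (⊤ : Submodule (A ⊗[k] Aᵐᵒᵖ) M) := by
  change m ∈ AddSubgroup.closure _ at hm
  induction hm using AddSubgroup.closure_induction with
  | mem y hy =>
    obtain ⟨i, hi, m, rfl⟩ := hy
    refine Submodule.smul_mem_smul ?_ Submodule.mem_top
    change φ 1 ⊗ₜ[k] op (φ i) = 0
    rw [hi, op_zero, TensorProduct.tmul_zero]
  | zero => exact zero_mem _
  | add x y _ _ hx hy => exact add_mem hx hy
  | neg x _ hx => exact neg_mem hx

include hφ in
/-- The isomorphism `Bᵉ ⊗_{Aᵉ} M ≅ B ⊗_A (M / M I)`, on elements of the kernels. -/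
lemma mem_ker_smul_top_iff {M : ModuleCat.{u} (A ⊗[k] Aᵐᵒᵖ)} (m : M) :
    m ∈ RingHom.ker (envMap φ).toRingHom • (⊤ : Submodule (A ⊗[k] Aᵐᵒᵖ) M) ↔
      rightMk φ m ∈ RingHom.ker φ.toRingHom • (⊤ : Submodule A ((rightQuot φ).obj M)) := by
  constructor
  · exact map_mem_ker_smul_top hφ ((rightQuotMk φ).app M)
      (fun i hi m => (rightMk_eq_zero_iff φ _).2 (right_smul_mem_rightKer hi m)) m
  · intro h
    have h1 : ∀ z ∈ RingHom.ker φ.toRingHom • (⊤ : Submodule A ((rightQuot φ).obj M)),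
        ∃ m' ∈ RingHom.ker (envMap φ).toRingHom • (⊤ : Submodule (A ⊗[k] Aᵐᵒᵖ) M),
          rightMk φ m' = z := by
      intro z hz
      induction hz using Submodule.smul_induction_on' with
      | smul i hi z _ =>
        obtain ⟨m, rfl⟩ := rightMk_surjective φ z
        refine ⟨(i ⊗ₜ[k] (1 : Aᵐᵒᵖ) : A ⊗[k] Aᵐᵒᵖ) • m,
          Submodule.smul_mem_smul ?_ Submodule.mem_top, rightMk_smul φ i m⟩
        change φ i ⊗ₜ[k] op (φ 1) = 0
        rw [show φ i = 0 from hi, TensorProduct.zero_tmul]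
      | add x _ y _ hx hy =>
        obtain ⟨m, hm, rfl⟩ := hx
        obtain ⟨m', hm', rfl⟩ := hy
        exact ⟨m + m', add_mem hm hm', rightMk_add φ m m'⟩
    obtain ⟨m', hm', h'⟩ := h1 _ h
    have h2 : m - m' ∈ rightKer φ M := by
      rw [← rightMk_eq_zero_iff, rightMk_sub, h', sub_self]
    rw [← sub_add_cancel m m']
    exact add_mem (rightKer_le_ker_smul_top _ h2) hm'

lemma torBB_smul_left (b : B) {q : ℕ} (t : torBB φ q) :
    (b ⊗ₜ[k] (1 : Bᵐᵒᵖ) : B ⊗[k] Bᵐᵒᵖ) • t =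
      b • (show (torFunctor φ.toRingHom q).obj (leftRestrict φ) from t) :=
  congrArg (b • ·) (one_smul Bᵐᵒᵖ (show TorBB φ q from t))

lemma torBB_smul_right (c : B) {q : ℕ} (t : torBB φ q) :
    ((1 : B) ⊗ₜ[k] op c : B ⊗[k] Bᵐᵒᵖ) • t =
      ((torFunctor φ.toRingHom q).map (rightMul φ c)).hom t :=
  one_smul B (show (torFunctor φ.toRingHom q).obj (leftRestrict φ) from
        ((torFunctor φ.toRingHom q).map (rightMul φ c)).hom t)

/-- The relation between `t ∈ Tor_q^{Aᵉ}(Bᵉ, A)` and `t' ∈ Tor_q^A(B, B)` that are represented by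
the same element of the bar resolution of `A`. -/
def KappaRel (q : ℕ) (t : torEnv φ q) (t' : torBB φ q) : Prop :=
  ∃ x : barObj k A (q + 1),
    IsTorClass (envMap φ).toRingHom (barResolution k A) (q := q) 1 x t ∧
      IsTorClass φ.toRingHom (quotBarResolution φ hφ) 1 (quotBarCls φ hφ q x) t'

/-- An element of the bar complex of `A` is a cycle in `Bᵉ ⊗_{Aᵉ} X` if and only if it is one in
`B ⊗_A (X / X I)`. -/
lemma bar_cycle_iff (q : ℕ) (x : barObj k A (q + 1)) :
    (∀ j, baseChangeMk (envMap φ).toRingHom (1 : B ⊗[k] Bᵐᵒᵖ)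
        (((barResolution k A).complex.d q j).hom x) = 0) ↔
      (∀ j, baseChangeMk φ.toRingHom (1 : B) (((quotBarResolution φ hφ).complex.d q j).hom
          (quotBarCls φ hφ q x)) = 0) := by
  refine forall_congr' fun j => ?_
  refine (baseChangeMk_one_eq_zero_iff (envMap_surjective hφ) _).trans
    (Iff.trans ?_ (baseChangeMk_one_eq_zero_iff (f := φ.toRingHom) hφ _).symm)
  exact mem_ker_smul_top_iff hφ (M := (barComplex k A).X j) (((barComplex k A).d q j).hom x)

lemma exists_kappaRel (q : ℕ) (t : torEnv φ q) : ∃ t', KappaRel hφ q t t' := by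
  obtain ⟨x, hx⟩ := exists_isTorClass_one (barResolution k A) (envMap_surjective hφ) t
  obtain ⟨t', ht'⟩ := exists_isTorClass (quotBarResolution φ hφ) (f := φ.toRingHom) 1
    (quotBarCls φ hφ q x) ((bar_cycle_iff hφ q x).1 hx.d_eq_zero)
  exact ⟨t', x, hx, ht'⟩

lemma exists_kappa (q : ℕ) :
    ∃ e : torEnv φ q ≅ torBB φ q, ∀ t t', KappaRel hφ q t t' → e.hom.hom t = t' := by
  refine exists_iso_of_relation (KappaRel hφ q) ?_ ?_ ?_ ?_ ?_ ?_
  · rintro t s t' s' ⟨x, hx, hx'⟩ ⟨y, hy, hy'⟩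
    exact ⟨x - y, hx.sub hy, hx'.sub hy'⟩
  · rintro b t t' ⟨x, hx, hx'⟩
    obtain ⟨a, rfl⟩ := hφ b
    refine ⟨(a ⊗ₜ[k] (1 : Aᵐᵒᵖ) : A ⊗[k] Aᵐᵒᵖ) • x, ?_, ?_⟩
    · have h := hx.smul_one (a ⊗ₜ[k] (1 : Aᵐᵒᵖ) : A ⊗[k] Aᵐᵒᵖ)
      have h2 : (envMap φ).toRingHom (a ⊗ₜ[k] (1 : Aᵐᵒᵖ) : A ⊗[k] Aᵐᵒᵖ) =
          φ a ⊗ₜ[k] (1 : Bᵐᵒᵖ) := congrArg (fun c => φ a ⊗ₜ[k] op c) (map_one φ)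
      rwa [h2] at h
    · rw [torBB_smul_left]
      exact hx'.smul_one a
  · rintro b t t' ⟨x, hx, hx'⟩
    obtain ⟨a, rfl⟩ := hφ b
    refine ⟨((1 : A) ⊗ₜ[k] op a : A ⊗[k] Aᵐᵒᵖ) • x, ?_, ?_⟩
    · have h := hx.smul_one ((1 : A) ⊗ₜ[k] op a : A ⊗[k] Aᵐᵒᵖ)
      have h2 : (envMap φ).toRingHom ((1 : A) ⊗ₜ[k] op a : A ⊗[k] Aᵐᵒᵖ) =
          (1 : B) ⊗ₜ[k] op (φ a) := congrArg (fun c => c ⊗ₜ[k] op (φ a)) (map_one φ)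
      rwa [h2] at h
    · rw [torBB_smul_right]
      exact hx'.quotBar_right_smul φ a
  · exact exists_kappaRel hφ q
  · intro t'
    obtain ⟨z, hz⟩ := exists_isTorClass_one (quotBarResolution φ hφ) (f := φ.toRingHom) hφ t'
    obtain ⟨x, rfl⟩ := quotBarMk_surjective φ q z
    obtain ⟨t, ht⟩ := exists_isTorClass (barResolution k A) (f := (envMap φ).toRingHom) 1
      x ((bar_cycle_iff hφ q x).2 hz.d_eq_zero)
    exact ⟨t, x, ht, hz⟩
  · rintro t t' ⟨x, hx, hx'⟩
    have h := IsTorClass.eq_zero_iff_one (f := (envMap φ).toRingHom) (P := barResolution k A)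
      (q := q) (x := x) (envMap_surjective hφ) hx
    have h' := IsTorClass.eq_zero_iff_one (f := φ.toRingHom) hφ hx'
    refine h.trans (Iff.trans ?_ h'.symm)
    constructor
    · rintro ⟨w, hw⟩
      exact ⟨quotBarCls φ hφ (q + 1) w, (mem_ker_smul_top_iff hφ (M := barObj k A (q + 1)) _).1 hw⟩
    · rintro ⟨w, hw⟩
      obtain ⟨w, rfl⟩ := quotBarMk_surjective φ (q + 1) w
      exact ⟨w, (mem_ker_smul_top_iff hφ (M := barObj k A (q + 1)) _).2 hw⟩

/-- A morphism of complexes `X → P` that vanishes on `X I` computes the relation between the two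
`Tor` groups, whatever the resolutions: its composite with a comparison map from the bar resolution
of `A` factors through a comparison map from `quotBarResolution`. -/
lemma KappaRel.of_isTorClass (q : ℕ) (X : ProjectiveResolution (regularBimodule k A))
    (P : ProjectiveResolution (leftRestrict φ)) (g : leftComplex X.complex ⟶ P.complex)
    (hg : ∀ x : X.complex.X 0, (augmentation P).hom ((g.f 0).hom x) =
      φ ((augmentation X).hom x))
    (hgI : ∀ (n : ℕ) (a : A) (x : X.complex.X n), φ a = 0 →
      (g.f n).hom (((1 : A) ⊗ₜ[k] op a : A ⊗[k] Aᵐᵒᵖ) • x) = 0)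
    (x : X.complex.X q) (t : torEnv φ q) (t' : torBB φ q)
    (hx : IsTorClass (envMap φ).toRingHom X 1 x t)
    (hx' : IsTorClass φ.toRingHom P 1 ((g.f q).hom x) t') : KappaRel hφ q t t' := by
  obtain ⟨f, hf⟩ := exists_resolution_lift (barResolution k A) X (𝟙 _)
  obtain ⟨t₁, y, hy, hy'⟩ := exists_kappaRel hφ q t
  -- the composite of `g` with a comparison map from the bar resolution descends to the quotient
  let G : leftComplex (barComplex k A) ⟶ P.complex :=
    ((ModuleCat.restrictScalars (Algebra.TensorProduct.includeLeft :
      A →ₐ[k] A ⊗[k] Aᵐᵒᵖ).toRingHom).mapHomologicalComplex _).map f ≫ g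
  have hG : ∀ n (i : A), φ i = 0 → ∀ m : (barComplex k A).X n,
      (G.f n).hom (((1 : A) ⊗ₜ[k] op i : A ⊗[k] Aᵐᵒᵖ) • m : (barComplex k A).X n) = 0 :=
    fun n i hi m => (congrArg (g.f n).hom (map_smul (f.f n).hom _ m)).trans (hgI n i _ hi)
  let l : (quotBarResolution φ hφ).complex ⟶ P.complex :=
    { f := fun n => rightQuotDesc φ (M := (barComplex k A).X n) (G.f n) (hG n)
      comm' := fun i j _ => by
        ext z
        obtain ⟨z, rfl⟩ := quotBarMk_surjective φ i z
        exact congrArg (fun h => h.hom z) (G.comm i j) }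
  have hl : IsTorClass φ.toRingHom P 1 ((g.f q).hom ((f.f q).hom y)) t₁ :=
    hy'.map_id l (fun z => by
      obtain ⟨z, rfl⟩ := quotBarMk_surjective φ 0 z
      exact (hg _).trans (congrArg φ (hf z)))
  obtain ⟨w, hw⟩ := ((hx.sub (hy.map_id f hf)).eq_zero_iff_one (envMap_surjective hφ)).1
    (sub_self t)
  have h0 := ((hx'.sub hl).eq_zero_iff_one (f := φ.toRingHom) hφ).2 ⟨(g.f (q + 1)).hom w, by
    have h1 := map_mem_ker_smul_top hφ (M := X.complex.X q) (g.f q)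
      (fun i hi m => hgI q i m hi) _ hw
    have h2 : (g.f q).hom ((X.complex.d (q + 1) q).hom w) =
        (P.complex.d (q + 1) q).hom ((g.f (q + 1)).hom w) :=
      (congrArg (fun h => h.hom w) (g.comm (q + 1) q)).symm
    rw [← h2]
    refine (congrArg (· ∈ _) ?_).mp h1
    exact (map_sub (g.f q).hom _ _).trans (congrArg (· - _) (map_sub (g.f q).hom _ _))⟩
  have h1 : t' = t₁ := sub_eq_zero.1 h0
  exact ⟨y, hy, h1 ▸ hy'⟩

end Kappa

/-! ### The bimodules `Tor_0^A(B, B)` and `Tor_1^A(B, B)` -/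

section LowDegree

variable {k : Type v} [Field k] {A B : Type u} [Ring A] [Ring B] [Algebra k A] [Algebra k B]
  {φ : A →ₐ[k] B} (hφ : Function.Surjective φ) (P : ProjectiveResolution (leftRestrict φ))

lemma augmentation_smul (a : A) (y : P.complex.X 0) :
    (augmentation P).hom (a • y) = φ a * (show B from (augmentation P).hom y) :=
  map_smul (augmentation P).hom a y

lemma augmentation_sub (y y' : P.complex.X 0) :
    (augmentation P).hom (y - y') = (augmentation P).hom y - (augmentation P).hom y' :=
  map_sub (augmentation P).hom y y'

lemma augmentation_eq_zero_of_mem (y : P.complex.X 0)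
    (hy : y ∈ RingHom.ker φ.toRingHom • (⊤ : Submodule A (P.complex.X 0))) :
    (augmentation P).hom y = 0 := by
  induction hy using Submodule.smul_induction_on' with
  | smul a ha y _ =>
    refine (augmentation_smul P a y).trans ?_
    rw [show φ a = 0 from ha, zero_mul]
    rfl
  | add x _ y _ hx hy => rw [map_add, hx, hy, add_zero]

lemma map_mem_smul_top {M N : ModuleCat.{u} A} (g : M ⟶ N) (J : Ideal A) (m : M)
    (hm : m ∈ J • (⊤ : Submodule A M)) : g.hom m ∈ J • (⊤ : Submodule A N) := by
  induction hm using Submodule.smul_induction_on' with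
  | smul a ha y _ =>
    rw [map_smul]
    exact Submodule.smul_mem_smul ha Submodule.mem_top
  | add x _ y _ hx hy =>
    rw [map_add]
    exact add_mem hx hy

/-- The relation between the class in `Tor_0^A(B, B)` of `1 ⊗ y` and the image of `y` in `B`. -/
def EZeroRel (t : torBB φ 0) (b : regularBimodule k B) : Prop :=
  ∃ y : P.complex.X 0, IsTorClass φ.toRingHom P (q := 0) 1 y t ∧ (augmentation P).hom y = b

include hφ in
lemma exists_eZero :
    ∃ e : torBB φ 0 ≅ regularBimodule k B, ∀ t b, EZeroRel P t b → e.hom.hom t = b := by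
  refine exists_iso_of_relation (EZeroRel P) ?_ ?_ ?_ ?_ ?_ ?_
  · rintro t s b c ⟨y, hy, rfl⟩ ⟨z, hz, rfl⟩
    exact ⟨y - z, hy.sub hz, augmentation_sub P y z⟩
  · rintro b t _ ⟨y, hy, rfl⟩
    obtain ⟨a, rfl⟩ := hφ b
    refine ⟨a • y, ?_, ?_⟩
    · rw [torBB_smul_left]
      exact hy.smul_one a
    · exact (augmentation_smul P a y).trans (congrArg (φ a * ·) (mul_one (M := B) _).symm)
  · rintro b t _ ⟨y, hy, rfl⟩
    obtain ⟨ρ, hρ⟩ := exists_resolution_lift P P (rightMul φ b)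
    refine ⟨(ρ.f 0).hom y, ?_, ?_⟩
    · rw [torBB_smul_right]
      exact hy.map _ ρ hρ
    · exact (hρ y).trans (one_mul (M := B) _).symm
  · intro t
    obtain ⟨y, hy⟩ := exists_isTorClass_one P (f := φ.toRingHom) hφ t
    exact ⟨_, y, hy, rfl⟩
  · intro b
    obtain ⟨y, hy⟩ := augmentation_surjective P b
    obtain ⟨t, ht⟩ := exists_isTorClass P (f := φ.toRingHom) (q := 0) 1 y (fun j => by
      rw [P.complex.shape 0 j (by simp)]
      exact baseChangeMk_zero _ _)
    exact ⟨t, y, ht, hy⟩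
  · rintro t _ ⟨y, hy, rfl⟩
    refine (IsTorClass.eq_zero_iff_one (f := φ.toRingHom) hφ hy).trans ⟨?_, fun h => ?_⟩
    · rintro ⟨w, hw⟩
      have h := augmentation_eq_zero_of_mem P _ hw
      rw [map_sub, augmentation_d, sub_zero] at h
      exact h
    · obtain ⟨w, hw⟩ := exists_d_eq_of_augmentation_eq_zero P y h
      exact ⟨w, by rw [hw, sub_self]; exact zero_mem _⟩

include hφ in
/-- The relation `EZeroRel` may be checked on any resolution, on elements `b ⊗ y`. -/
lemma EZeroRel.of_isTorClass (P' : ProjectiveResolution (leftRestrict φ)) (b : B)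
    (y : P'.complex.X 0) (t : torBB φ 0) (h : IsTorClass φ.toRingHom P' b y t) :
    EZeroRel P t (b * (show B from (augmentation P').hom y) : B) := by
  obtain ⟨a, rfl⟩ := hφ b
  obtain ⟨l, hl⟩ := exists_resolution_lift P' P (𝟙 _)
  have h1 : IsTorClass φ.toRingHom P' 1 (a • y) t := h.congr (baseChangeMk_map φ.toRingHom a y)
  exact ⟨_, h1.map_id l hl, (hl _).trans (augmentation_smul P' a y)⟩

lemma conormalMk_sub {x y : A} (hx : φ x = 0) (hy : φ y = 0) :
    conormalMk φ hφ x hx - conormalMk φ hφ y hy =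
      conormalMk φ hφ (x - y) (by rw [map_sub, hx, hy, sub_self]) := rfl

lemma left_smul_conormalMk (a : A) {x : A} (hx : φ x = 0) :
    (φ a ⊗ₜ[k] (1 : Bᵐᵒᵖ) : B ⊗[k] Bᵐᵒᵖ) • conormalMk φ hφ x hx =
      conormalMk φ hφ (a * x) (by rw [map_mul, hx, mul_zero]) :=
  SingularExtension.left_smul_ker (S := squareZeroQuotient φ hφ) (Ideal.Quotient.mk _ a)
    (SingularExtension.Ker.mk (S := squareZeroQuotient φ hφ) (Ideal.Quotient.mk _ x) hx)

lemma right_smul_conormalMk (a : A) {x : A} (hx : φ x = 0) :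
    ((1 : B) ⊗ₜ[k] op (φ a) : B ⊗[k] Bᵐᵒᵖ) • conormalMk φ hφ x hx =
      conormalMk φ hφ (x * a) (by rw [map_mul, hx, zero_mul]) :=
  SingularExtension.right_smul_ker (S := squareZeroQuotient φ hφ) (Ideal.Quotient.mk _ a)
    (SingularExtension.Ker.mk (S := squareZeroQuotient φ hφ) (Ideal.Quotient.mk _ x) hx)

variable {P} {ξ : P.complex.X 0} (hξ : (augmentation P).hom ξ = (1 : B))

/-- For a fixed `ξ ∈ P_0` over `1 ∈ B`, the relation between the class in `Tor_1^A(B, B)` of `1 ⊗ η`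
and the class of `x` in `I/I²`, if `dη = x ξ`. -/
def EOneRel (ξ : P.complex.X 0) (t : torBB φ 1) (z : conormal φ hφ) : Prop :=
  ∃ (η : P.complex.X 1) (x : A) (hx : φ x = 0), (P.complex.d 1 0).hom η = x • ξ ∧
    IsTorClass φ.toRingHom P (q := 1) 1 η t ∧ conormalMk φ hφ x hx = z

include hφ in
lemma IsTorClass.congr_ker {q : ℕ} {η η' : P.complex.X q}
    {t : (torFunctor φ.toRingHom q).obj (leftRestrict φ)}
    (h : IsTorClass φ.toRingHom P 1 η t)
    (h' : η - η' ∈ RingHom.ker φ.toRingHom • (⊤ : Submodule A (P.complex.X q))) :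
    IsTorClass φ.toRingHom P 1 η' t :=
  h.congr ((baseChangeMk_one_eq_iff (f := φ.toRingHom) hφ _ _).2 h')

include hξ in
/-- If `dη = x ξ'` with `ξ'` over `φ(a)`, then `η` may be changed modulo `I P_1` so that
`dη = x a ξ`. -/
lemma EOneRel.of_d_eq {η : P.complex.X 1} {x : A} (hx : φ x = 0) {ξ' : P.complex.X 0} (a : A)
    (hξ' : (augmentation P).hom ξ' = φ a) (hη : (P.complex.d 1 0).hom η = x • ξ') {t : torBB φ 1}
    (h : IsTorClass φ.toRingHom P (q := 1) 1 η t) :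
    EOneRel hφ ξ t (conormalMk φ hφ (x * a) (by rw [map_mul, hx, zero_mul])) := by
  obtain ⟨ζ, hζ⟩ := exists_d_eq_of_augmentation_eq_zero P (ξ' - a • ξ) (by
    refine (augmentation_sub P _ _).trans (sub_eq_zero.2 (hξ'.trans ?_))
    refine Eq.trans ?_ (augmentation_smul P a ξ).symm
    exact (mul_one (φ a)).symm.trans (congrArg (φ a * ·) hξ.symm))
  refine ⟨η - x • ζ, x * a, _, ?_, h.congr_ker hφ ?_, rfl⟩
  · rw [map_sub, map_smul, hζ, hη, smul_sub, sub_sub_cancel, mul_smul]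
  · rw [sub_sub_cancel]
    exact Submodule.smul_mem_smul hx Submodule.mem_top

include hφ in
/-- A lift to `A` of the augmentation of a projective resolution of the left `A`-module `B`. -/
lemma exists_lift_augmentation (P : ProjectiveResolution (leftRestrict φ)) :
    ∃ ψ : P.complex.X 0 ⟶ ModuleCat.of A A, ∀ y, φ (ψ.hom y) = (augmentation P).hom y := by
  let p : ModuleCat.of A A ⟶ leftRestrict φ := ModuleCat.ofHom (Y := leftRestrict φ)
    { toFun := fun a => (φ a : B)
      map_add' := map_add φ
      map_smul' := fun a x => map_mul φ a x }
  have hp : Epi p := (ModuleCat.epi_iff_surjective p).2 hφ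
  have := P.projective 0
  exact ⟨Projective.factorThru (augmentation P) p, fun y =>
    congrArg (fun g => g.hom y) (Projective.factorThru_comp (augmentation P) p)⟩

/-- For every `x ∈ I²` there is an element `θ ∈ I P_1` with `dθ = x ξ`. -/
lemma exists_d_eq_smul_of_mem_sq (ξ : P.complex.X 0) (x : A) (hx : x ∈ (RingHom.ker φ) ^ 2) :
    ∃ θ ∈ RingHom.ker φ.toRingHom • (⊤ : Submodule A (P.complex.X 1)),
      (P.complex.d 1 0).hom θ = x • ξ := by
  rw [Submodule.pow_succ, Submodule.pow_one] at hx
  change x ∈ RingHom.ker φ • RingHom.ker φ at hx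
  induction hx using Submodule.smul_induction_on' with
  | smul i hi j hj =>
    obtain ⟨θ, hθ⟩ := exists_d_eq_of_augmentation_eq_zero P (j • ξ) (by
      refine (augmentation_smul P j ξ).trans ?_
      rw [show φ j = 0 from hj, zero_mul]
      rfl)
    refine ⟨i • θ, Submodule.smul_mem_smul hi Submodule.mem_top, ?_⟩
    rw [map_smul, hθ, smul_eq_mul, mul_smul]
  | add x _ y _ hx hy =>
    obtain ⟨θ, h, hθ⟩ := hx
    obtain ⟨θ', h', hθ'⟩ := hy
    exact ⟨θ + θ', add_mem h h', by rw [map_add, hθ, hθ', add_smul]⟩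

include hξ in
lemma exists_eOne :
    ∃ e : torBB φ 1 ≅ conormal φ hφ, ∀ t z, EOneRel hφ ξ t z → e.hom.hom t = z := by
  obtain ⟨ψ, hψ⟩ := exists_lift_augmentation hφ P
  -- `d` maps an element to `I P_0` if and only if it is a cycle of `B ⊗ P`
  have hcyc : ∀ η : P.complex.X 1, (∀ j, baseChangeMk φ.toRingHom (1 : B)
      ((P.complex.d 1 j).hom η) = 0) ↔
      (P.complex.d 1 0).hom η ∈ RingHom.ker φ.toRingHom • (⊤ : Submodule A (P.complex.X 0)) := by
    intro η
    rw [← baseChangeMk_one_eq_zero_iff (f := φ.toRingHom) hφ]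
    refine ⟨fun h => h 0, fun h j => ?_⟩
    by_cases hj : j = 0
    · subst hj
      exact h
    · rw [P.complex.shape 1 j (by simpa using hj)]
      exact baseChangeMk_zero _ _
  refine exists_iso_of_relation (EOneRel hφ ξ) ?_ ?_ ?_ ?_ ?_ ?_
  · rintro t s _ _ ⟨η, x, hx, hη, ht, rfl⟩ ⟨η', x', hx', hη', hs, rfl⟩
    exact ⟨η - η', x - x', _, by rw [map_sub, hη, hη', sub_smul], ht.sub hs,
      (conormalMk_sub hφ hx hx').symm⟩
  · rintro b t _ ⟨η, x, hx, hη, ht, rfl⟩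
    obtain ⟨a, rfl⟩ := hφ b
    refine ⟨a • η, a * x, _, by rw [map_smul, hη, mul_smul], ?_,
      (left_smul_conormalMk hφ a hx).symm⟩
    rw [torBB_smul_left]
    exact ht.smul_one a
  · rintro b t _ ⟨η, x, hx, hη, ht, rfl⟩
    obtain ⟨a, rfl⟩ := hφ b
    obtain ⟨ρ, hρ⟩ := exists_resolution_lift P P (rightMul φ (φ a))
    rw [right_smul_conormalMk, torBB_smul_right]
    refine EOneRel.of_d_eq hφ hξ hx (ξ' := (ρ.f 0).hom ξ) a ?_ ?_ (ht.map _ ρ hρ)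
    · refine (hρ ξ).trans ?_
      rw [hξ]
      exact one_mul (φ a)
    · rw [← map_smul, ← hη]
      exact congrArg (fun g => g.hom η) (ρ.comm 1 0)
  · intro t
    obtain ⟨η, hη⟩ := exists_isTorClass_one P (f := φ.toRingHom) hφ t
    -- `h` is a homotopy on `P_0` from the identity to `y ↦ ψ(y) ξ`
    let u : P.complex.X 0 ⟶ P.complex.X 0 := 𝟙 _ -
      ψ ≫ ModuleCat.ofHom (LinearMap.toSpanSingleton A (P.complex.X 0) ξ)
    have hu : ∀ y, u.hom y = y - ψ.hom y • ξ := fun y => rfl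
    have hu0 : u ≫ P.π.f 0 = 0 := by
      ext y
      refine (congrArg (augmentation P).hom (hu y)).trans ?_
      refine (augmentation_sub P _ _).trans (sub_eq_zero.2 ?_)
      refine Eq.trans ?_ (augmentation_smul P (ψ.hom y) ξ).symm
      refine (hψ y).symm.trans ((mul_one (φ (ψ.hom y))).symm.trans ?_)
      exact congrArg (φ (ψ.hom y) * ·) hξ.symm
    have := P.projective 0
    let h := P.exact₀.liftFromProjective u hu0
    have hh : ∀ y, (P.complex.d 1 0).hom (h.hom y) = y - ψ.hom y • ξ := fun y =>
      (congrArg (fun g => g.hom y) (P.exact₀.liftFromProjective_comp u hu0)).trans (hu y)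
    have hI := (hcyc η).1 (hη.d_eq_zero)
    refine ⟨_, η - h.hom ((P.complex.d 1 0).hom η), ψ.hom ((P.complex.d 1 0).hom η), ?_, ?_,
      hη.congr_ker hφ ?_, rfl⟩
    · exact (hψ _).trans (augmentation_d P η)
    · rw [map_sub, hh, sub_sub_cancel]
    · rw [sub_sub_cancel]
      exact map_mem_smul_top h _ _ hI
  · intro z
    obtain ⟨x, hx, rfl⟩ := conormalMk_surjective φ hφ z
    obtain ⟨η, hη⟩ := exists_d_eq_of_augmentation_eq_zero P (x • ξ) (by
      refine (augmentation_smul P x ξ).trans ?_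
      rw [hx, zero_mul]
      rfl)
    obtain ⟨t, ht⟩ := exists_isTorClass P (f := φ.toRingHom) (q := 1) 1 η ((hcyc η).2 (by
      rw [hη]
      exact Submodule.smul_mem_smul hx Submodule.mem_top))
    exact ⟨t, η, x, hx, hη, ht, rfl⟩
  · rintro t _ ⟨η, x, hx, hη, ht, rfl⟩
    have hz : conormalMk φ hφ x hx = 0 ↔ x ∈ (RingHom.ker φ) ^ 2 := by
      have h := conormalMk_eq_iff φ hφ x 0 hx (map_zero φ)
      rwa [sub_zero] at h
    refine (IsTorClass.eq_zero_iff_one (f := φ.toRingHom) hφ ht).trans (Iff.trans ?_ hz.symm)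
    constructor
    · rintro ⟨w, hw⟩
      rw [Submodule.pow_succ, Submodule.pow_one]
      -- `ψ d` maps `I P_1` to `I²`
      have h2 : ∀ m ∈ RingHom.ker φ.toRingHom • (⊤ : Submodule A (P.complex.X 1)),
          ψ.hom ((P.complex.d 1 0).hom m) ∈ RingHom.ker φ * RingHom.ker φ := by
        intro m hm
        induction hm using Submodule.smul_induction_on' with
        | smul i hi m _ =>
          rw [map_smul, map_smul]
          exact Ideal.mul_mem_mul hi ((hψ _).trans (augmentation_d P m))
        | add x _ y _ hx hy =>
          rw [map_add, map_add]
          exact add_mem hx hy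
      have h3 := h2 _ hw
      have h4 : (P.complex.d 1 0).hom ((P.complex.d 2 1).hom w) = 0 :=
        congrArg (fun g => g.hom w) (P.complex.d_comp_d 2 1 0)
      rw [map_sub, h4, sub_zero, hη, map_smul] at h3
      have h5 : x = x • ψ.hom ξ - x * (ψ.hom ξ - 1) := by
        rw [mul_sub, mul_one, smul_eq_mul, sub_sub_cancel]
      rw [h5]
      refine sub_mem h3 (Ideal.mul_mem_mul hx ?_)
      rw [RingHom.mem_ker, map_sub, map_one, sub_eq_zero]
      exact (hψ ξ).trans hξ
    · intro h
      obtain ⟨θ, hθ, hd⟩ := exists_d_eq_smul_of_mem_sq ξ x h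
      obtain ⟨w, hw⟩ := exists_d_eq_of_d_eq_zero P (η - θ) (by rw [map_sub, hη, hd, sub_self])
      exact ⟨w, by rw [hw, sub_sub_cancel]; exact hθ⟩

include hξ in
/-- The relation `EOneRel` may be checked on any resolution. -/
lemma EOneRel.of_isTorClass (P' : ProjectiveResolution (leftRestrict φ)) (ξ' : P'.complex.X 0)
    (η : P'.complex.X 1) (x : A) (hx : φ x = 0) (t : torBB φ 1)
    (hξ' : (augmentation P').hom ξ' = (1 : B)) (hη : (P'.complex.d 1 0).hom η = x • ξ')
    (h : IsTorClass φ.toRingHom P' 1 η t) : EOneRel hφ ξ t (conormalMk φ hφ x hx) := by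
  obtain ⟨l, hl⟩ := exists_resolution_lift P' P (𝟙 _)
  have h1 := EOneRel.of_d_eq hφ hξ hx (ξ' := (l.f 0).hom ξ') (η := (l.f 1).hom η) 1
    (((hl ξ').trans hξ').trans (map_one φ).symm) (by
      rw [← map_smul, ← hη]
      exact congrArg (fun g => g.hom η) (l.comm 1 0)) (h.map_id l hl)
  simpa only [mul_one] using h1

end LowDegree

/-! ### Morphisms from the terms of the bar resolution -/

section FreeMaps

open ModuleCat.Algebra

variable {k : Type v} [Field k] {B : Type u} [Ring B] [Algebra k B]
  {M N : ModuleCat.{u} (B ⊗[k] Bᵐᵒᵖ)}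

lemma algebraMap_tmul_one (c : k) :
    (algebraMap k B c ⊗ₜ[k] (1 : Bᵐᵒᵖ) : B ⊗[k] Bᵐᵒᵖ) = (1 : B) ⊗ₜ[k] op (algebraMap k B c) := by
  rw [Algebra.algebraMap_eq_smul_one, op_smul, op_one, TensorProduct.smul_tmul]

/-- The morphism of bimodules `b ⊗ x ↦ b l(x)` that extends a map `l` of right modules. -/
def barExtend (l : M →+ N) (hl : ∀ (c : B) (x : M), l (((1 : B) ⊗ₜ[k] op c : B ⊗[k] Bᵐᵒᵖ) • x) =
    ((1 : B) ⊗ₜ[k] op c : B ⊗[k] Bᵐᵒᵖ) • l x) : (barFunctor k B).obj M ⟶ N :=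
  barLift
    (TensorProduct.liftAddHom (R := k) (M := B) (N := M)
      (AddMonoidHom.mk' (fun b => (DistribSMul.toAddMonoidHom N
          (b ⊗ₜ[k] (1 : Bᵐᵒᵖ) : B ⊗[k] Bᵐᵒᵖ)).comp l) fun b b' => by
        ext x
        change ((b + b') ⊗ₜ[k] (1 : Bᵐᵒᵖ) : B ⊗[k] Bᵐᵒᵖ) • l x = _
        rw [TensorProduct.add_tmul, add_smul]
        rfl)
      (fun c b x => by
        change ((c • b) ⊗ₜ[k] (1 : Bᵐᵒᵖ) : B ⊗[k] Bᵐᵒᵖ) • l x =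
          (b ⊗ₜ[k] (1 : Bᵐᵒᵖ) : B ⊗[k] Bᵐᵒᵖ) •
            l ((algebraMap k B c ⊗ₜ[k] (1 : Bᵐᵒᵖ) : B ⊗[k] Bᵐᵒᵖ) • x)
        rw [algebraMap_tmul_one, hl, smul_smul, ← algebraMap_tmul_one,
          Algebra.TensorProduct.tmul_mul_tmul, ← Algebra.commutes, ← Algebra.smul_def, mul_one]))
    (fun b c x m => by
      change ((b * x) ⊗ₜ[k] (1 : Bᵐᵒᵖ) : B ⊗[k] Bᵐᵒᵖ) •
          l (((1 : B) ⊗ₜ[k] op c.unop : B ⊗[k] Bᵐᵒᵖ) • m) =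
        (b ⊗ₜ[k] c : B ⊗[k] Bᵐᵒᵖ) • (x ⊗ₜ[k] (1 : Bᵐᵒᵖ) : B ⊗[k] Bᵐᵒᵖ) • l m
      rw [hl, smul_smul, smul_smul]
      simp)

/-- The map of right modules `B → N` that sends `1` to `n`. -/
def rightSpan (n : N) : barObj k B 0 →+ N :=
  AddMonoidHom.mk' (fun b => ((1 : B) ⊗ₜ[k] op (show B from b) : B ⊗[k] Bᵐᵒᵖ) • n) (fun x y => by
    refine Eq.trans ?_ (add_smul _ _ _)
    rw [← TensorProduct.tmul_add]
    rfl)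

lemma rightSpan_smul (n : N) (c : B) (x : barObj k B 0) :
    rightSpan n (((1 : B) ⊗ₜ[k] op c : B ⊗[k] Bᵐᵒᵖ) • x) =
      ((1 : B) ⊗ₜ[k] op c : B ⊗[k] Bᵐᵒᵖ) • rightSpan n x := by
  change B at x
  change ((1 : B) ⊗ₜ[k] op ((1 : B) * (x * c)) : B ⊗[k] Bᵐᵒᵖ) • n =
    ((1 : B) ⊗ₜ[k] op c : B ⊗[k] Bᵐᵒᵖ) • ((1 : B) ⊗ₜ[k] op x : B ⊗[k] Bᵐᵒᵖ) • n
  rw [smul_smul, Algebra.TensorProduct.tmul_mul_tmul, one_mul, one_mul, op_mul]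

/-- The morphism of bimodules `B ⊗ B → N` that sends `1 ⊗ 1` to `n`. -/
def barHomOne (n : N) : barObj k B 1 ⟶ N := barExtend (rightSpan n) (rightSpan_smul n)

lemma barHomOne_mk (n : N) (b b' : B) :
    (barHomOne n).hom (barTmul k b (barOf k b')) = (b ⊗ₜ[k] op b' : B ⊗[k] Bᵐᵒᵖ) • n := by
  change (b ⊗ₜ[k] (1 : Bᵐᵒᵖ) : B ⊗[k] Bᵐᵒᵖ) • ((1 : B) ⊗ₜ[k] op b' : B ⊗[k] Bᵐᵒᵖ) • n = _
  rw [smul_smul, Algebra.TensorProduct.tmul_mul_tmul, one_mul, mul_one]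

/-- The map `b ⊗ b' ↦ q(b) b'` of right modules `B ⊗ B → N`, for a linear map `q : B → N`. -/
def rightExtend (q : B →ₗ[k] N) : barObj k B 1 →+ N :=
  TensorProduct.liftAddHom (R := k) (M := B) (N := barObj k B 0)
    (AddMonoidHom.mk' (fun b => rightSpan (q b)) (fun x y => by
      ext z
      exact (congrArg (((1 : B) ⊗ₜ[k] op (show B from z) : B ⊗[k] Bᵐᵒᵖ) • ·)
        (map_add q x y)).trans (smul_add _ _ _)))
    (fun c b b' => by
      change B at b'
      change ((1 : B) ⊗ₜ[k] op b' : B ⊗[k] Bᵐᵒᵖ) • q (c • b) =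
        ((1 : B) ⊗ₜ[k] op (algebraMap k B c * (b' * 1)) : B ⊗[k] Bᵐᵒᵖ) • q b
      rw [map_smul, mul_one, ← Algebra.smul_def, op_smul, TensorProduct.tmul_smul,
        smul_comm, smul_assoc])

lemma rightExtend_smul (q : B →ₗ[k] N) (c : B) (x : barObj k B 1) :
    rightExtend q (((1 : B) ⊗ₜ[k] op c : B ⊗[k] Bᵐᵒᵖ) • x) =
      ((1 : B) ⊗ₜ[k] op c : B ⊗[k] Bᵐᵒᵖ) • rightExtend q x := by
  induction x using barObj_induction with
  | zero => rw [smul_zero, map_zero, smul_zero]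
  | add x y hx hy => rw [smul_add, map_add, map_add, smul_add, hx, hy]
  | mk b x =>
    rw [right_smul_barTmul]
    exact rightSpan_smul (q b) c x

/-- The morphism of bimodules `B ⊗ B ⊗ B → N` that sends `1 ⊗ b ⊗ 1` to `q(b)`, for a linear map
`q : B → N`. -/
def barHomTwo (q : B →ₗ[k] N) : barObj k B 2 ⟶ N := barExtend (rightExtend q) (rightExtend_smul q)

lemma barHomTwo_mk (q : B →ₗ[k] N) (b₀ b b' : B) :
    (barHomTwo q).hom (barTmul k b₀ (barTmul k b (barOf k b'))) =
      (b₀ ⊗ₜ[k] op b' : B ⊗[k] Bᵐᵒᵖ) • q b := by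
  change (b₀ ⊗ₜ[k] (1 : Bᵐᵒᵖ) : B ⊗[k] Bᵐᵒᵖ) • ((1 : B) ⊗ₜ[k] op b' : B ⊗[k] Bᵐᵒᵖ) • q b = _
  rw [smul_smul, Algebra.TensorProduct.tmul_mul_tmul, one_mul, mul_one]

lemma smul_barTmul_one (b b' : B) : (b ⊗ₜ[k] op b' : B ⊗[k] Bᵐᵒᵖ) • barTmul k 1 (barOf k (1 : B)) =
    barTmul k b (barOf k b') := by
  refine (smul_barMk (M := barObj k B 0) b (op b') 1 (1 : B)).trans ?_
  rw [mul_one]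
  refine congrArg (barTmul k b) ?_
  change (1 : B) * (1 * b') = b'
  rw [one_mul, one_mul]

lemma smul_barTmul_two (b b₁ b' : B) :
    (b ⊗ₜ[k] op b' : B ⊗[k] Bᵐᵒᵖ) • barTmul k 1 (barTmul k b₁ (barOf k (1 : B))) =
      barTmul k b (barTmul k b₁ (barOf k b')) := by
  refine (smul_barMk (M := barObj k B 1) b (op b') 1 _).trans ?_
  rw [mul_one]
  refine congrArg (barTmul k b) ?_
  refine (right_smul_barTmul (op b') b₁ (barOf k (1 : B))).trans (congrArg (barTmul k b₁) ?_)
  change (1 : B) * (1 * b') = b'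
  rw [one_mul, one_mul]

lemma smul_barMk₄ (b b₁ b₂ b' : B) : (b ⊗ₜ[k] op b' : B ⊗[k] Bᵐᵒᵖ) • barMk₄ (k := k) 1 b₁ b₂ 1 =
    barMk₄ b b₁ b₂ b' := by
  refine (smul_barMk (M := barObj k B 2) b (op b') 1 _).trans ?_
  rw [mul_one]
  refine congrArg (barTmul k b) ?_
  exact (right_smul_barTmul (op b') b₁ _).trans (congrArg (barTmul k b₁)
    ((right_smul_barTmul (op b') b₂ _).trans (congrArg (barTmul k b₂)
      ((one_mul (M := B) _).trans (one_mul (M := B) b')))))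

lemma bar_hom_ext_one {g h : barObj k B 1 ⟶ N}
    (H : g.hom (barTmul k 1 (barOf k (1 : B))) = h.hom (barTmul k 1 (barOf k (1 : B)))) :
    g = h := by
  ext x
  induction x using barObj_induction with
  | zero => rw [map_zero, map_zero]
  | add x y hx hy => rw [map_add, map_add, hx, hy]
  | mk b x =>
    rw [show barTmul k b x = _ from (smul_barTmul_one b (show B from x)).symm, map_smul, map_smul,
      H]

lemma bar_hom_ext_two {g h : barObj k B 2 ⟶ N}
    (H : ∀ b, g.hom (barTmul k 1 (barTmul k b (barOf k (1 : B)))) =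
      h.hom (barTmul k 1 (barTmul k b (barOf k (1 : B))))) : g = h := by
  ext x
  induction x using barObj_induction with
  | zero => rw [map_zero, map_zero]
  | add x y hx hy => rw [map_add, map_add, hx, hy]
  | mk b x =>
    induction x using barObj_induction with
    | zero => rw [barTmul_zero, map_zero, map_zero]
    | add x y hx hy => rw [barTmul_add, map_add, map_add, hx, hy]
    | mk b₁ x =>
      rw [show barTmul k b (barTmul k b₁ x) = _ from (smul_barTmul_two b b₁ (show B from x)).symm,
        map_smul, map_smul, H]

lemma bar_hom_ext_three {g h : barObj k B 3 ⟶ N}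
    (H : ∀ b b', g.hom (barMk₄ 1 b b' 1) = h.hom (barMk₄ 1 b b' 1)) : g = h := by
  ext x
  induction x using barObj_induction with
  | zero => rw [map_zero, map_zero]
  | add x y hx hy => rw [map_add, map_add, hx, hy]
  | mk b x =>
    induction x using barObj_induction with
    | zero => rw [barTmul_zero, map_zero, map_zero]
    | add x y hx hy => rw [barTmul_add, map_add, map_add, hx, hy]
    | mk b₁ x =>
      induction x using barObj_induction with
      | zero => rw [barTmul_zero, barTmul_zero, map_zero, map_zero]
      | add x y hx hy => rw [barTmul_add, barTmul_add, map_add, map_add, hx, hy]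
      | mk b₂ x =>
        rw [show barTmul k b (barTmul k b₁ (barTmul k b₂ x)) = _ from
          (smul_barMk₄ b b₁ b₂ (show B from x)).symm, map_smul, map_smul, H]

lemma barD_one_mk (b₀ b₁ b₂ : B) :
    (barD k B 1).hom (barTmul k b₀ (barTmul k b₁ (barOf k b₂))) =
      barTmul k (b₀ * b₁) (barOf k b₂) - barTmul k b₀ (barOf k (b₁ * b₂)) := by
  rw [barD_tmul, left_smul_barTmul, barD_zero_tmul, smul_barObj_zero]

lemma barD_two_mk (b₀ b₁ b₂ b₃ : B) :
    (barD k B 2).hom (barMk₄ b₀ b₁ b₂ b₃) =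
      barTmul k (b₀ * b₁) (barTmul k b₂ (barOf k b₃)) -
        barTmul k b₀ (barTmul k (b₁ * b₂) (barOf k b₃)) +
          barTmul k b₀ (barTmul k b₁ (barOf k (b₂ * b₃))) := by
  rw [barMk₄, barD_tmul, left_smul_barTmul, barD_one_mk, barTmul_sub]
  abel

end FreeMaps

/-! ### The class `O₁(φ)` is the characteristic class -/

section CharacteristicClass

variable {k : Type v} [Field k] {A B : Type u} [Ring A] [Ring B] [Algebra k A] [Algebra k B]
  {φ : A →ₐ[k] B} (hφ : Function.Surjective φ)

/-- A class is not changed by subtracting a boundary from its representative. -/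
lemma IsTorClass.sub_boundary {R S : Type u} [Ring R] [Ring S] {f : R →+* S} {M : ModuleCat.{u} R}
    {P : ProjectiveResolution M} {q : ℕ} {x : P.complex.X q} {t : (torFunctor f q).obj M}
    (h : IsTorClass f P 1 x t) (w : P.complex.X (q + 1)) :
    IsTorClass f P 1 (x - (P.complex.d (q + 1) q).hom w) t := by
  obtain ⟨t', ht'⟩ := exists_isTorClass P (f := f) 1 ((P.complex.d (q + 1) q).hom w) (fun j => by
    have h1 : (P.complex.d q j).hom ((P.complex.d (q + 1) q).hom w) = 0 :=
      congrArg (fun g => g.hom w) (P.complex.d_comp_d (q + 1) q j)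
    rw [h1, baseChangeMk_zero])
  have h0 : t' = 0 := ht'.eq_zero_iff.2 ⟨baseChangeMk f 1 w, rfl⟩
  have h2 := h.sub ht'
  rwa [h0, sub_zero] at h2

/-- A linear section of `A/I² → B` lifts to a linear section of `φ`. -/
lemma exists_lift_section (σ : B →ₗ[k] A ⧸ (RingHom.ker φ) ^ 2)
    (hσ : ∀ b, (squareZeroQuotient φ hφ).proj (σ b) = b) :
    ∃ s : B →ₗ[k] A, (∀ b, Ideal.Quotient.mk ((RingHom.ker φ) ^ 2) (s b) = σ b) ∧
      ∀ b, φ (s b) = b := by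
  obtain ⟨s, hs⟩ := Module.projective_lifting_property
    (Ideal.Quotient.mkₐ k ((RingHom.ker φ) ^ 2)).toLinearMap σ Ideal.Quotient.mk_surjective
  have hs' : ∀ b, Ideal.Quotient.mk ((RingHom.ker φ) ^ 2) (s b) = σ b := fun b =>
    DFunLike.congr_fun hs b
  refine ⟨s, hs', fun b => ?_⟩
  rw [← hσ b, ← hs']
  exact congrArg φ (congrArg s (congrArg (squareZeroQuotient φ hφ).proj (hs' b) |>.trans (hσ b)))

lemma factorSet_eq_conormalMk (σ : B →ₗ[k] A ⧸ (RingHom.ker φ) ^ 2)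
    (hσ : ∀ b, (squareZeroQuotient φ hφ).proj (σ b) = b) (s : B →ₗ[k] A)
    (hs : ∀ b, Ideal.Quotient.mk ((RingHom.ker φ) ^ 2) (s b) = σ b) (b b' : B)
    (h : φ (s b * s b' - s (b * b')) = 0) :
    (squareZeroQuotient φ hφ).factorSet σ hσ b b' =
      conormalMk φ hφ (s b * s b' - s (b * b')) h := by
  let p := Ideal.Quotient.mk ((RingHom.ker φ) ^ 2)
  have h1 := (map_sub p (s b * s b') (s (b * b'))).trans (congrArg₂ (· - ·)
    ((map_mul p (s b) (s b')).trans (congrArg₂ (· * ·) (hs b) (hs b'))) (hs (b * b')))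
  exact SingularExtension.Ker.ext (S := squareZeroQuotient φ hφ) h1.symm

variable (k) in
/-- The element `1 ⊗ a ⊗ 1` of the bar resolution. -/
def barMid (a : A) : barObj k A 2 := barTmul k 1 (barTmul k a (barOf k 1))

open ModuleCat.Algebra in
lemma barMid_sub (a a' : A) : barMid k (a - a') = barMid k a - barMid k a' := by
  refine Eq.trans ?_ (barTmul_sub _ _ _)
  exact congrArg (barTmul k (1 : A)) (TensorProduct.sub_tmul a a' (barOf k (1 : A)))

open ModuleCat.Algebra in
lemma barMid_add (a a' : A) : barMid k (a + a') = barMid k a + barMid k a' := by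
  refine Eq.trans ?_ (barTmul_add _ _ _)
  exact congrArg (barTmul k (1 : A)) (TensorProduct.add_tmul a a' (barOf k (1 : A)))

open ModuleCat.Algebra in
lemma barMid_smul (c : k) (a : A) : barMid k (c • a) =
    (algebraMap k A c ⊗ₜ[k] (1 : Aᵐᵒᵖ) : A ⊗[k] Aᵐᵒᵖ) • barMid k a := by
  have h1 : barMid k (c • a) = barTmul k (1 : A) (c • barTmul k a (barOf k (1 : A))) :=
    congrArg (barTmul k (1 : A)) (algebra_smul_barObj c a (barOf k (1 : A))).symm
  have h2 : barTmul k (1 : A) (c • barTmul k a (barOf k (1 : A))) = barTmul k (c • (1 : A))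
      (barTmul k a (barOf k (1 : A))) :=
    (TensorProduct.smul_tmul c (1 : A) (barTmul k a (barOf k (1 : A)))).symm
  rw [h1, h2, Algebra.smul_def, ← left_smul_barTmul]
  rfl

/-- If `φ(i) = 0`, then `κ₁` and `e₁` map the class of `1 ⊗ i ⊗ 1` to the class of `i`. -/
lemma exists_kappaRel_barMid (i : A) (hi : φ i = 0) :
    ∃ t t', IsTorClass (envMap φ).toRingHom (barResolution k A) (q := 1) 1 (barMid k i) t ∧
      KappaRel hφ 1 t t' ∧
      IsTorClass φ.toRingHom (quotBarResolution φ hφ) 1 (quotBarCls φ hφ 1 (barMid k i)) t' ∧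
      ((quotBarResolution φ hφ).complex.d 1 0).hom (quotBarCls φ hφ 1 (barMid k i)) =
        i • quotBarCls φ hφ 0 (barTmul k 1 (barOf k (1 : A))) := by
  have hd : ((quotBarResolution φ hφ).complex.d 1 0).hom (quotBarCls φ hφ 1 (barMid k i)) =
      i • quotBarCls φ hφ 0 (barTmul k 1 (barOf k (1 : A))) := by
    refine (quotBarCls_d φ hφ 0 _).trans ?_
    have h1 : (barD k A 1).hom (barMid k i) =
        (i ⊗ₜ[k] (1 : Aᵐᵒᵖ) : A ⊗[k] Aᵐᵒᵖ) • barTmul k 1 (barOf k (1 : A)) -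
          ((1 : A) ⊗ₜ[k] op i : A ⊗[k] Aᵐᵒᵖ) • barTmul k 1 (barOf k (1 : A)) := by
      rw [← op_one, smul_barTmul_one, smul_barTmul_one, barMid, barD_one_mk, one_mul, mul_one]
    refine (congrArg (quotBarMk φ 0) h1).trans ((quotBarMk_sub φ 0 _ _).trans ?_)
    rw [(quotBarMk_eq_zero_iff φ 0 _).2 (right_smul_mem_rightKer hi _), sub_zero]
    exact quotBarMk_smul φ 0 i _
  have hc : ∀ j, baseChangeMk φ.toRingHom (1 : B) (((quotBarResolution φ hφ).complex.d 1 j).hom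
          (quotBarCls φ hφ 1 (barMid k i))) = 0 := by
    intro j
    by_cases hj : j = 0
    · subst hj
      rw [hd, baseChangeMk_one_eq_zero_iff (f := φ.toRingHom) hφ]
      exact Submodule.smul_mem_smul hi Submodule.mem_top
    · rw [(quotBarResolution φ hφ).complex.shape 1 j (by simpa using hj)]
      exact baseChangeMk_zero _ _
  obtain ⟨t, ht⟩ := exists_isTorClass (barResolution k A) (f := (envMap φ).toRingHom) (q := 1) 1
    (barMid k i) ((bar_cycle_iff hφ 1 _).2 hc)
  obtain ⟨t', ht'⟩ := exists_isTorClass (quotBarResolution φ hφ) (f := φ.toRingHom) 1 _ hc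
  exact ⟨t, t', ht, ⟨_, ht, ht'⟩, ht', hd⟩

section BarToChange

variable {X : ProjectiveResolution (regularBimodule k A)}
  (f : (barResolution k A).complex ⟶ X.complex)

/-- The element `1 ⊗ f(x)` of `Bᵉ ⊗_{Aᵉ} X`, for `x` in the bar resolution of `A` and a morphism `f`
from the bar resolution to `X`. -/
def barToChange (φ : A →ₐ[k] B) (n : ℕ) (x : barObj k A (n + 1)) :
    (changeComplex (envMap φ).toRingHom X).X n :=
  baseChangeMk (envMap φ).toRingHom (1 : B ⊗[k] Bᵐᵒᵖ) ((f.f n).hom x)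

lemma bar_hom_d (n : ℕ) (x : barObj k A (n + 2)) :
    (X.complex.d (n + 1) n).hom ((f.f (n + 1)).hom x) =
      (f.f n).hom ((barD k A (n + 1)).hom x) :=
  (congrArg (fun g => g.hom x) (f.comm (n + 1) n)).trans
    (congrArg (f.f n).hom (barComplex_d_apply n x))

lemma barToChange_d (n : ℕ) (x : barObj k A (n + 2)) :
    ((changeComplex (envMap φ).toRingHom X).d (n + 1) n).hom (barToChange f φ (n + 1) x) =
      barToChange f φ n ((barD k A (n + 1)).hom x) :=
  congrArg (baseChangeMk (envMap φ).toRingHom (1 : B ⊗[k] Bᵐᵒᵖ)) (bar_hom_d f n x)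

lemma barToChange_sub (n : ℕ) (x y : barObj k A (n + 1)) :
    barToChange f φ n (x - y) = barToChange f φ n x - barToChange f φ n y :=
  (congrArg (baseChangeMk (envMap φ).toRingHom (1 : B ⊗[k] Bᵐᵒᵖ)) (map_sub (f.f n).hom x y)).trans
    (baseChangeMk_sub (envMap φ).toRingHom 1 _ _)

lemma barToChange_add (n : ℕ) (x y : barObj k A (n + 1)) :
    barToChange f φ n (x + y) = barToChange f φ n x + barToChange f φ n y :=
  (congrArg (baseChangeMk (envMap φ).toRingHom (1 : B ⊗[k] Bᵐᵒᵖ)) (map_add (f.f n).hom x y)).trans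
    (baseChangeMk_add (envMap φ).toRingHom 1 _ _)

lemma barToChange_smul (n : ℕ) (a a' : A) (x : barObj k A (n + 1)) :
    barToChange f φ n ((a ⊗ₜ[k] op a' : A ⊗[k] Aᵐᵒᵖ) • x) =
      (φ a ⊗ₜ[k] op (φ a') : B ⊗[k] Bᵐᵒᵖ) • barToChange f φ n x := by
  refine (congrArg (baseChangeMk (envMap φ).toRingHom (1 : B ⊗[k] Bᵐᵒᵖ))
    (map_smul (f.f n).hom (a ⊗ₜ[k] op a' : A ⊗[k] Aᵐᵒᵖ) x)).trans ?_
  rw [← baseChangeMk_map]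
  refine Eq.trans ?_ (smul_baseChangeMk (envMap φ).toRingHom _ _ _).symm
  rw [mul_one]
  rfl

open ModuleCat.Algebra in
/-- The linear map `b ↦ 1 ⊗ f(1 ⊗ s(b) ⊗ 1)`. -/
def barToChangeMid (φ : A →ₐ[k] B) (s : B →ₗ[k] A) :
    B →ₗ[k] (changeComplex (envMap φ).toRingHom X).X 1 where
  toFun b := barToChange f φ 1 (barMid k (s b))
  map_add' b b' := by
    rw [map_add, barMid_add]
    exact barToChange_add f 1 _ _
  map_smul' c b := by
    rw [map_smul, barMid_smul, ← op_one]
    refine (barToChange_smul f 1 _ _ _).trans ?_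
    rw [φ.commutes, map_one]
    rfl

end BarToChange

open Abelian in
/-- The class `O₁(φ)` is the characteristic class of `A/I²`. Lifting `1 ⊗ b ⊗ 1` to `1 ⊗ s(b) ⊗ 1`,
for a linear section `s` of `φ`, the obstruction to lifting the identity of `B` to a morphism from
the bar resolution of `B` to `Bᵉ ⊗ X` is the cocycle
`b₁ ⊗ b₂ ↦ 1 ⊗ (s(b₁) s(b₂) - s(b₁b₂)) ⊗ 1`. -/
lemma omega_eq_charClass (e₀ : torEnv φ 0 ≅ regularBimodule k B) (e₁ : torEnv φ 1 ≅ conormal φ hφ)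
    (h₀ : ∀ t, IsTorClass (envMap φ).toRingHom (barResolution k A) (q := 0) 1
      (barTmul k 1 (barOf k (1 : A))) t → e₀.hom.hom t = (1 : B))
    (h₁ : ∀ i (hi : φ i = 0) t, IsTorClass (envMap φ).toRingHom (barResolution k A) (q := 1) 1
      (barMid k i) t → e₁.hom.hom t = conormalMk φ hφ i hi)
    (X : ProjectiveResolution (regularBimodule k A)) (Y : InjectiveResolution (torEnv φ 1))
    (σ : B →ₗ[k] A ⧸ (RingHom.ker φ) ^ 2)
    (hσ : ∀ b, (squareZeroQuotient φ hφ).proj (σ b) = b) :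
    (Ext.mk₀ e₀.inv).comp ((omega φ 0 X Y).comp (Ext.mk₀ e₁.hom) (add_zero 2)) (zero_add 2) =
      (squareZeroQuotient φ hφ).charClass σ hσ := by
  obtain ⟨s, hs, hφs⟩ := exists_lift_section hφ σ hσ
  obtain ⟨f, hf⟩ := exists_resolution_lift (barResolution k A) X (𝟙 _)
  let F := (envMap φ).toRingHom
  let K := changeComplex F X
  let P := barResolution k B
  let n₀ : K.X 0 := barToChange f φ 0 (barTmul k 1 (barOf k (1 : A)))
  -- the components in degrees `0` and `1` of a lift `P ⟶ K` of the identity of `B`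
  let γ' : P.complex.X 0 ⟶ K.X 0 := barHomOne n₀
  let γ : P.complex.X 0 ⟶ K.cycles 0 := K.liftCycles γ' _ rfl (by
    rw [K.shape _ _ (by simp), Limits.comp_zero])
  have hγi : γ ≫ K.iCycles 0 = γ' := K.liftCycles_i _ _ _ _
  let β : P.complex.X 1 ⟶ K.X 1 := barHomTwo (N := K.X 1) (barToChangeMid f φ s)
  have hβ₁ : ∀ b₀ b b' : B, β.hom (barTmul k b₀ (barTmul k b (barOf k b'))) =
      (b₀ ⊗ₜ[k] op b' : B ⊗[k] Bᵐᵒᵖ) • barToChange f φ 1 (barMid k (s b)) :=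
    barHomTwo_mk (N := K.X 1) (barToChangeMid f φ s)
  have hβ : β ≫ K.d 1 0 = P.complex.d 1 0 ≫ γ ≫ K.iCycles 0 := by
    rw [hγi, show P.complex.d 1 0 = barD k B 1 from barComplex_d k B 0]
    refine bar_hom_ext_two (N := K.X 0) fun b => ?_
    have h1 : β.hom (barTmul k 1 (barTmul k b (barOf k (1 : B)))) =
        barToChange f φ 1 (barMid k (s b)) := hβ₁ 1 b 1 |>.trans (one_smul (B ⊗[k] Bᵐᵒᵖ) _)
    refine (congrArg (K.d 1 0).hom h1).trans ((barToChange_d f 0 _).trans ?_)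
    rw [barMid, barD_one_mk, one_mul, mul_one, ← smul_barTmul_one (s b) 1,
      ← smul_barTmul_one 1 (s b),
      barToChange_sub, barToChange_smul, barToChange_smul, hφs, map_one]
    refine Eq.trans ?_ (congrArg γ'.hom (barD_one_mk 1 b 1)).symm
    rw [one_mul, mul_one]
    refine Eq.trans ?_ (map_sub γ'.hom _ _).symm
    exact (congrArg₂ (· - ·) (barHomOne_mk n₀ b 1) (barHomOne_mk n₀ 1 b)).symm
  have hdβ : (P.complex.d 2 1 ≫ β) ≫ K.d 1 0 = 0 := by
    rw [Category.assoc, hβ, P.complex.d_comp_d_assoc, Limits.zero_comp]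
  let c : P.complex.X 2 ⟶ K.cycles 1 := K.liftCycles (P.complex.d 2 1 ≫ β) 0 (by simp) hdβ
  have hc : c ≫ K.iCycles 1 = P.complex.d 2 1 ≫ β := K.liftCycles_i _ _ _ _
  have hcd : P.complex.d 3 2 ≫ c = 0 := by
    rw [← cancel_mono (K.iCycles 1), Category.assoc, hc, P.complex.d_comp_d_assoc,
      Limits.zero_comp, Limits.zero_comp]
  have hγ : γ ≫ K.homologyπ 0 = P.π.f 0 ≫ e₀.inv ≫ (torIso F X 0).hom := by
    refine bar_hom_ext_one (N := K.homology 0) ?_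
    let z : K.cycles 0 := γ.hom (barTmul k 1 (barOf k (1 : B)))
    have hz : (K.iCycles 0).hom z = n₀ :=
      (congrArg (fun g => g.hom (barTmul k 1 (barOf k (1 : B)))) hγi).trans
        ((barHomOne_mk n₀ 1 1).trans (one_smul (B ⊗[k] Bᵐᵒᵖ) n₀))
    have ht : IsTorClass F X (q := 0) 1 ((f.f 0).hom (barTmul k 1 (barOf k (1 : A))))
      (torClass X 0 z) := ⟨z, hz, rfl⟩
    obtain ⟨t, ht'⟩ := exists_isTorClass (barResolution k A) (f := F) (q := 0) 1
      (barTmul k 1 (barOf k (1 : A))) (fun j => by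
        rw [(barResolution k A).complex.shape 0 j (by simp)]
        exact baseChangeMk_zero _ _)
    have h2 : torClass X 0 z = t := ht.unique (ht'.map_id f hf)
    have h3 : e₀.inv.hom (1 : B) = torClass X 0 z := by
      rw [h2, ← h₀ t ht']
      exact congrArg (fun g => g.hom t) e₀.hom_inv_id
    have h4 : (torIso F X 0).hom.hom (torClass X 0 z) = (K.homologyπ 0).hom z :=
      congrArg (fun g => g.hom ((K.homologyπ 0).hom z)) (torIso F X 0).inv_hom_id
    have h5 : (P.π.f 0).hom (barTmul k 1 (barOf k (1 : B))) = (1 : B) :=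
      (one_mul (1 * 1 : B)).trans (one_mul 1)
    exact h4.symm.trans (congrArg (torIso F X 0).hom.hom
      (h3.symm.trans (congrArg e₀.inv.hom h5.symm)))
  have hce : (c ≫ K.homologyπ 1 ≫ (torIso F X 1).inv) ≫ e₁.hom =
      cochainHom ((squareZeroQuotient φ hφ).factorSet σ hσ) := by
    refine bar_hom_ext_three (N := conormal φ hφ) fun b b' => ?_
    let z : K.cycles 1 := c.hom (barMk₄ (k := k) 1 b b' 1)
    -- the cocycle maps `1 ⊗ b ⊗ b' ⊗ 1` to the class of `f(dw + 1 ⊗ (s(b) s(b') - s(b b')) ⊗ 1)`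
    let w : barObj k A 3 := barMk₄ 1 (s b) (s b') 1
    have hi : φ (s b * s b' - s (b * b')) = 0 := by
      rw [map_sub, map_mul, hφs, hφs, hφs, sub_self]
    let y : barObj k A 2 := (barD k A 2).hom w + barMid k (s b * s b' - s (b * b'))
    have hz : (K.iCycles 1).hom z = barToChange f φ 1 y := by
      refine (congrArg (fun g => g.hom (barMk₄ (k := k) 1 b b' 1)) hc).trans ?_
      refine (congrArg (fun g => β.hom (g.hom (barMk₄ (k := k) 1 b b' 1)))
        (barComplex_d k B 1)).trans ?_
      refine (congrArg β.hom (barD_two_mk 1 b b' 1)).trans ?_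
      refine (map_add β.hom _ _).trans ?_
      refine (congrArg (· + _) (map_sub β.hom _ _)).trans ?_
      refine (congrArg₂ (· + ·) (congrArg₂ (· - ·) (hβ₁ _ _ _) (hβ₁ _ _ _)) (hβ₁ _ _ _)).trans ?_
      have hy : y = (s b ⊗ₜ[k] op (1 : A) : A ⊗[k] Aᵐᵒᵖ) • barMid k (s b') -
          barMid k (s (b * b')) + ((1 : A) ⊗ₜ[k] op (s b') : A ⊗[k] Aᵐᵒᵖ) • barMid k (s b) := by
        simp only [y, w, barMid_sub]
        rw [barD_two_mk, one_mul, mul_one, barMid, barMid, barMid, barMid, smul_barTmul_two,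
          smul_barTmul_two]
        abel
      rw [hy, barToChange_add, barToChange_sub, barToChange_smul, barToChange_smul, hφs, hφs,
        map_one, one_mul, mul_one]
      exact congrArg (fun v => _ - v + _) (one_smul (B ⊗[k] Bᵐᵒᵖ) _)
    have ht : IsTorClass F X (q := 1) 1 ((f.f 1).hom y) (torClass X 1 z) := ⟨z, hz, rfl⟩
    have ht₂ := ht.sub_boundary ((f.f 2).hom w)
    have hy : (f.f 1).hom y - (X.complex.d 2 1).hom ((f.f 2).hom w) =
        (f.f 1).hom (barMid k (s b * s b' - s (b * b'))) := by
      rw [bar_hom_d]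
      refine (map_sub (f.f 1).hom y _).symm.trans (congrArg (f.f 1).hom ?_)
      exact add_sub_cancel_left ((barD k A 2).hom w) _
    rw [hy] at ht₂
    obtain ⟨t, -, ht₃, -⟩ := exists_kappaRel_barMid hφ _ hi
    have h2 : torClass X 1 z = t := ht₂.unique (ht₃.map_id f hf)
    refine (congrArg e₁.hom.hom h2).trans ((h₁ _ hi t ht₃).trans ?_)
    refine (factorSet_eq_conormalMk hφ σ hσ s hs b b' hi).symm.trans ?_
    refine Eq.trans ?_ (cochainHom_mk ((squareZeroQuotient φ hφ).factorSet σ hσ) 1 b b' 1).symm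
    exact (one_smul (B ⊗[k] Bᵐᵒᵖ) _).symm
  have hu : P.complex.d 3 2 ≫ c ≫ K.homologyπ 1 ≫ (torIso F X 1).inv = 0 := by
    rw [reassoc_of% hcd, Limits.zero_comp]
  have main := mk₀_comp_extD₂_mk₀ K Y P (e₀.inv ≫ (torIso F X 0).hom) (torIso F X 1).inv γ hγ β hβ
    c hc hu
  have ho : omega φ 0 X Y = (Ext.mk₀ (torIso F X 0).hom).comp
      (extD₂ K Y 0 0 (Ext.mk₀ (torIso F X 1).inv)) (zero_add 2) := by
    change (Ext.mk₀ (torIso F X 0).hom).comp (extD₂ K Y 0 0 ((Ext.mk₀ (torIso F X 1).inv).comp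
      (Ext.mk₀ (𝟙 (torEnv φ 1))) (zero_add 0))) (zero_add 2) = _
    rw [Ext.mk₀_comp_mk₀, Category.comp_id]
  rw [ho, ← Ext.comp_assoc_of_third_deg_zero, Ext.mk₀_comp_mk₀_assoc, main, P.extMk_comp_mk₀]
  simp only [hce]
  rfl

end CharacteristicClass

theorem mainTheorem6 {k : Type v} {A B : Type u} [Field k] [Ring A] [Ring B] [Algebra k A]
    [Algebra k B] (φ : A →ₐ[k] B) (hφ : Function.Surjective φ) :
    ∃ (κ : ∀ q, torEnv φ q ≅ torBB φ q) (e₀ : torBB φ 0 ≅ regularBimodule k B)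
      (e₁ : torBB φ 1 ≅ conormal φ hφ),
      (∀ (q : ℕ) (X : ProjectiveResolution (regularBimodule k A))
        (P : ProjectiveResolution (leftRestrict φ)) (g : leftComplex X.complex ⟶ P.complex),
        (∀ x : X.complex.X 0, (augmentation P).hom ((g.f 0).hom x) =
          φ ((augmentation X).hom x)) →
        (∀ (n : ℕ) (a : A) (x : X.complex.X n), φ a = 0 →
          (g.f n).hom (((1 : A) ⊗ₜ[k] op a : A ⊗[k] Aᵐᵒᵖ) • x) = 0) →
        ∀ (x : X.complex.X q) (t : torEnv φ q) (t' : torBB φ q),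
          IsTorClass (envMap φ).toRingHom X 1 x t → IsTorClass φ.toRingHom P 1 ((g.f q).hom x) t' → (κ q).hom.hom t = t') ∧
      (∀ (P : ProjectiveResolution (leftRestrict φ)) (b : B) (y : P.complex.X 0) (t : torBB φ 0),
        IsTorClass φ.toRingHom P b y t → e₀.hom.hom t = b * (show B from (augmentation P).hom y)) ∧
      (∀ (P : ProjectiveResolution (leftRestrict φ)) (ξ : P.complex.X 0) (η : P.complex.X 1)
        (x : A) (hx : φ x = 0) (t : torBB φ 1),
        (augmentation P).hom ξ = (1 : B) → (P.complex.d 1 0).hom η = x • ξ →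
        IsTorClass φ.toRingHom P 1 η t → e₁.hom.hom t = conormalMk φ hφ x hx) ∧
      ∀ (X : ProjectiveResolution (regularBimodule k A)) (Y : InjectiveResolution (torEnv φ 1))
        (σ : B →ₗ[k] A ⧸ (RingHom.ker φ) ^ 2)
        (hσ : ∀ b, (squareZeroQuotient φ hφ).proj (σ b) = b),
        (Abelian.Ext.mk₀ (κ 0 ≪≫ e₀).inv).comp
          ((omega φ 0 X Y).comp (Abelian.Ext.mk₀ (κ 1 ≪≫ e₁).hom) (add_zero 2)) (zero_add 2) =
            (squareZeroQuotient φ hφ).charClass σ hσ := by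
  choose κ hκ using exists_kappa hφ
  let P := quotBarResolution φ hφ
  let ξ : P.complex.X 0 := quotBarCls φ hφ 0 (barTmul k 1 (barOf k (1 : A)))
  have hξ : (augmentation P).hom ξ = (1 : B) :=
    (quotBar_augmentation φ hφ _).trans
      ((congrArg φ ((one_mul (M := A) _).trans (one_mul (M := A) _))).trans (map_one φ))
  obtain ⟨e₀, he₀⟩ := exists_eZero hφ P
  obtain ⟨e₁, he₁⟩ := exists_eOne hφ hξ
  refine ⟨κ, e₀, e₁, ?_, ?_, ?_, ?_⟩
  · intro q X P g hg hgI x t t' hx hx'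
    exact hκ q t t' (KappaRel.of_isTorClass hφ q X P g hg hgI x t t' hx hx')
  · intro P' b y t h
    exact he₀ _ _ (EZeroRel.of_isTorClass hφ P P' b y t h)
  · intro P' ξ' η x hx t hξ' hη h
    exact he₁ _ _ (EOneRel.of_isTorClass hφ hξ P' ξ' η x hx t hξ' hη h)
  · refine omega_eq_charClass hφ (κ 0 ≪≫ e₀) (κ 1 ≪≫ e₁) (fun t ht => ?_) (fun i hi t ht => ?_)
    · obtain ⟨t', ht'⟩ := exists_isTorClass P (f := φ.toRingHom) (q := 0) 1 ξ (fun j => by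
        rw [P.complex.shape 0 j (by simp)]
        exact baseChangeMk_zero _ _)
      exact (congrArg e₀.hom.hom (hκ 0 t t' ⟨_, ht, ht'⟩)).trans (he₀ t' (1 : B) ⟨ξ, ht', hξ⟩)
    · obtain ⟨t₁, t', ht₁, h, ht', hd⟩ := exists_kappaRel_barMid hφ i hi
      obtain rfl := ht.unique ht₁
      refine (congrArg e₁.hom.hom (hκ 1 _ _ h)).trans (he₁ _ _ ⟨_, i, hi, hd, ht', rfl⟩)

end
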